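/- Let $n\ge 2$ be an integer and let $q>1$ be a real number. Let $\sigma$ be the normalized surface measure on the unit sphere $\mathbb{S}^{n-1}\subset\mathbb{R}^n$, and let $$ m=\frac{|y_1\cdots y_n|^{\frac2q-1}\,\sigma}{\int_{\mathbb{S}^{n-1}}|y_1\cdots y_n|^{\frac2q-1}\,d\sigma}, $$ which is a well-defined probability measure on $\mathbb{S}^{n-1}$. Then the smallest constant $C$ such that $$ \int_{\mathbb{S}^{n-1}} f^2\,dm-\Bigl(\int_{\mathbb{S}^{n-1}} f\,dm\Bigr)^2\le C\int_{\mathbb{S}^{n-1}}|\nabla_{\mathbb{S}^{n-1}}f|^2\,dm $$ holds for every even (i.e. $f(-y)=f(y)$) locally Lipschitz function $f:\mathbb{S}^{n-1}\to\mathbb{R}$ is $$ C_m=\max\Bigl(\frac{q}{4n},\ \frac{q^2}{8(q-1)(n+q-2)}\Bigr). $$ Here $\nabla_{\mathbb{S}^{n-1}}f$ is the spherical (tangential) gradient, which exists almost everywhere. The smallest constant is the same if only even functions $f\in C^\infty(\mathbb{S}^{n-1})$ are considered. -/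

import Mathlib

open MeasureTheory ProbabilityTheory Set
open scoped ContDiff

noncomputable section

/-- The unit sphere `S^{n-1}` of the Euclidean space `ℝⁿ`. -/
abbrev UnitSphere (n : ℕ) : Type := Metric.sphere (0 : EuclideanSpace ℝ (Fin n)) 1

/-- The normalized (probability) surface measure `σ` on `S^{n-1}`. -/
def sphereSigma (n : ℕ) : Measure (UnitSphere n) :=
  ((volume : Measure (EuclideanSpace ℝ (Fin n))).toSphere univ)⁻¹ •
    (volume : Measure (EuclideanSpace ℝ (Fin n))).toSphere

/-- The weight `|y₁ ⋯ yₙ|^(2/q - 1)`. -/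
def sphereWeight (n : ℕ) (q : ℝ) (y : UnitSphere n) : ℝ :=
  |∏ i, y.1 i| ^ (2 / q - 1)

/-- The measure `m = |y₁ ⋯ yₙ|^(2/q - 1) σ / ∫ |y₁ ⋯ yₙ|^(2/q - 1) dσ` on `S^{n-1}`. -/
def measureM (n : ℕ) (q : ℝ) : Measure (UnitSphere n) :=
  (sphereSigma n).withDensity fun y =>
    ENNReal.ofReal (sphereWeight n q y / ∫ z, sphereWeight n q z ∂(sphereSigma n))

theorem norm_inv_smul_mem_sphere {n : ℕ} {x : EuclideanSpace ℝ (Fin n)} (hx : x ≠ 0) :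
    ‖x‖⁻¹ • x ∈ Metric.sphere (0 : EuclideanSpace ℝ (Fin n)) 1 := by
  simp [norm_smul, inv_mul_cancel₀ (norm_ne_zero_iff.mpr hx)]

open Classical in
/-- The 0-homogeneous extension `x ↦ f (x / |x|)` of a function on the sphere to `ℝⁿ \ {0}`
(given the value `0` at the origin, which plays no role). -/
def homogExt {n : ℕ} (f : UnitSphere n → ℝ) (x : EuclideanSpace ℝ (Fin n)) : ℝ :=
  if hx : x = 0 then 0 else f ⟨‖x‖⁻¹ • x, norm_inv_smul_mem_sphere hx⟩

/-- The spherical gradient of `f` at `y`: the Euclidean gradient at `y` of the 0-homogeneous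
extension of `f`. It is tangent to the sphere, and it is the tangential projection of the gradient
of any differentiable extension of `f`. For a locally Lipschitz `f` it exists
almost everywhere. -/
def sphereGrad {n : ℕ} (f : UnitSphere n → ℝ) (y : UnitSphere n) : EuclideanSpace ℝ (Fin n) :=
  gradient (homogExt f) y.1

/-- `f` is a smooth function on the manifold `S^{n-1}`. -/
def SphereSmooth {n : ℕ} (f : UnitSphere n → ℝ) : Prop :=
  ContDiffOn ℝ ∞ (homogExt f) {0}ᶜ

/-- The measure `μ` on the sphere satisfies the Poincaré inequality with constant `C`,
`Var_μ f ≤ C ∫ |∇f|² dμ`, for all even functions `f` in the class `𝓕`. -/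
def EvenPoincare {n : ℕ} (μ : Measure (UnitSphere n)) (𝓕 : (UnitSphere n → ℝ) → Prop)
    (C : ℝ) : Prop :=
  ∀ f : UnitSphere n → ℝ, 𝓕 f → (∀ y, f (-y) = f y) →
    variance f μ ≤ C * ∫ y, ‖sphereGrad f y‖ ^ 2 ∂μ

end

/-! Put `β = 2/q - 1` and `α = 1 - β = 2 - 2/q`, and let `ν` be the probability measure on the line
with density proportional to `|t|^β e^{-t²/2}`. Under `ν^n` the radius `|x|` and the direction
`x/|x|` are independent, and the direction has law `m`. The sphere can therefore be studied through
homogeneous functions on `ℝⁿ`, where the measure is a product.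

On the line, the operator `u'' + (β/t - t)u'` has the even eigenfunction `t² - (β+1)` with
eigenvalue 2 and the odd eigenfunction `t|t|^(α-1)` with eigenvalue `α`. These are the spectral gaps
on the two parity classes; they are proved by Hardy inequalities whose weight is the derivative of
the eigenfunction (`lintegral_hardy_even`, `lintegral_hardy_odd`). If `λ ≤ min(2, 2α)`, then `λ`
times the form "variance of the even part plus half the squared norm of the odd part" is at most the
energy. The factor 1/2 is what makes this form subadditive on products (`parityForm_prod_le`): a
product of two odd functions is even, with weight `1 = 1/2 + 1/2`. For an even `F` on `ℝⁿ` the form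
is the full variance, so `λ Var F ≤ ∫|∇F|²` (`parityForm_pi_le`): evenness forbids a single odd
factor, which is why `2α` enters and not `α`.

Apply this to `F(x) = |x|^λ (f(x/|x|) - ∫ f dm)`. With `A(p) = E|x|^p` one has `Var F = A(2λ) Var f`
and `∫|∇F|² = A(2λ-2)(λ² Var f + ∫|∇f|² dm)`, while `A(2λ) = (2λ - 2 + 2n/q) A(2λ-2)`. Hence `λ(λ +
2n/q - 2) Var f ≤ ∫|∇f|² dm`. The choices `λ = 2` (for `q ≥ 2`) and `λ = 2α` (for `q ≤ 2`) give the
two constants in the maximum.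

For the lower bound, the restrictions to the sphere of the homogeneous eigenfunctions are tested:
`y_i²`, and `y_i|y_i|^(α-1) y_j|y_j|^(α-1)` with `i ≠ j`. The second is not smooth and is reached as
a limit of smooth even functions. -/

/-! ### Abstract weighted Hardy inequalities on the half-line. -/

/-- Weighted Hardy inequality from Tonelli's theorem, for an abstract region `R`. -/
theorem lintegral_hardy {R : Set (ℝ × ℝ)} (hR : MeasurableSet R) {Y S : Set ℝ}
    (hY : MeasurableSet Y) (hS : MeasurableSet S)
    {u b h Φ W : ℝ → ENNReal} {κ : ENNReal} (hb : Measurable b) (hh : Measurable h)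
    (hΦ : Measurable Φ) (hW : Measurable W)
    (hRS : ∀ y s, (y, s) ∈ R → s ∈ S)
    (h0 : ∀ s ∈ S, h s ≠ 0) (htop : ∀ s ∈ S, h s ≠ ⊤)
    (hu : ∀ y ∈ Y, u y ≤ (∫⁻ s, R.indicator (fun p => b p.2 / h p.2) (y, s)) * Φ y)
    (hker : ∀ s ∈ S, ∫⁻ y in Y, R.indicator (fun p => Φ p.1 * W p.1) (y, s) ≤ κ * h s * W s) :
    ∫⁻ y in Y, u y * W y ≤ κ * ∫⁻ s in S, b s * W s := by
  have hm : Measurable (Function.uncurry fun y s =>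
      R.indicator (fun p => b p.2 / h p.2 * (Φ p.1 * W p.1)) (y, s)) := by
    apply Measurable.indicator _ hR
    fun_prop
  calc ∫⁻ y in Y, u y * W y
      ≤ ∫⁻ y in Y, ∫⁻ s, R.indicator (fun p => b p.2 / h p.2 * (Φ p.1 * W p.1)) (y, s) := by
        apply setLIntegral_mono' hY
        intro y hy
        calc u y * W y ≤ (∫⁻ s, R.indicator (fun p => b p.2 / h p.2) (y, s)) * Φ y * W y := by
              gcongr; exact hu y hy
          _ = ∫⁻ s, R.indicator (fun p => b p.2 / h p.2) (y, s) * (Φ y * W y) := by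
              rw [lintegral_mul_const, mul_assoc]
              have : Measurable (R.indicator (fun p => b p.2 / h p.2)) :=
                Measurable.indicator (by fun_prop) hR
              exact this.comp measurable_prodMk_left
          _ = _ := by
              congr 1; ext s
              by_cases hs : (y, s) ∈ R <;> simp [hs]
    _ = ∫⁻ s, ∫⁻ y in Y, R.indicator (fun p => b p.2 / h p.2 * (Φ p.1 * W p.1)) (y, s) :=
        lintegral_lintegral_swap hm.aemeasurable
    _ ≤ ∫⁻ s, S.indicator (fun s => κ * (b s * W s)) s := by
        apply lintegral_mono
        intro s
        by_cases hs : s ∈ S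
        · simp only [hs, indicator_of_mem]
          calc ∫⁻ y in Y, R.indicator (fun p => b p.2 / h p.2 * (Φ p.1 * W p.1)) (y, s)
              = ∫⁻ y in Y, b s / h s * R.indicator (fun p => Φ p.1 * W p.1) (y, s) := by
                congr 1; ext y
                by_cases hs : (y, s) ∈ R <;> simp [hs]
            _ = b s / h s * ∫⁻ y in Y, R.indicator (fun p => Φ p.1 * W p.1) (y, s) := by
                rw [lintegral_const_mul]
                have : Measurable (R.indicator (fun p => Φ p.1 * W p.1)) :=
                  Measurable.indicator (by fun_prop) hR
                exact this.comp measurable_prodMk_right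
            _ ≤ b s / h s * (κ * h s * W s) := by gcongr; exact hker s hs
            _ = κ * ((b s / h s * h s) * W s) := by ring
            _ = _ := by rw [ENNReal.div_mul_cancel (h0 s hs) (htop s hs)]
        · have : ∀ y, (y, s) ∉ R := fun y hy => hs (hRS y s hy)
          simp [this]
    _ = κ * ∫⁻ s in S, b s * W s := by
        rw [lintegral_indicator hS, lintegral_const_mul]
        fun_prop

/-- Cauchy–Schwarz with a weight. -/
theorem ofReal_setIntegral_sq_le {s : Set ℝ} (hs : MeasurableSet s) {a : ℝ → ℝ}
    {h : ℝ → ENNReal} (ha : Measurable a) (hh : Measurable h)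
    (h0 : ∀ x ∈ s, h x ≠ 0) (htop : ∀ x ∈ s, h x ≠ ⊤) :
    ENNReal.ofReal ((∫ x in s, a x) ^ 2) ≤
      (∫⁻ x in s, ENNReal.ofReal (a x ^ 2) / h x) * ∫⁻ x in s, h x := by
  have e1 : ENNReal.ofReal ((∫ x in s, a x) ^ 2) = ‖∫ x in s, a x‖ₑ ^ 2 := by
    rw [← sq_abs, ENNReal.ofReal_pow (abs_nonneg _), ← Real.norm_eq_abs, ofReal_norm]
  have e2 : ∀ x, ENNReal.ofReal (a x ^ 2) = ‖a x‖ₑ ^ 2 := fun x => by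
    rw [← sq_abs, ENNReal.ofReal_pow (abs_nonneg _), ← Real.norm_eq_abs, ofReal_norm]
  have hcs := ENNReal.lintegral_mul_le_Lp_mul_Lq (volume.restrict s)
    (Real.HolderConjugate.two_two) (f := fun x => ‖a x‖ₑ / h x ^ (1/2 : ℝ))
    (g := fun x => h x ^ (1/2 : ℝ)) (by fun_prop) (by fun_prop)
  rw [e1]
  calc ‖∫ x in s, a x‖ₑ ^ 2 ≤ (∫⁻ x in s, ‖a x‖ₑ) ^ 2 := by
        gcongr; exact enorm_integral_le_lintegral_enorm _
    _ = (∫⁻ x in s, ((fun x => ‖a x‖ₑ / h x ^ (1/2 : ℝ)) * fun x => h x ^ (1/2 : ℝ)) x) ^ 2 := by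
        congr 1
        apply setLIntegral_congr_fun hs
        intro x hx
        simp only [Pi.mul_apply]
        rw [ENNReal.div_mul_cancel]
        · simp [h0 x hx, htop x hx]
        · simp [h0 x hx, htop x hx]
    _ ≤ _ := by
        grw [hcs]
        rw [mul_pow, ← ENNReal.rpow_natCast, ← ENNReal.rpow_natCast, ← ENNReal.rpow_mul,
          ← ENNReal.rpow_mul]
        norm_num
        gcongr with x x
        · rw [e2, div_eq_mul_inv, div_eq_mul_inv, mul_pow, ← ENNReal.inv_pow,
            ← ENNReal.rpow_natCast (h x ^ _), ← ENNReal.rpow_mul]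
          norm_num [div_eq_mul_inv]
        · rw [← ENNReal.rpow_natCast, ← ENNReal.rpow_mul]
          norm_num

/-- Intended for `h = w'` and `Φ = |w|`, where `w` is an increasing eigenfunction for the weight `W`
that vanishes at `t₀`. Then `hhΦ` is the fundamental theorem of calculus, and `hker` is the
integrated eigenvalue equation with `κ` the inverse eigenvalue. -/
theorem lintegral_Ioi_hardy {t₀ : ℝ} {a : ℝ → ℝ} {h Φ W : ℝ → ENNReal} {κ : ENNReal}
    (ha : Measurable a) (hh : Measurable h) (hΦ : Measurable Φ) (hW : Measurable W)
    (h0 : ∀ s, t₀ < s → h s ≠ 0) (htop : ∀ s, t₀ < s → h s ≠ ⊤)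
    (hhΦ : ∀ y, t₀ < y → ∫⁻ s in Ioo t₀ y, h s ≤ Φ y)
    (hker : ∀ s, t₀ < s → ∫⁻ y in Ioi s, Φ y * W y ≤ κ * h s * W s) :
    ∫⁻ y in Ioi t₀, ENNReal.ofReal ((∫ x in Ioo t₀ y, a x) ^ 2) * W y ≤
      κ * ∫⁻ s in Ioi t₀, ENNReal.ofReal (a s ^ 2) * W s := by
  refine lintegral_hardy (R := {p : ℝ × ℝ | t₀ < p.2} ∩ {p | p.2 < p.1}) (Φ := Φ) (h := h)
    (u := fun y => ENNReal.ofReal ((∫ x in Ioo t₀ y, a x) ^ 2))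
    (b := fun s => ENNReal.ofReal (a s ^ 2)) ?_
    measurableSet_Ioi measurableSet_Ioi (by fun_prop) hh hΦ hW ?_ h0 htop ?_ ?_
  · exact (measurableSet_lt measurable_const measurable_snd).inter
      (measurableSet_lt measurable_snd measurable_fst)
  · exact fun y s hs => hs.1
  · intro y hy
    refine (ofReal_setIntegral_sq_le measurableSet_Ioo ha hh (fun x hx => h0 x hx.1)
      (fun x hx => htop x hx.1)).trans ?_
    refine mul_le_mul' ?_ ?_
    · rw [← lintegral_indicator measurableSet_Ioo]
      apply lintegral_mono
      intro s
      by_cases hs : s ∈ Ioo t₀ y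
      · have : (y, s) ∈ {p : ℝ × ℝ | t₀ < p.2} ∩ {p | p.2 < p.1} := hs
        simp [hs, this]
      · simp [hs]
    · exact hhΦ y hy
  · intro s hs
    refine le_trans ?_ (hker s hs)
    rw [← lintegral_indicator measurableSet_Ioi, ← lintegral_indicator measurableSet_Ioi]
    apply lintegral_mono
    intro y
    by_cases hy : s < y
    · have h1 : t₀ < y := lt_trans hs hy
      have : (y, s) ∈ {p : ℝ × ℝ | t₀ < p.2} ∩ {p | p.2 < p.1} := ⟨hs, hy⟩
      simp [hy, this, h1]
    · have : (y, s) ∉ {p : ℝ × ℝ | t₀ < p.2} ∩ {p | p.2 < p.1} := fun h => hy h.2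
      by_cases h1 : y ∈ Ioi t₀ <;> simp only [h1, indicator_of_mem, indicator_of_notMem, this,
        not_false_eq_true] <;> exact zero_le

/-- The same mechanism below the zero `t₀` of the eigenfunction, integrating towards 0. -/
theorem lintegral_Ioo_hardy {t₀ : ℝ} {a : ℝ → ℝ} {h Φ W : ℝ → ENNReal} {κ : ENNReal}
    (ha : Measurable a) (hh : Measurable h) (hΦ : Measurable Φ) (hW : Measurable W)
    (h0 : ∀ s ∈ Ioo 0 t₀, h s ≠ 0) (htop : ∀ s ∈ Ioo 0 t₀, h s ≠ ⊤)
    (hhΦ : ∀ y ∈ Ioo 0 t₀, ∫⁻ s in Ioo y t₀, h s ≤ Φ y)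
    (hker : ∀ s ∈ Ioo 0 t₀, ∫⁻ y in Ioo 0 s, Φ y * W y ≤ κ * h s * W s) :
    ∫⁻ y in Ioo 0 t₀, ENNReal.ofReal ((∫ x in Ioo y t₀, a x) ^ 2) * W y ≤
      κ * ∫⁻ s in Ioo 0 t₀, ENNReal.ofReal (a s ^ 2) * W s := by
  refine lintegral_hardy (R := {p : ℝ × ℝ | 0 < p.1} ∩ ({p | p.1 < p.2} ∩ {p | p.2 < t₀}))
    (Φ := Φ) (h := h)
    (u := fun y => ENNReal.ofReal ((∫ x in Ioo y t₀, a x) ^ 2))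
    (b := fun s => ENNReal.ofReal (a s ^ 2)) ?_
    measurableSet_Ioo measurableSet_Ioo (by fun_prop) hh hΦ hW ?_ h0 htop ?_ ?_
  · exact (measurableSet_lt measurable_const measurable_fst).inter
      ((measurableSet_lt measurable_fst measurable_snd).inter
        (measurableSet_lt measurable_snd measurable_const))
  · exact fun y s hs => ⟨lt_trans hs.1 hs.2.1, hs.2.2⟩
  · intro y hy
    refine (ofReal_setIntegral_sq_le measurableSet_Ioo ha hh
      (fun x hx => h0 x ⟨hy.1.trans hx.1, hx.2⟩)
      (fun x hx => htop x ⟨hy.1.trans hx.1, hx.2⟩)).trans ?_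
    refine mul_le_mul' ?_ ?_
    · rw [← lintegral_indicator measurableSet_Ioo]
      apply lintegral_mono
      intro s
      by_cases hs : s ∈ Ioo y t₀
      · have : (y, s) ∈ {p : ℝ × ℝ | 0 < p.1} ∩ ({p | p.1 < p.2} ∩ {p | p.2 < t₀}) :=
          ⟨hy.1, hs⟩
        simp [hs, this]
      · simp [hs]
    · exact hhΦ y hy
  · intro s hs
    refine le_trans ?_ (hker s hs)
    rw [← lintegral_indicator measurableSet_Ioo, ← lintegral_indicator measurableSet_Ioo]
    apply lintegral_mono
    intro y
    by_cases hy : y ∈ Ioo 0 s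
    · have h1 : y ∈ Ioo 0 t₀ := ⟨hy.1, hy.2.trans hs.2⟩
      have : (y, s) ∈ {p : ℝ × ℝ | 0 < p.1} ∩ ({p | p.1 < p.2} ∩ {p | p.2 < t₀}) :=
        ⟨hy.1, hy.2, hs.2⟩
      simp [hy, this, h1]
    · have : (y, s) ∉ {p : ℝ × ℝ | 0 < p.1} ∩ ({p | p.1 < p.2} ∩ {p | p.2 < t₀}) :=
        fun h => hy ⟨h.1, h.2.1⟩
      by_cases h1 : y ∈ Ioo 0 t₀ <;> simp only [h1, indicator_of_mem, indicator_of_notMem, this,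
        not_false_eq_true] <;> exact zero_le

/-! ### Gaussian primitives and the Hardy inequalities for odd and even functions. -/

theorem hasDerivAt_rpow_mul_exp (d : ℝ) {t : ℝ} (ht : 0 < t) :
    HasDerivAt (fun t : ℝ => t ^ d * Real.exp (-t ^ 2 / 2))
      ((d - t ^ 2) * (t ^ (d - 1) * Real.exp (-t ^ 2 / 2))) t := by
  have h1 := Real.hasDerivAt_rpow_const (p := d) (Or.inl ht.ne')
  have h2 : HasDerivAt (fun t : ℝ => Real.exp (-t ^ 2 / 2))
      (Real.exp (-t ^ 2 / 2) * (-t)) t := by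
    apply HasDerivAt.exp
    refine (((hasDerivAt_pow 2 t).neg).div_const 2).congr_deriv ?_
    simp only [Nat.cast_ofNat, Nat.add_one_sub_one, pow_one]
    ring
  refine (h1.mul h2).congr_deriv ?_
  have : t ^ d = t ^ (d - 1) * t := by
    rw [← Real.rpow_add_one ht.ne']; ring_nf
  rw [this]; ring

theorem tendsto_rpow_mul_exp_neg_sq (d : ℝ) :
    Filter.Tendsto (fun t : ℝ => t ^ d * Real.exp (-t ^ 2 / 2)) Filter.atTop (nhds 0) := by
  have h := rpow_mul_exp_neg_mul_sq_isLittleO_exp_neg (b := 1/2) (by norm_num) d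
  have h2 : Filter.Tendsto (fun x : ℝ => Real.exp (-(1/2) * x)) Filter.atTop (nhds 0) := by
    refine Real.tendsto_exp_atBot.comp ?_
    exact Filter.tendsto_id.const_mul_atTop_of_neg (by norm_num)
  refine (h.trans_tendsto h2).congr fun x => ?_
  congr 2; ring

/-- The integrand is the derivative of `-t^d e^{-t²/2}`; the condition `d ≤ s²` makes it nonnegative
on the tail, so integrability comes for free. -/
theorem lintegral_Ioi_gauss_tail {d s : ℝ} (hs : 0 < s) (hds : d ≤ s ^ 2) :
    ∫⁻ t in Ioi s, ENNReal.ofReal ((t ^ 2 - d) * (t ^ (d - 1) * Real.exp (-t ^ 2 / 2))) =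
      ENNReal.ofReal (s ^ d * Real.exp (-s ^ 2 / 2)) := by
  have hd : ∀ x ∈ Ici s, HasDerivAt (fun t : ℝ => -(t ^ d * Real.exp (-t ^ 2 / 2)))
      ((x ^ 2 - d) * (x ^ (d - 1) * Real.exp (-x ^ 2 / 2))) x := fun x hx => by
    refine (hasDerivAt_rpow_mul_exp d (lt_of_lt_of_le hs hx)).neg.congr_deriv ?_
    ring
  have hp : ∀ x ∈ Ioi s, 0 ≤ (x ^ 2 - d) * (x ^ (d - 1) * Real.exp (-x ^ 2 / 2)) := by
    intro x hx
    have hx' : s < x := hx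
    have : 0 < x := hs.trans hx'
    have h2 : 0 ≤ x ^ 2 - d := by nlinarith
    positivity
  have ht := (tendsto_rpow_mul_exp_neg_sq d).neg
  rw [neg_zero] at ht
  rw [← ofReal_integral_eq_lintegral_ofReal (integrableOn_Ioi_deriv_of_nonneg' hd hp ht)
    ((ae_restrict_iff' measurableSet_Ioi).2 (.of_forall hp)),
    integral_Ioi_of_hasDerivAt_of_nonneg' hd hp ht]
  simp

theorem lintegral_Ioo_gauss_head {d s : ℝ} (hd0 : 0 < d) (hs : 0 < s) (hds : s ^ 2 ≤ d) :
    ∫⁻ t in Ioo 0 s, ENNReal.ofReal ((d - t ^ 2) * (t ^ (d - 1) * Real.exp (-t ^ 2 / 2))) =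
      ENNReal.ofReal (s ^ d * Real.exp (-s ^ 2 / 2)) := by
  have hd : ∀ x ∈ Ioo 0 s, HasDerivAt (fun t : ℝ => (t ^ d * Real.exp (-t ^ 2 / 2)))
      ((d - x ^ 2) * (x ^ (d - 1) * Real.exp (-x ^ 2 / 2))) x := fun x hx =>
    hasDerivAt_rpow_mul_exp d hx.1
  have hp : ∀ x ∈ Ioo 0 s, 0 ≤ (d - x ^ 2) * (x ^ (d - 1) * Real.exp (-x ^ 2 / 2)) := by
    intro x hx
    have h0 : 0 < x := hx.1
    have h2 : 0 ≤ d - x ^ 2 := by nlinarith [hx.2]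
    positivity
  have hc : ContinuousOn (fun t : ℝ => (t ^ d * Real.exp (-t ^ 2 / 2))) (Icc 0 s) := by
    apply ContinuousOn.mul
    · exact (Real.continuous_rpow_const hd0.le).continuousOn
    · fun_prop
  have hi := intervalIntegral.integrableOn_deriv_of_nonneg hc hd hp
  rw [← ofReal_integral_eq_lintegral_ofReal (hi.mono_set Ioo_subset_Ioc_self)
    ((ae_restrict_iff' measurableSet_Ioo).2 (.of_forall hp)), ← integral_Ioc_eq_integral_Ioo,
    ← intervalIntegral.integral_of_le hs.le,
    intervalIntegral.integral_eq_sub_of_hasDerivAt_of_le hs.le hc hd]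
  · simp [Real.zero_rpow hd0.ne']
  · rwa [intervalIntegrable_iff_integrableOn_Ioc_of_le hs.le]

theorem lintegral_Ioo_rpow {α y : ℝ} (hα : 0 < α) (hy : 0 ≤ y) :
    ∫⁻ s in Ioo 0 y, ENNReal.ofReal (α * s ^ (α - 1)) = ENNReal.ofReal (y ^ α) := by
  have hd : ∀ x ∈ Ioo 0 y, HasDerivAt (fun t : ℝ => t ^ α) (α * x ^ (α - 1)) x := fun x hx =>
    Real.hasDerivAt_rpow_const (Or.inl hx.1.ne')
  have hp : ∀ x ∈ Ioo 0 y, 0 ≤ α * x ^ (α - 1) := fun x hx => by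
    have := hx.1
    positivity
  have hc : ContinuousOn (fun t : ℝ => t ^ α) (Icc 0 y) :=
    (Real.continuous_rpow_const hα.le).continuousOn
  have hi := intervalIntegral.integrableOn_deriv_of_nonneg hc hd hp
  rw [← ofReal_integral_eq_lintegral_ofReal (hi.mono_set Ioo_subset_Ioc_self)
    ((ae_restrict_iff' measurableSet_Ioo).2 (.of_forall hp)), ← integral_Ioc_eq_integral_Ioo,
    ← intervalIntegral.integral_of_le hy,
    intervalIntegral.integral_eq_sub_of_hasDerivAt_of_le hy hc hd]
  · simp [Real.zero_rpow hα.ne']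
  · rwa [intervalIntegrable_iff_integrableOn_Ioc_of_le hy]

theorem lintegral_Ioo_two_mul {x y : ℝ} (hx : 0 ≤ x) (hxy : x ≤ y) :
    ∫⁻ s in Ioo x y, ENNReal.ofReal (2 * s) = ENNReal.ofReal (y ^ 2 - x ^ 2) := by
  have hi : IntegrableOn (fun s : ℝ => 2 * s) (Ioo x y) :=
    ((continuous_const.mul continuous_id).continuousOn.integrableOn_Icc).mono_set Ioo_subset_Icc_self
  rw [← ofReal_integral_eq_lintegral_ofReal hi
    ((ae_restrict_iff' measurableSet_Ioo).2 (.of_forall fun s hs => ?_)),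
    ← integral_Ioc_eq_integral_Ioo, ← intervalIntegral.integral_of_le hxy]
  · congr 1
    rw [intervalIntegral.integral_const_mul, integral_id]
    ring
  · have : 0 < s := lt_of_le_of_lt hx hs.1
    simp only [Pi.zero_apply]
    positivity

/-- The eigenfunction is `w = y^α`, vanishing at 0, with eigenvalue `α`. -/
theorem lintegral_hardy_odd {α : ℝ} (hα : 0 < α) {a : ℝ → ℝ} (ha : Measurable a) :
    ∫⁻ y in Ioi 0, ENNReal.ofReal ((∫ x in (0:ℝ)..y, a x) ^ 2) *
        ENNReal.ofReal (y ^ (1 - α) * Real.exp (-y ^ 2 / 2)) ≤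
      ENNReal.ofReal (1 / α) * ∫⁻ s in Ioi 0, ENNReal.ofReal (a s ^ 2) *
        ENNReal.ofReal (s ^ (1 - α) * Real.exp (-s ^ 2 / 2)) := by
  refine le_trans (le_of_eq ?_) (lintegral_Ioi_hardy (t₀ := 0) (a := a)
    (h := fun s => ENNReal.ofReal (α * s ^ (α - 1))) (Φ := fun y => ENNReal.ofReal (y ^ α))
    ha (by fun_prop) (by fun_prop) (by fun_prop) ?_ ?_ ?_ ?_)
  · refine setLIntegral_congr_fun measurableSet_Ioi fun y hy => ?_
    rw [intervalIntegral.integral_of_le (le_of_lt hy), integral_Ioc_eq_integral_Ioo]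
  · intro s hs
    simp only [ne_eq, ENNReal.ofReal_eq_zero, not_le]
    positivity
  · simp
  · intro y hy
    exact (lintegral_Ioo_rpow hα hy.le).le
  · intro s hs
    -- Here `Φ W = y e^{-y²/2}`, which is the integrand of the tail formula at `d = 0`.
    have h1 := lintegral_Ioi_gauss_tail (d := 0) hs (sq_nonneg s)
    refine le_of_eq ?_
    calc ∫⁻ y in Ioi s, ENNReal.ofReal (y ^ α) *
          ENNReal.ofReal (y ^ (1 - α) * Real.exp (-y ^ 2 / 2))
        = ∫⁻ t in Ioi s,
            ENNReal.ofReal ((t ^ 2 - 0) * (t ^ ((0:ℝ) - 1) * Real.exp (-t ^ 2 / 2))) := by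
          refine setLIntegral_congr_fun measurableSet_Ioi fun y hy => ?_
          have hy' : 0 < y := hs.trans hy
          rw [← ENNReal.ofReal_mul (by positivity), ← mul_assoc, ← mul_assoc,
            ← Real.rpow_add hy', zero_sub, Real.rpow_neg_one]
          congr 2
          ring_nf
          rw [Real.rpow_one]
          field_simp
      _ = ENNReal.ofReal (s ^ (0:ℝ) * Real.exp (-s ^ 2 / 2)) := h1
      _ = _ := by
          rw [← ENNReal.ofReal_mul (by positivity), ← ENNReal.ofReal_mul (by positivity)]
          congr 1
          have : s ^ (α - 1) * s ^ (1 - α) = 1 := by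
            rw [← Real.rpow_add hs]; simp
          rw [Real.rpow_zero]
          calc 1 * Real.exp (-s ^ 2 / 2) = (1 / α * α) * (s ^ (α - 1) * s ^ (1 - α)) *
                Real.exp (-s ^ 2 / 2) := by rw [this]; field_simp
            _ = _ := by ring

theorem gauss_even_kernel {β s : ℝ} (hs : 0 < s) :
    s ^ (β + 1) * Real.exp (-s ^ 2 / 2) =
      1 / 2 * (2 * s) * (s ^ β * Real.exp (-s ^ 2 / 2)) := by
  rw [Real.rpow_add_one hs.ne']; ring

/-- The eigenfunction is `w = y² - (β+1)` with eigenvalue 2. It changes sign at `√(β+1)`, so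
primitives start there and the two sides are treated separately with `h = w' = 2s`. -/
theorem lintegral_hardy_even {β : ℝ} (hβ : -1 < β) {a : ℝ → ℝ} (ha : Measurable a) :
    ∫⁻ y in Ioi 0, ENNReal.ofReal ((∫ x in (√(β + 1))..y, a x) ^ 2) *
        ENNReal.ofReal (y ^ β * Real.exp (-y ^ 2 / 2)) ≤
      ENNReal.ofReal (1 / 2) * ∫⁻ s in Ioi 0, ENNReal.ofReal (a s ^ 2) *
        ENNReal.ofReal (s ^ β * Real.exp (-s ^ 2 / 2)) := by
  set t₀ := √(β + 1) with ht₀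
  have hd : 0 < β + 1 := by linarith
  have ht : 0 < t₀ := Real.sqrt_pos.2 hd
  have hsq : t₀ ^ 2 = β + 1 := Real.sq_sqrt hd.le
  have hsplit : ∀ f : ℝ → ENNReal, ∫⁻ y in Ioi 0, f y =
      (∫⁻ y in Ioo 0 t₀, f y) + ∫⁻ y in Ioi t₀, f y := by
    intro f
    rw [← Ioc_union_Ioi_eq_Ioi ht.le, lintegral_union measurableSet_Ioi
      (Set.disjoint_left.2 fun x hx hx' => not_lt.2 hx.2 hx'), setLIntegral_congr Ioo_ae_eq_Ioc]
  rw [hsplit, hsplit, mul_add]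
  refine add_le_add ?_ ?_
  · refine le_trans (le_of_eq ?_) (lintegral_Ioo_hardy (t₀ := t₀) (a := a)
      (h := fun s => ENNReal.ofReal (2 * s)) (Φ := fun y => ENNReal.ofReal (β + 1 - y ^ 2))
      ha (by fun_prop) (by fun_prop) (by fun_prop) ?_ ?_ ?_ ?_)
    · refine setLIntegral_congr_fun measurableSet_Ioo fun y hy => ?_
      rw [intervalIntegral.integral_of_ge hy.2.le, integral_Ioc_eq_integral_Ioo, neg_sq]
    · intro s hs
      simpa using hs.1
    · intros; exact ENNReal.ofReal_ne_top
    · intro y hy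
      exact (lintegral_Ioo_two_mul hy.1.le hy.2.le).le.trans (by rw [hsq])
    · intro s hs
      have hs0 := hs.1
      have hs2 : s ^ 2 ≤ β + 1 := by rw [← hsq]; nlinarith [hs.2]
      have h1 := lintegral_Ioo_gauss_head hd hs0 hs2
      rw [gauss_even_kernel hs0] at h1
      rw [← ENNReal.ofReal_mul (by positivity), ← ENNReal.ofReal_mul (by positivity), ← h1]
      refine le_of_eq (setLIntegral_congr_fun measurableSet_Ioo fun y hy => ?_)
      have : 0 ≤ β + 1 - y ^ 2 := by nlinarith [hy.1, hy.2]
      rw [← ENNReal.ofReal_mul this]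
      ring_nf
  · refine le_trans (le_of_eq ?_) (lintegral_Ioi_hardy (t₀ := t₀) (a := a)
      (h := fun s => ENNReal.ofReal (2 * s)) (Φ := fun y => ENNReal.ofReal (y ^ 2 - (β + 1)))
      ha (by fun_prop) (by fun_prop) (by fun_prop) ?_ ?_ ?_ ?_)
    · refine setLIntegral_congr_fun measurableSet_Ioi fun y hy => ?_
      rw [intervalIntegral.integral_of_le (le_of_lt hy), integral_Ioc_eq_integral_Ioo]
    · intro s hs
      simpa using ht.trans hs
    · intros; exact ENNReal.ofReal_ne_top
    · intro y hy
      exact (lintegral_Ioo_two_mul ht.le hy.le).le.trans (by rw [hsq])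
    · intro s hs
      have hs0 := ht.trans hs
      have hs2 : β + 1 ≤ s ^ 2 := by rw [← hsq]; nlinarith [hs]
      have h1 := lintegral_Ioi_gauss_tail hs0 hs2
      rw [gauss_even_kernel hs0] at h1
      rw [← ENNReal.ofReal_mul (by positivity), ← ENNReal.ofReal_mul (by positivity), ← h1]
      refine le_of_eq (setLIntegral_congr_fun measurableSet_Ioi fun y hy => ?_)
      have hy' : s < y := hy
      have : 0 ≤ y ^ 2 - (β + 1) := by nlinarith
      rw [← ENNReal.ofReal_mul this]
      ring_nf

/-! ### Moments and the one-dimensional reference measure. -/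

/-- The moment `∫₀^∞ t^a e^{-t²/2} dt`. -/
noncomputable def gaussMoment (a : ℝ) : ℝ := ∫ t in Ioi (0:ℝ), t ^ a * Real.exp (-t ^ 2 / 2)

theorem integrableOn_gaussMoment {a : ℝ} (ha : -1 < a) :
    IntegrableOn (fun t : ℝ => t ^ a * Real.exp (-t ^ 2 / 2)) (Ioi 0) := by
  refine (integrableOn_rpow_mul_exp_neg_mul_sq (b := 1/2) (by norm_num) ha).congr_fun
    (fun t _ => ?_) measurableSet_Ioi
  simp only
  congr 2; ring

theorem gaussMoment_eq {a : ℝ} (ha : -1 < a) :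
    gaussMoment a = (1/2 : ℝ) ^ (-(a + 1) / 2) * (1 / 2) * Real.Gamma ((a + 1) / 2) := by
  rw [← integral_rpow_mul_exp_neg_mul_rpow (by norm_num) ha (by norm_num), gaussMoment]
  refine setIntegral_congr_fun measurableSet_Ioi fun t _ => ?_
  simp only [Real.rpow_ofNat]
  congr 2; ring

theorem gaussMoment_pos {a : ℝ} (ha : -1 < a) : 0 < gaussMoment a := by
  rw [gaussMoment_eq ha]
  have := Real.Gamma_pos_of_pos (s := (a + 1) / 2) (by linarith)
  positivity

/-- This is `Γ(s+1) = sΓ(s)`. The sharp constants depend on moments only through this recursion;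
their values are never needed. -/
theorem gaussMoment_add_two {a : ℝ} (ha : -1 < a) :
    gaussMoment (a + 2) = (a + 1) * gaussMoment a := by
  rw [gaussMoment_eq ha, gaussMoment_eq (by linarith), show (a + 2 + 1) / 2 = (a + 1) / 2 + 1 by ring,
    Real.Gamma_add_one (by linarith), show -(a + 2 + 1) / 2 = -(a + 1) / 2 - 1 by ring,
    Real.rpow_sub_one (by norm_num)]
  ring

theorem lintegral_gaussMoment {a : ℝ} (ha : -1 < a) :
    ∫⁻ t in Ioi (0:ℝ), ENNReal.ofReal (t ^ a * Real.exp (-t ^ 2 / 2)) =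
      ENNReal.ofReal (gaussMoment a) := by
  rw [gaussMoment, ofReal_integral_eq_lintegral_ofReal (integrableOn_gaussMoment ha)]
  refine (ae_restrict_iff' measurableSet_Ioi).2 (.of_forall fun t (ht : 0 < t) => ?_)
  simp only [Pi.zero_apply]
  positivity

/-- The probability measure on `ℝ` with density proportional to `|t|^β e^{-t²/2}`. -/
noncomputable def gaussMeas (β : ℝ) : Measure ℝ :=
  volume.withDensity fun t =>
    ENNReal.ofReal (|t| ^ β * Real.exp (-t ^ 2 / 2) / (2 * gaussMoment β))

theorem lintegral_gaussMeas (β : ℝ) (g : ℝ → ENNReal) :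
    ∫⁻ t, g t ∂(gaussMeas β) =
      ∫⁻ t, ENNReal.ofReal (|t| ^ β * Real.exp (-t ^ 2 / 2) / (2 * gaussMoment β)) * g t := by
  rw [gaussMeas, lintegral_withDensity_eq_lintegral_mul_non_measurable _ (by fun_prop)
    (.of_forall fun _ => ENNReal.ofReal_lt_top)]
  rfl

theorem measurePreserving_neg_gaussMeas (β : ℝ) :
    MeasurePreserving (fun t : ℝ => -t) (gaussMeas β) (gaussMeas β) := by
  refine ⟨measurable_neg, ?_⟩
  ext s hs
  rw [Measure.map_apply measurable_neg hs, ← lintegral_indicator_one (measurable_neg hs),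
    ← lintegral_indicator_one hs, lintegral_gaussMeas, lintegral_gaussMeas]
  have h := (Measure.measurePreserving_neg (volume : Measure ℝ)).lintegral_comp_emb
    (MeasurableEquiv.neg ℝ).measurableEmbedding
    (fun t => ENNReal.ofReal (|t| ^ β * Real.exp (-t ^ 2 / 2) / (2 * gaussMoment β)) *
      s.indicator 1 t)
  rw [← h]
  simp only [abs_neg, neg_sq]
  rfl

theorem lintegral_gaussMeas_of_even {β : ℝ} (hβ : -1 < β) {g : ℝ → ENNReal}
    (hg : ∀ t, g (-t) = g t) :
    ∫⁻ t, g t ∂(gaussMeas β) = ENNReal.ofReal (1 / gaussMoment β) *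
      ∫⁻ t in Ioi 0, g t * ENNReal.ofReal (t ^ β * Real.exp (-t ^ 2 / 2)) := by
  have hp := gaussMoment_pos hβ
  rw [lintegral_gaussMeas]
  set G : ℝ → ENNReal := fun t =>
    ENNReal.ofReal (|t| ^ β * Real.exp (-t ^ 2 / 2) / (2 * gaussMoment β)) * g t with hG
  have hGe : ∀ t, G (-t) = G t := fun t => by simp [hG, hg]
  have h1 : ∫⁻ t in Iic 0, G t = ∫⁻ t in Ioi 0, G t := by
    rw [← setLIntegral_congr Iio_ae_eq_Iic]
    have h := (Measure.measurePreserving_neg (volume : Measure ℝ)).setLIntegral_comp_preimage_emb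
      (MeasurableEquiv.neg ℝ).measurableEmbedding G (Ioi 0)
    rw [← h]
    simp only [hGe]
    congr 2
    ext; simp
  have h2 : ∫⁻ t, G t = 2 * ∫⁻ t in Ioi 0, G t := by
    rw [← setLIntegral_univ, ← Iic_union_Ioi (a := (0:ℝ)), lintegral_union (A := Iic (0:ℝ)) measurableSet_Ioi
      (Set.disjoint_left.2 fun x (hx : x ≤ 0) (hx' : 0 < x) => not_lt.2 hx hx'), h1, two_mul]
  rw [h2, ← lintegral_const_mul' _ _ (by simp), ← lintegral_const_mul' _ _ (by simp)]
  refine setLIntegral_congr_fun measurableSet_Ioi fun t (ht : 0 < t) => ?_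
  simp only [hG]
  rw [abs_of_pos ht, ← mul_assoc, mul_left_comm, mul_comm (g t),
    ← ENNReal.ofReal_mul (by positivity)]
  congr 1
  rw [show (2 : ENNReal) = ENNReal.ofReal 2 by simp, ← ENNReal.ofReal_mul (by positivity)]
  congr 1
  field_simp

theorem isProbabilityMeasure_gaussMeas {β : ℝ} (hβ : -1 < β) :
    IsProbabilityMeasure (gaussMeas β) := by
  have hp := gaussMoment_pos hβ
  constructor
  rw [← lintegral_one, lintegral_gaussMeas_of_even hβ (fun _ => rfl)]
  simp only [one_mul]
  rw [lintegral_gaussMoment hβ, ← ENNReal.ofReal_mul (by positivity)]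
  field_simp
  simp

theorem gaussMeas_absolutelyContinuous (β : ℝ) : gaussMeas β ≪ volume :=
  withDensity_absolutelyContinuous _ _

theorem lintegral_gaussMeas_abs_rpow {β s : ℝ} (hβ : -1 < β) (hs : -1 < β + s) :
    ∫⁻ t, ENNReal.ofReal (|t| ^ s) ∂(gaussMeas β) =
      ENNReal.ofReal (gaussMoment (β + s) / gaussMoment β) := by
  have hp := gaussMoment_pos hβ
  rw [lintegral_gaussMeas_of_even hβ (fun t => by simp), div_eq_mul_one_div (gaussMoment (β + s)),
    mul_comm (gaussMoment (β + s)), ENNReal.ofReal_mul (by positivity), ← lintegral_gaussMoment hs]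
  congr 1
  refine setLIntegral_congr_fun measurableSet_Ioi fun t (ht : 0 < t) => ?_
  rw [abs_of_pos ht, ← ENNReal.ofReal_mul (by positivity), ← mul_assoc, ← Real.rpow_add ht,
    add_comm s]

/-! ### The parity form and its one-dimensional spectral inequality. -/

/-- The quadratic form `‖F_even - mean‖² + ‖F_odd‖² / 2`, where the parity is taken with respect to
the involution `s`. -/
noncomputable def parityForm {X : Type*} [MeasurableSpace X] (μ : Measure X) (s : X → X)
    (F : X → ℝ) : ℝ :=
  3 / 4 * ∫ x, F x ^ 2 ∂μ + 1 / 4 * ∫ x, F x * F (s x) ∂μ - (∫ x, F x ∂μ) ^ 2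

/-- The mean minimizes the squared distance of the even part to constants, so any `c` gives an upper
bound. This freedom is needed because the Hardy inequality dictates its own `c`. -/
theorem parityForm_le {X : Type*} [MeasurableSpace X] {μ : Measure X} [IsProbabilityMeasure μ]
    {s : X → X} (hs : MeasurePreserving s μ μ) {F : X → ℝ} (hF : MemLp F 2 μ) (c : ℝ) :
    parityForm μ s F ≤ ∫ x, ((F x + F (s x)) / 2 - c) ^ 2 ∂μ +
      1 / 2 * ∫ x, ((F x - F (s x)) / 2) ^ 2 ∂μ ∧
    Integrable (fun x => ((F x + F (s x)) / 2 - c) ^ 2) μ ∧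
    Integrable (fun x => ((F x - F (s x)) / 2) ^ 2) μ := by
  obtain ⟨G, hGF⟩ : ∃ G : X → ℝ, ∀ x, F (s x) = G x := ⟨_, fun _ => rfl⟩
  have hG : MemLp G 2 μ := by
    rw [← funext hGF]
    exact hF.comp_measurePreserving hs
  have i1 : Integrable (fun x => F x ^ 2) μ := hF.integrable_sq
  have i2 : Integrable (fun x => G x ^ 2) μ := hG.integrable_sq
  have i3 : Integrable (fun x => F x * G x) μ := hF.integrable_mul hG
  have i4 : Integrable F μ := hF.integrable one_le_two
  have i5 : Integrable G μ := hG.integrable one_le_two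
  have e2 : ∫ x, G x ^ 2 ∂μ = ∫ x, F x ^ 2 ∂μ := by
    have := integral_map (μ := μ) hs.measurable.aemeasurable (f := fun x => F x ^ 2)
      (by rw [hs.map_eq]; exact i1.aestronglyMeasurable)
    simp only [← hGF]
    rw [← this, hs.map_eq]
  have e5 : ∫ x, G x ∂μ = ∫ x, F x ∂μ := by
    have := integral_map (μ := μ) hs.measurable.aemeasurable (f := fun x => F x)
      (by rw [hs.map_eq]; exact i4.aestronglyMeasurable)
    simp only [← hGF]
    rw [← this, hs.map_eq]
  simp only [parityForm, hGF]
  have a1 : (fun x => ((F x + G x) / 2 - c) ^ 2) = fun x => 1/4 * F x ^ 2 + 1/4 * G x ^ 2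
      + 1/2 * (F x * G x) + (-c) * F x + (-c) * G x + c ^ 2 := by
    ext x; ring
  have a2 : (fun x => ((F x - G x) / 2) ^ 2) = fun x => 1/4 * F x ^ 2 + 1/4 * G x ^ 2
      + (-(1/2)) * (F x * G x) := by
    ext x; ring
  rw [a1, a2]
  refine ⟨?_, by fun_prop, by fun_prop⟩
  rw [integral_add (by fun_prop) (by fun_prop), integral_add (by fun_prop) (by fun_prop),
    integral_add (by fun_prop) (by fun_prop), integral_add (by fun_prop) (by fun_prop),
    integral_add (by fun_prop) (by fun_prop),
    integral_add (f := fun x => 1/4 * F x ^ 2 + 1/4 * G x ^ 2) (by fun_prop) (by fun_prop),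
    integral_add (by fun_prop) (by fun_prop)]
  simp only [integral_const_mul, e2, e5, integral_const, probReal_univ, smul_eq_mul, one_mul]
  -- The difference of the two sides is exactly `(c - ∫ F)²`.
  nlinarith [sq_nonneg (c - ∫ x, F x ∂μ)]

/-- The even part has gap 2 and the odd part gap `α`. Since the odd part carries weight 1/2 in the
form, it only requires `lam / 2 ≤ α`. -/
theorem parityForm_gaussMeas_le {α lam : ℝ} (hα : 0 < α) (hα2 : α < 2) (hlam : 0 ≤ lam)
    (h2 : lam ≤ 2) (hlα : lam ≤ 2 * α) {u : ℝ → ℝ}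
    (hu : MemLp u 2 (gaussMeas (1 - α))) (hac : ∀ a b, AbsolutelyContinuousOnInterval u a b) :
    ENNReal.ofReal (lam * parityForm (gaussMeas (1 - α)) (fun t => -t) u) ≤
      ∫⁻ t, ENNReal.ofReal (deriv u t ^ 2) ∂(gaussMeas (1 - α)) := by
  have hβ : -1 < 1 - α := by linarith
  have := isProbabilityMeasure_gaussMeas hβ
  have hneg := measurePreserving_neg_gaussMeas (1 - α)
  have hii : ∀ a b, IntervalIntegrable (deriv u) volume a b := fun a b =>
    (hac a b).intervalIntegrable_deriv
  have hin : ∀ a b, IntervalIntegrable (fun t => deriv u (-t)) volume a b := fun a b => by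
    simpa using (hii (-a) (-b)).comp_sub_left 0
  have hftc : ∀ a b, ∫ t in a..b, deriv u t = u b - u a := fun a b =>
    (hac a b).integral_deriv_eq_sub
  have hftn : ∀ a b, ∫ t in a..b, deriv u (-t) = u (-a) - u (-b) := fun a b => by
    rw [intervalIntegral.integral_comp_neg (fun t => deriv u t), hftc]
  have hm : Measurable (deriv u) := measurable_deriv u
  set t₀ := √(1 - α + 1)
  -- The value of the even part at the zero of `t² - (β+1)`, where `β = 1 - α`: with this constant
  -- the even part minus `c` is a primitive starting at `t₀`.
  set c := (u t₀ + u (-t₀)) / 2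
  have hE : ∀ y, (u y + u (-y)) / 2 - c =
      ∫ x in t₀..y, (deriv u x - deriv u (-x)) / 2 := fun y => by
    rw [intervalIntegral.integral_div, intervalIntegral.integral_sub (hii _ _) (hin _ _),
      hftc, hftn]
    ring
  have hO : ∀ y, (u y - u (-y)) / 2 = ∫ x in (0:ℝ)..y, (deriv u x + deriv u (-x)) / 2 := fun y => by
    rw [intervalIntegral.integral_div, intervalIntegral.integral_add (hii _ _) (hin _ _),
      hftc, hftn]
    ring_nf
  obtain ⟨hle, ie, io⟩ := parityForm_le hneg hu c
  have hev : ∫⁻ y in Ioi 0, ENNReal.ofReal (((u y + u (-y)) / 2 - c) ^ 2) *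
        ENNReal.ofReal (y ^ (1 - α) * Real.exp (-y ^ 2 / 2)) ≤
      ENNReal.ofReal (1 / 2) * ∫⁻ s in Ioi 0,
        ENNReal.ofReal (((deriv u s - deriv u (-s)) / 2) ^ 2) *
        ENNReal.ofReal (s ^ (1 - α) * Real.exp (-s ^ 2 / 2)) := by
    simp only [hE]
    exact lintegral_hardy_even hβ (by fun_prop)
  have hod : ∫⁻ y in Ioi 0, ENNReal.ofReal (((u y - u (-y)) / 2) ^ 2) *
        ENNReal.ofReal (y ^ (1 - α) * Real.exp (-y ^ 2 / 2)) ≤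
      ENNReal.ofReal (1 / α) * ∫⁻ s in Ioi 0,
        ENNReal.ofReal (((deriv u s + deriv u (-s)) / 2) ^ 2) *
        ENNReal.ofReal (s ^ (1 - α) * Real.exp (-s ^ 2 / 2)) := by
    simp only [hO]
    exact lintegral_hardy_odd hα (by fun_prop)
  set K := ENNReal.ofReal (1 / gaussMoment (1 - α))
  have hev' : ENNReal.ofReal 2 * ∫⁻ t, ENNReal.ofReal (((u t + u (-t)) / 2 - c) ^ 2)
      ∂(gaussMeas (1 - α)) ≤
      ∫⁻ t, ENNReal.ofReal (((deriv u t - deriv u (-t)) / 2) ^ 2) ∂(gaussMeas (1 - α)) := by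
    rw [lintegral_gaussMeas_of_even hβ (fun t => by simp only [neg_neg]; ring_nf),
      lintegral_gaussMeas_of_even hβ (fun t => by simp only [neg_neg]; ring_nf), mul_left_comm]
    refine mul_le_mul' le_rfl ?_
    refine (mul_le_mul' le_rfl hev).trans ?_
    rw [← mul_assoc, ← ENNReal.ofReal_mul (by norm_num)]
    simp
  have hod' : ENNReal.ofReal α * ∫⁻ t, ENNReal.ofReal (((u t - u (-t)) / 2) ^ 2)
      ∂(gaussMeas (1 - α)) ≤
      ∫⁻ t, ENNReal.ofReal (((deriv u t + deriv u (-t)) / 2) ^ 2) ∂(gaussMeas (1 - α)) := by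
    rw [lintegral_gaussMeas_of_even hβ (fun t => by simp only [neg_neg]; ring_nf),
      lintegral_gaussMeas_of_even hβ (fun t => by simp only [neg_neg]; ring_nf), mul_left_comm]
    refine mul_le_mul' le_rfl ?_
    refine (mul_le_mul' le_rfl hod).trans ?_
    rw [← mul_assoc, ← ENNReal.ofReal_mul hα.le, mul_one_div_cancel hα.ne']
    simp
  have hsum : ∫⁻ t, ENNReal.ofReal (deriv u (-t) ^ 2) ∂(gaussMeas (1 - α)) =
      ∫⁻ t, ENNReal.ofReal (deriv u t ^ 2) ∂(gaussMeas (1 - α)) :=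
    hneg.lintegral_comp (f := fun t => ENNReal.ofReal (deriv u t ^ 2)) (by fun_prop)
  have e0 : 0 ≤ ∫ t, ((u t + u (-t)) / 2 - c) ^ 2 ∂(gaussMeas (1 - α)) :=
    integral_nonneg fun _ => sq_nonneg _
  have o0 : 0 ≤ ∫ t, ((u t - u (-t)) / 2) ^ 2 ∂(gaussMeas (1 - α)) :=
    integral_nonneg fun _ => sq_nonneg _
  calc ENNReal.ofReal (lam * parityForm (gaussMeas (1 - α)) (fun t => -t) u)
      ≤ ENNReal.ofReal (2 * (∫ t, ((u t + u (-t)) / 2 - c) ^ 2 ∂(gaussMeas (1 - α))) +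
          α * ∫ t, ((u t - u (-t)) / 2) ^ 2 ∂(gaussMeas (1 - α))) := by
        apply ENNReal.ofReal_le_ofReal
        have h3 := mul_le_mul_of_nonneg_left hle hlam
        have h4 := mul_le_mul_of_nonneg_right h2 e0
        have h5 := mul_le_mul_of_nonneg_right hlα o0
        linarith
    _ = ENNReal.ofReal 2 * ∫⁻ t, ENNReal.ofReal (((u t + u (-t)) / 2 - c) ^ 2)
          ∂(gaussMeas (1 - α)) +
        ENNReal.ofReal α * ∫⁻ t, ENNReal.ofReal (((u t - u (-t)) / 2) ^ 2)
          ∂(gaussMeas (1 - α)) := by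
        rw [ENNReal.ofReal_add (by positivity) (by positivity), ENNReal.ofReal_mul (by norm_num),
          ENNReal.ofReal_mul hα.le, ofReal_integral_eq_lintegral_ofReal ie
            (.of_forall fun _ => sq_nonneg _), ofReal_integral_eq_lintegral_ofReal io
            (.of_forall fun _ => sq_nonneg _)]
    _ ≤ _ := add_le_add hev' hod'
    -- Parallelogram law: the cross terms of the two parity components cancel, and reflection
    -- invariance then merges the two remaining integrals.
    _ = ∫⁻ t, (ENNReal.ofReal (1 / 2) * ENNReal.ofReal (deriv u t ^ 2) +
          ENNReal.ofReal (1 / 2) * ENNReal.ofReal (deriv u (-t) ^ 2)) ∂(gaussMeas (1 - α)) := by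
        rw [← lintegral_add_left (by fun_prop)]
        congr 1
        ext t
        rw [← ENNReal.ofReal_add (by positivity) (by positivity),
          ← ENNReal.ofReal_mul (by norm_num), ← ENNReal.ofReal_mul (by norm_num),
          ← ENNReal.ofReal_add (by positivity) (by positivity)]
        congr 1; ring
    _ = ∫⁻ t, ENNReal.ofReal (deriv u t ^ 2) ∂(gaussMeas (1 - α)) := by
        rw [lintegral_add_left (by fun_prop), lintegral_const_mul _ (by fun_prop),
          lintegral_const_mul _ (by fun_prop), hsum, ← add_mul,
          ← ENNReal.ofReal_add (by norm_num) (by norm_num)]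
        norm_num

theorem MeasureTheory.MeasurePreserving.integral_comp_eq {X : Type*} [MeasurableSpace X]
    {μ : Measure X} {s : X → X} (hs : MeasurePreserving s μ μ) {φ : X → ℝ}
    (hφ : AEStronglyMeasurable φ μ) : ∫ x, φ (s x) ∂μ = ∫ x, φ x ∂μ := by
  have := integral_map (μ := μ) hs.measurable.aemeasurable (f := φ)
    (by rwa [hs.map_eq])
  rw [← this, hs.map_eq]

/-! ### Tensorization of the parity form. -/

section Product
variable {X Y : Type*} [MeasurableSpace X] [MeasurableSpace Y]

theorem ae_memLp_two_prod_right {μ : Measure X} {ν : Measure Y} [SFinite μ] [SFinite ν]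
    {F : X × Y → ℝ} (hF : MemLp F 2 (μ.prod ν)) : ∀ᵐ x ∂μ, MemLp (fun y => F (x, y)) 2 ν := by
  filter_upwards [hF.integrable_sq.prod_right_ae, hF.aestronglyMeasurable.prodMk_left] with x h1 h2
  exact (memLp_two_iff_integrable_sq h2).2 h1

/-- Square of the mean at most mean of the square, on almost every fibre. -/
theorem memLp_two_integral_prod {μ : Measure X} {ν : Measure Y} [SFinite μ]
    [IsProbabilityMeasure ν] {F : X × Y → ℝ} (hF : MemLp F 2 (μ.prod ν)) :
    MemLp (fun x => ∫ y, F (x, y) ∂ν) 2 μ := by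
  have hm : AEStronglyMeasurable (fun x => ∫ y, F (x, y) ∂ν) μ :=
    hF.aestronglyMeasurable.integral_prod_right'
  rw [memLp_two_iff_integrable_sq hm]
  refine hF.integrable_sq.integral_prod_left.mono' (hm.pow 2) ?_
  filter_upwards [ae_memLp_two_prod_right hF] with x hx
  have h := variance_nonneg (fun y => F (x, y)) ν
  rw [variance_eq_sub hx] at h
  rw [Real.norm_eq_abs, abs_of_nonneg (sq_nonneg _)]
  simpa using h

/-- Pythagoras for the component of `F` that has mean zero in each variable separately. -/
theorem integral_sq_sub_marginals {μ : Measure X} {ν : Measure Y} [IsProbabilityMeasure μ]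
    [IsProbabilityMeasure ν] {F : X × Y → ℝ} {A : Y → ℝ} {B : X → ℝ} {m : ℝ}
    (hF : MemLp F 2 (μ.prod ν)) (hA : MemLp A 2 ν) (hB : MemLp B 2 μ)
    (hAF : ∀ y, ∫ x, F (x, y) ∂μ = A y) (hBF : ∀ x, ∫ y, F (x, y) ∂ν = B x)
    (hm : ∫ p, F p ∂(μ.prod ν) = m) :
    ∫ p, (F p - A p.2 - B p.1 + m) ^ 2 ∂(μ.prod ν) =
      ∫ p, F p ^ 2 ∂(μ.prod ν) - ∫ y, A y ^ 2 ∂ν - ∫ x, B x ^ 2 ∂μ + m ^ 2 := by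
  have hFi := hF.integrable one_le_two
  have hmA : ∫ y, A y ∂ν = m := by
    rw [← hm, integral_prod_symm _ hFi]; simp only [hAF]
  have hmB : ∫ x, B x ∂μ = m := by
    rw [← hm, integral_prod _ hFi]; simp only [hBF]
  obtain ⟨a, ha⟩ : ∃ a : X × Y → ℝ, ∀ p, A p.2 = a p := ⟨_, fun _ => rfl⟩
  obtain ⟨b, hb⟩ : ∃ b : X × Y → ℝ, ∀ p, B p.1 = b p := ⟨_, fun _ => rfl⟩
  have hsnd : MeasurePreserving Prod.snd (μ.prod ν) ν := measurePreserving_snd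
  have hfst : MeasurePreserving Prod.fst (μ.prod ν) μ := measurePreserving_fst
  have ma : MemLp a 2 (μ.prod ν) := by rw [← funext ha]; exact hA.comp_measurePreserving hsnd
  have mb : MemLp b 2 (μ.prod ν) := by rw [← funext hb]; exact hB.comp_measurePreserving hfst
  have i1 : Integrable (fun p => F p ^ 2) (μ.prod ν) := hF.integrable_sq
  have i2 : Integrable (fun p => a p ^ 2) (μ.prod ν) := ma.integrable_sq
  have i3 : Integrable (fun p => b p ^ 2) (μ.prod ν) := mb.integrable_sq
  have i4 : Integrable (fun p => F p * a p) (μ.prod ν) := hF.integrable_mul ma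
  have i5 : Integrable (fun p => F p * b p) (μ.prod ν) := hF.integrable_mul mb
  have i6 : Integrable (fun p => a p * b p) (μ.prod ν) := ma.integrable_mul mb
  have i7 := ma.integrable one_le_two
  have i8 := mb.integrable one_le_two
  have e2 : ∫ p, a p ^ 2 ∂(μ.prod ν) = ∫ y, A y ^ 2 ∂ν := by
    rw [integral_prod_symm _ i2]; simp [← ha]
  have e3 : ∫ p, b p ^ 2 ∂(μ.prod ν) = ∫ x, B x ^ 2 ∂μ := by
    rw [integral_prod _ i3]; simp [← hb]
  have e4 : ∫ p, F p * a p ∂(μ.prod ν) = ∫ y, A y ^ 2 ∂ν := by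
    rw [integral_prod_symm _ i4]; simp [← ha, integral_mul_const, hAF, sq]
  have e5 : ∫ p, F p * b p ∂(μ.prod ν) = ∫ x, B x ^ 2 ∂μ := by
    rw [integral_prod _ i5]; simp [← hb, integral_mul_const, hBF, sq]
  have e6 : ∫ p, a p * b p ∂(μ.prod ν) = m * m := by
    rw [integral_prod _ i6]; simp [← hb, ← ha, integral_mul_const, integral_const_mul, hmA, hmB]
  have e7 : ∫ p, a p ∂(μ.prod ν) = m := by
    rw [integral_prod_symm _ i7]; simp [← ha, hmA]
  have e8 : ∫ p, b p ∂(μ.prod ν) = m := by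
    rw [integral_prod _ i8]; simp [← hb, hmB]
  simp only [ha, hb]
  have key : ∀ p, (F p - a p - b p + m) ^ 2 = F p ^ 2 + (a p ^ 2 + (b p ^ 2 + (m ^ 2 +
      ((-2) * (F p * a p) + ((-2) * (F p * b p) + (2 * m * F p + (2 * (a p * b p) +
      ((-2 * m) * a p + (-2 * m) * b p)))))))) := fun p => by ring
  simp only [key]
  iterate 9 rw [integral_add (by fun_prop) (by fun_prop)]
  simp only [integral_const_mul, e2, e3, e4, e5, e6, e7, e8, hm, integral_const, probReal_univ,
    smul_eq_mul]
  ring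

/-- The combination is the projection onto functions odd in each variable. Its norm expands using
invariance under `s` and `t`; being an average of four isometries up to sign, it is a contraction.
-/
theorem integral_sq_odd_odd {μ : Measure X} {ν : Measure Y} [IsProbabilityMeasure μ]
    [IsProbabilityMeasure ν] {s : X → X} {t : Y → Y} (hs : MeasurePreserving s μ μ)
    (ht : MeasurePreserving t ν ν) (hss : ∀ x, s (s x) = x) {F : X × Y → ℝ}
    (hF : MemLp F 2 (μ.prod ν)) :
    ∫ p, ((F p - F (s p.1, p.2) - F (p.1, t p.2) + F (s p.1, t p.2)) / 4) ^ 2 ∂(μ.prod ν) =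
      1 / 4 * (∫ p, F p ^ 2 ∂(μ.prod ν) - ∫ p, F p * F (s p.1, p.2) ∂(μ.prod ν)
        - ∫ p, F p * F (p.1, t p.2) ∂(μ.prod ν) + ∫ p, F p * F (s p.1, t p.2) ∂(μ.prod ν)) ∧
    ∀ g : X × Y → ℝ, MemLp g 2 (μ.prod ν) →
      ∫ p, ((g p - g (s p.1, p.2) - g (p.1, t p.2) + g (s p.1, t p.2)) / 4) ^ 2 ∂(μ.prod ν) ≤
        ∫ p, g p ^ 2 ∂(μ.prod ν) := by
  have h1 : MeasurePreserving (fun p : X × Y => (s p.1, p.2)) (μ.prod ν) (μ.prod ν) :=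
    hs.prod (MeasurePreserving.id ν)
  have h2 : MeasurePreserving (fun p : X × Y => (p.1, t p.2)) (μ.prod ν) (μ.prod ν) :=
    (MeasurePreserving.id μ).prod ht
  have h3 : MeasurePreserving (fun p : X × Y => (s p.1, t p.2)) (μ.prod ν) (μ.prod ν) :=
    hs.prod ht
  constructor
  · obtain ⟨F1, hF1⟩ : ∃ F1 : X × Y → ℝ, ∀ p, F (s p.1, p.2) = F1 p := ⟨_, fun _ => rfl⟩
    obtain ⟨F2, hF2⟩ : ∃ F2 : X × Y → ℝ, ∀ p, F (p.1, t p.2) = F2 p := ⟨_, fun _ => rfl⟩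
    obtain ⟨F3, hF3⟩ : ∃ F3 : X × Y → ℝ, ∀ p, F (s p.1, t p.2) = F3 p := ⟨_, fun _ => rfl⟩
    have m1 : MemLp F1 2 (μ.prod ν) := by rw [← funext hF1]; exact hF.comp_measurePreserving h1
    have m2 : MemLp F2 2 (μ.prod ν) := by rw [← funext hF2]; exact hF.comp_measurePreserving h2
    have m3 : MemLp F3 2 (μ.prod ν) := by rw [← funext hF3]; exact hF.comp_measurePreserving h3
    have q0 : Integrable (fun p => F p ^ 2) (μ.prod ν) := hF.integrable_sq
    have q1 : Integrable (fun p => F1 p ^ 2) (μ.prod ν) := m1.integrable_sq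
    have q2 : Integrable (fun p => F2 p ^ 2) (μ.prod ν) := m2.integrable_sq
    have q3 : Integrable (fun p => F3 p ^ 2) (μ.prod ν) := m3.integrable_sq
    have p01 : Integrable (fun p => F p * F1 p) (μ.prod ν) := hF.integrable_mul m1
    have p02 : Integrable (fun p => F p * F2 p) (μ.prod ν) := hF.integrable_mul m2
    have p03 : Integrable (fun p => F p * F3 p) (μ.prod ν) := hF.integrable_mul m3
    have p12 : Integrable (fun p => F1 p * F2 p) (μ.prod ν) := m1.integrable_mul m2
    have p13 : Integrable (fun p => F1 p * F3 p) (μ.prod ν) := m1.integrable_mul m3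
    have p23 : Integrable (fun p => F2 p * F3 p) (μ.prod ν) := m2.integrable_mul m3
    have e1 : ∫ p, F1 p ^ 2 ∂(μ.prod ν) = ∫ p, F p ^ 2 ∂(μ.prod ν) := by
      rw [← h1.integral_comp_eq q0.aestronglyMeasurable]; simp only [hF1]
    have e2 : ∫ p, F2 p ^ 2 ∂(μ.prod ν) = ∫ p, F p ^ 2 ∂(μ.prod ν) := by
      rw [← h2.integral_comp_eq q0.aestronglyMeasurable]; simp only [hF2]
    have e3 : ∫ p, F3 p ^ 2 ∂(μ.prod ν) = ∫ p, F p ^ 2 ∂(μ.prod ν) := by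
      rw [← h3.integral_comp_eq q0.aestronglyMeasurable]; simp only [hF3]
    have e12 : ∫ p, F1 p * F2 p ∂(μ.prod ν) = ∫ p, F p * F3 p ∂(μ.prod ν) := by
      rw [← h1.integral_comp_eq p12.aestronglyMeasurable]
      simp only [← hF1, ← hF2, ← hF3, hss]
    have e13 : ∫ p, F1 p * F3 p ∂(μ.prod ν) = ∫ p, F p * F2 p ∂(μ.prod ν) := by
      rw [← h1.integral_comp_eq p13.aestronglyMeasurable]
      simp only [← hF1, ← hF2, ← hF3, hss]
    have e23 : ∫ p, F2 p * F3 p ∂(μ.prod ν) = ∫ p, F p * F1 p ∂(μ.prod ν) := by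
      rw [← h2.integral_comp_eq p01.aestronglyMeasurable]
      simp only [← hF1, ← hF2, ← hF3]
    simp only [hF1, hF2, hF3]
    have key : ∀ p, ((F p - F1 p - F2 p + F3 p) / 4) ^ 2 =
        1/16 * F p ^ 2 + (1/16 * F1 p ^ 2 + (1/16 * F2 p ^ 2 + (1/16 * F3 p ^ 2 +
        ((-(1/8)) * (F p * F1 p) + ((-(1/8)) * (F p * F2 p) + (1/8 * (F p * F3 p) +
        (1/8 * (F1 p * F2 p) + ((-(1/8)) * (F1 p * F3 p) + (-(1/8)) * (F2 p * F3 p)))))))))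
        := fun p => by ring
    simp only [key]
    iterate 9 rw [integral_add (by fun_prop) (by fun_prop)]
    simp only [integral_const_mul, e1, e2, e3, e12, e13, e23]
    ring
  · intro g hg
    obtain ⟨F1, hF1⟩ : ∃ F1 : X × Y → ℝ, ∀ p, g (s p.1, p.2) = F1 p := ⟨_, fun _ => rfl⟩
    obtain ⟨F2, hF2⟩ : ∃ F2 : X × Y → ℝ, ∀ p, g (p.1, t p.2) = F2 p := ⟨_, fun _ => rfl⟩
    obtain ⟨F3, hF3⟩ : ∃ F3 : X × Y → ℝ, ∀ p, g (s p.1, t p.2) = F3 p := ⟨_, fun _ => rfl⟩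
    have m1 : MemLp F1 2 (μ.prod ν) := by rw [← funext hF1]; exact hg.comp_measurePreserving h1
    have m2 : MemLp F2 2 (μ.prod ν) := by rw [← funext hF2]; exact hg.comp_measurePreserving h2
    have m3 : MemLp F3 2 (μ.prod ν) := by rw [← funext hF3]; exact hg.comp_measurePreserving h3
    have q0 : Integrable (fun p => g p ^ 2) (μ.prod ν) := hg.integrable_sq
    have q1 : Integrable (fun p => F1 p ^ 2) (μ.prod ν) := m1.integrable_sq
    have q2 : Integrable (fun p => F2 p ^ 2) (μ.prod ν) := m2.integrable_sq
    have q3 : Integrable (fun p => F3 p ^ 2) (μ.prod ν) := m3.integrable_sq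
    have e1 : ∫ p, F1 p ^ 2 ∂(μ.prod ν) = ∫ p, g p ^ 2 ∂(μ.prod ν) := by
      rw [← h1.integral_comp_eq q0.aestronglyMeasurable]; simp only [hF1]
    have e2 : ∫ p, F2 p ^ 2 ∂(μ.prod ν) = ∫ p, g p ^ 2 ∂(μ.prod ν) := by
      rw [← h2.integral_comp_eq q0.aestronglyMeasurable]; simp only [hF2]
    have e3 : ∫ p, F3 p ^ 2 ∂(μ.prod ν) = ∫ p, g p ^ 2 ∂(μ.prod ν) := by
      rw [← h3.integral_comp_eq q0.aestronglyMeasurable]; simp only [hF3]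
    simp only [hF1, hF2, hF3]
    calc ∫ p, ((g p - F1 p - F2 p + F3 p) / 4) ^ 2 ∂(μ.prod ν)
        ≤ ∫ p, (1/4 * g p ^ 2 + (1/4 * F1 p ^ 2 + (1/4 * F2 p ^ 2 + 1/4 * F3 p ^ 2)))
            ∂(μ.prod ν) := by
          apply integral_mono_of_nonneg (.of_forall fun p => sq_nonneg _) (by fun_prop)
          refine .of_forall fun p => ?_
          simp only
          nlinarith [sq_nonneg (g p + F1 p), sq_nonneg (g p + F2 p), sq_nonneg (g p - F3 p),
            sq_nonneg (F1 p - F2 p), sq_nonneg (F1 p + F3 p), sq_nonneg (F2 p + F3 p)]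
      _ = _ := by
          iterate 3 rw [integral_add (by fun_prop) (by fun_prop)]
          simp only [integral_const_mul, e1, e2, e3]
          ring

/-- The right side minus the left side equals `‖G‖² - ‖H‖²`, where `G` is `F` with both marginals
removed and `H` is the odd-odd part of `F`. As `H` is also the odd-odd part of `G`, contractivity
gives the sign. In spectral terms, the form has weights 0, 1, 1/2 on constants, centred even
functions and odd functions, and these weights are subadditive under products. -/
theorem parityForm_prod_le {μ : Measure X} {ν : Measure Y} [IsProbabilityMeasure μ]
    [IsProbabilityMeasure ν] {s : X → X} {t : Y → Y} (hs : MeasurePreserving s μ μ)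
    (ht : MeasurePreserving t ν ν) (hss : ∀ x, s (s x) = x) {F : X × Y → ℝ}
    (hF : MemLp F 2 (μ.prod ν)) :
    Integrable (fun y => parityForm μ s fun x => F (x, y)) ν ∧
    Integrable (fun x => parityForm ν t fun y => F (x, y)) μ ∧
    parityForm (μ.prod ν) (fun p => (s p.1, t p.2)) F ≤
      ∫ y, parityForm μ s (fun x => F (x, y)) ∂ν + ∫ x, parityForm ν t (fun y => F (x, y)) ∂μ := by
  have h1 : MeasurePreserving (fun p : X × Y => (s p.1, p.2)) (μ.prod ν) (μ.prod ν) :=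
    hs.prod (MeasurePreserving.id ν)
  have h2 : MeasurePreserving (fun p : X × Y => (p.1, t p.2)) (μ.prod ν) (μ.prod ν) :=
    (MeasurePreserving.id μ).prod ht
  have mB := memLp_two_integral_prod hF
  have mA : MemLp (fun y => ∫ x, F (x, y) ∂μ) 2 ν :=
    memLp_two_integral_prod (hF.comp_measurePreserving (Measure.measurePreserving_swap))
  have i0 : Integrable (fun p => F p ^ 2) (μ.prod ν) := hF.integrable_sq
  have i1 : Integrable (fun p => F p * F (s p.1, p.2)) (μ.prod ν) :=
    hF.integrable_mul (hF.comp_measurePreserving h1)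
  have i2 : Integrable (fun p => F p * F (p.1, t p.2)) (μ.prod ν) :=
    hF.integrable_mul (hF.comp_measurePreserving h2)
  have j1 : Integrable (fun y => ∫ x, F (x, y) ^ 2 ∂μ) ν := i0.integral_prod_right
  have j2 : Integrable (fun y => ∫ x, F (x, y) * F (s x, y) ∂μ) ν := i1.integral_prod_right
  have j3 : Integrable (fun y => (∫ x, F (x, y) ∂μ) ^ 2) ν := mA.integrable_sq
  have k1 : Integrable (fun x => ∫ y, F (x, y) ^ 2 ∂ν) μ := i0.integral_prod_left
  have k2 : Integrable (fun x => ∫ y, F (x, y) * F (x, t y) ∂ν) μ := i2.integral_prod_left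
  have k3 : Integrable (fun x => (∫ y, F (x, y) ∂ν) ^ 2) μ := mB.integrable_sq
  refine ⟨((j1.const_mul _).add (j2.const_mul _)).sub j3,
    ((k1.const_mul _).add (k2.const_mul _)).sub k3, ?_⟩
  have eA : ∫ y, parityForm μ s (fun x => F (x, y)) ∂ν = 3 / 4 * ∫ p, F p ^ 2 ∂(μ.prod ν) +
      1 / 4 * ∫ p, F p * F (s p.1, p.2) ∂(μ.prod ν) - ∫ y, (∫ x, F (x, y) ∂μ) ^ 2 ∂ν := by
    simp only [parityForm]
    rw [integral_sub (by fun_prop) (by fun_prop), integral_add (by fun_prop) (by fun_prop), integral_const_mul, integral_const_mul,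
      integral_prod_symm _ i0, integral_prod_symm _ i1]
  have eB : ∫ x, parityForm ν t (fun y => F (x, y)) ∂μ = 3 / 4 * ∫ p, F p ^ 2 ∂(μ.prod ν) +
      1 / 4 * ∫ p, F p * F (p.1, t p.2) ∂(μ.prod ν) - ∫ x, (∫ y, F (x, y) ∂ν) ^ 2 ∂μ := by
    simp only [parityForm]
    rw [integral_sub (by fun_prop) (by fun_prop), integral_add (by fun_prop) (by fun_prop), integral_const_mul, integral_const_mul,
      integral_prod _ i0, integral_prod _ i2]
  have hG := integral_sq_sub_marginals hF mA mB (fun _ => rfl) (fun _ => rfl) rfl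
  obtain ⟨hH, hle⟩ := integral_sq_odd_odd hs ht hss hF
  have hsnd : MeasurePreserving Prod.snd (μ.prod ν) ν := measurePreserving_snd
  have hfst : MeasurePreserving Prod.fst (μ.prod ν) μ := measurePreserving_fst
  have mG : MemLp (fun p : X × Y => F p - (∫ x, F (x, p.2) ∂μ) - (∫ y, F (p.1, y) ∂ν) +
      ∫ p, F p ∂(μ.prod ν)) 2 (μ.prod ν) :=
    ((hF.sub (mA.comp_measurePreserving hsnd)).sub (mB.comp_measurePreserving hfst)).add
      (memLp_const _)
  have h := hle _ mG
  rw [hG] at h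
  -- Each marginal depends on one variable only, so antisymmetrizing in the other variable removes
  -- it: `G` and `F` have the same odd-odd part.
  have e : ∀ p : X × Y, (F p - (∫ x, F (x, p.2) ∂μ) - (∫ y, F (p.1, y) ∂ν) +
        ∫ p, F p ∂(μ.prod ν) - (F (s p.1, p.2) - (∫ x, F (x, p.2) ∂μ) -
        (∫ y, F (s p.1, y) ∂ν) + ∫ p, F p ∂(μ.prod ν)) - (F (p.1, t p.2) -
        (∫ x, F (x, t p.2) ∂μ) - (∫ y, F (p.1, y) ∂ν) + ∫ p, F p ∂(μ.prod ν)) +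
        (F (s p.1, t p.2) - (∫ x, F (x, t p.2) ∂μ) - (∫ y, F (s p.1, y) ∂ν) +
        ∫ p, F p ∂(μ.prod ν))) / 4 =
      (F p - F (s p.1, p.2) - F (p.1, t p.2) + F (s p.1, t p.2)) / 4 := fun p => by ring
  simp only [e] at h
  rw [hH] at h
  rw [eA, eB, parityForm]
  linarith

end Product

theorem ofReal_integral_le_lintegral {X : Type*} [MeasurableSpace X] {μ : Measure X} {f : X → ℝ}
    (hf : Integrable f μ) : ENNReal.ofReal (∫ x, f x ∂μ) ≤ ∫⁻ x, ENNReal.ofReal (f x) ∂μ := by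
  calc ENNReal.ofReal (∫ x, f x ∂μ) ≤ ENNReal.ofReal (∫ x, max (f x) 0 ∂μ) :=
        ENNReal.ofReal_le_ofReal (integral_mono hf hf.pos_part fun x => le_max_left _ _)
    _ = ∫⁻ x, ENNReal.ofReal (max (f x) 0) ∂μ :=
        ofReal_integral_eq_lintegral_ofReal hf.pos_part (.of_forall fun x => le_max_right _ _)
    _ = _ := by simp

theorem measurePreserving_neg_pi {ν : Measure ℝ} [IsProbabilityMeasure ν]
    (hν : MeasurePreserving (fun t : ℝ => -t) ν ν) (n : ℕ) :
    MeasurePreserving (fun x : Fin n → ℝ => -x) (Measure.pi fun _ => ν) (Measure.pi fun _ => ν) :=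
  measurePreserving_pi (fun _ => ν) (fun _ => ν) (f := fun _ t => -t) fun _ => hν

/-- Induction on the dimension, splitting off coordinate 0 with `parityForm_prod_le`. The functions
`g i` stand for squared partial derivatives, and the inequality is required only on almost every
line parallel to an axis, since lines through the origin can be bad. -/
theorem parityForm_pi_le {ν : Measure ℝ} [IsProbabilityMeasure ν]
    (hν : MeasurePreserving (fun t : ℝ => -t) ν ν) {lam : ℝ} (hlam : 0 ≤ lam) {n : ℕ} :
    ∀ {F : (Fin n → ℝ) → ℝ} {g : Fin n → (Fin n → ℝ) → ENNReal},
    (∀ i, Measurable (g i)) → MemLp F 2 (Measure.pi fun _ => ν) →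
    (∀ i, ∀ᵐ x ∂(Measure.pi fun _ => ν),
      ENNReal.ofReal (lam * parityForm ν (fun t => -t) fun t => F (Function.update x i t)) ≤
        ∫⁻ t, g i (Function.update x i t) ∂ν) →
    ENNReal.ofReal (lam * parityForm (Measure.pi fun _ => ν) (fun x => -x) F) ≤
      ∑ i, ∫⁻ x, g i x ∂(Measure.pi fun _ => ν) := by
  induction n with
  | zero =>
    intro F g _ _ _
    -- On a one-point space the form vanishes: `3/4 + 1/4 - 1 = 0`.
    obtain ⟨c, hc⟩ : ∃ c, ∀ x, F x = c := ⟨F 0, fun x => by rw [Subsingleton.elim x 0]⟩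
    have : parityForm (Measure.pi fun _ : Fin 0 => ν) (fun x => -x) F = 0 := by
      simp only [parityForm, hc, integral_const, probReal_univ, smul_eq_mul]
      ring
    rw [this]
    simp
  | succ n ih =>
    intro F g hg hF h
    set P := Measure.pi fun _ : Fin n => ν with hP
    set e := MeasurableEquiv.piFinSuccAbove (fun _ : Fin (n + 1) => ℝ) 0 with he_def
    have he : MeasurePreserving e (Measure.pi fun _ => ν) (ν.prod P) :=
      measurePreserving_piFinSuccAbove (fun _ => ν) 0
    have hes : MeasurePreserving e.symm (ν.prod P) (Measure.pi fun _ => ν) := he.symm e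
    have hcons : ∀ p : ℝ × (Fin n → ℝ), e.symm p = Fin.cons p.1 p.2 := fun p => by
      rw [he_def]
      exact Fin.insertNth_zero' _ _
    set F' : ℝ × (Fin n → ℝ) → ℝ := fun p => F (Fin.cons p.1 p.2) with hF'
    have hFe : F' = F ∘ e.symm := by ext p; simp [hF', hcons]
    have mF' : MemLp F' 2 (ν.prod P) := by rw [hFe]; exact hF.comp_measurePreserving hes
    have hcm : MeasurePreserving (fun p : ℝ × (Fin n → ℝ) => (Fin.cons p.1 p.2 : Fin (n + 1) → ℝ))
        (ν.prod P) (Measure.pi fun _ => ν) := by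
      rw [← funext hcons]; exact hes
    have tr : ∀ φ : (Fin (n + 1) → ℝ) → ℝ, ∫ x, φ x ∂(Measure.pi fun _ => ν) =
        ∫ p, φ (Fin.cons p.1 p.2) ∂(ν.prod P) := fun φ => by
      rw [← hes.integral_comp' (f := e.symm) φ]
      simp only [hcons]
    have hform : parityForm (Measure.pi fun _ => ν) (fun x => -x) F =
        parityForm (ν.prod P) (fun p => (-p.1, -p.2)) F' := by
      have hneg : ∀ p : ℝ × (Fin n → ℝ), -(Fin.cons p.1 p.2 : Fin (n + 1) → ℝ) =
          Fin.cons (-p.1) (-p.2) := fun p => by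
        ext i
        refine Fin.cases ?_ (fun j => ?_) i <;> simp
      simp only [parityForm, tr, hneg, hF']
    obtain ⟨I1, I2, hle⟩ := parityForm_prod_le hν (measurePreserving_neg_pi hν n)
      (fun x => neg_neg x) mF'
    have hA : ∀ i, ∀ᵐ p ∂(ν.prod P),
        ENNReal.ofReal (lam * parityForm ν (fun t => -t) fun t =>
          F (Function.update (Fin.cons p.1 p.2) i t)) ≤
        ∫⁻ t, g i (Function.update (Fin.cons p.1 p.2) i t) ∂ν := fun i =>
      hcm.quasiMeasurePreserving.ae (h i)
    have hB : ∀ i, ∀ᵐ t ∂ν, ∀ᵐ y ∂P,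
        ENNReal.ofReal (lam * parityForm ν (fun t => -t) fun s =>
          F (Function.update (Fin.cons t y) i s)) ≤
        ∫⁻ s, g i (Function.update (Fin.cons t y) i s) ∂ν := fun i =>
      Measure.ae_ae_of_ae_prod (hA i)
    have h0 : ∀ᵐ y ∂P, ENNReal.ofReal (lam * parityForm ν (fun t => -t) fun t => F' (t, y)) ≤
        ∫⁻ t, g 0 (Fin.cons t y) ∂ν := by
      -- The inequality along coordinate 0 does not depend on the starting value of that coordinate,
      -- which is overwritten, so one good `t` suffices.
      obtain ⟨t, ht⟩ := (hB 0).exists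
      filter_upwards [ht] with y hy
      simpa [Fin.update_cons_zero, hF'] using hy
    have hs : ∀ᵐ t ∂ν, ENNReal.ofReal (lam * parityForm P (fun x => -x) fun y => F' (t, y)) ≤
        ∑ i : Fin n, ∫⁻ y, g i.succ (Fin.cons t y) ∂P := by
      have hB' := ae_all_iff.2 fun i : Fin n => hB i.succ
      filter_upwards [hB', ae_memLp_two_prod_right mF'] with t ht1 ht2
      apply ih (g := fun i y => g i.succ (Fin.cons t y))
      · intro i
        refine (hg i.succ).comp ?_
        exact hcm.measurable.comp measurable_prodMk_left
      · exact ht2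
      · intro i
        filter_upwards [ht1 i] with y hy
        simpa [← Fin.cons_update, hF'] using hy
    have hg' : ∀ i, Measurable fun p : ℝ × (Fin n → ℝ) => g i (Fin.cons p.1 p.2) := fun i =>
      (hg i).comp hcm.measurable
    have trl : ∀ i, ∫⁻ x, g i x ∂(Measure.pi fun _ => ν) =
        ∫⁻ p, g i (Fin.cons p.1 p.2) ∂(ν.prod P) := fun i =>
      (hcm.lintegral_comp (hg i)).symm
    rw [hform]
    calc ENNReal.ofReal (lam * parityForm (ν.prod P) (fun p => (-p.1, -p.2)) F')
        ≤ ENNReal.ofReal (lam * (∫ y, parityForm ν (fun t => -t) (fun t => F' (t, y)) ∂P +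
            ∫ t, parityForm P (fun x => -x) (fun y => F' (t, y)) ∂ν)) :=
          ENNReal.ofReal_le_ofReal (mul_le_mul_of_nonneg_left hle hlam)
      _ ≤ ENNReal.ofReal (∫ y, lam * parityForm ν (fun t => -t) (fun t => F' (t, y)) ∂P) +
            ENNReal.ofReal (∫ t, lam * parityForm P (fun x => -x) (fun y => F' (t, y)) ∂ν) := by
          rw [mul_add, integral_const_mul, integral_const_mul]
          exact ENNReal.ofReal_add_le
      _ ≤ (∫⁻ y, ∫⁻ t, g 0 (Fin.cons t y) ∂ν ∂P) +
            ∫⁻ t, ∑ i : Fin n, ∫⁻ y, g i.succ (Fin.cons t y) ∂P ∂ν := by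
          refine add_le_add ?_ ?_
          · exact (ofReal_integral_le_lintegral (I1.const_mul lam)).trans (lintegral_mono_ae h0)
          · exact (ofReal_integral_le_lintegral (I2.const_mul lam)).trans (lintegral_mono_ae hs)
      _ = _ := by
          rw [Fin.sum_univ_succ]
          congr 1
          · rw [trl, lintegral_prod_symm _ (hg' 0).aemeasurable]
          · rw [lintegral_finsetSum _ fun i _ => (hg' i.succ).lintegral_prod_right']
            refine Finset.sum_congr rfl fun i _ => ?_
            rw [trl, lintegral_prod _ (hg' i.succ).aemeasurable]

/-! ### Product measures, polar coordinates and homogeneous functions. -/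

theorem lintegral_pi_prod_eq_prod_lintegral {n : ℕ} :
    ∀ {μ : Fin n → Measure ℝ} [∀ i, SigmaFinite (μ i)] {f : Fin n → ℝ → ENNReal},
    (∀ i, Measurable (f i)) →
    ∫⁻ x, ∏ i, f i (x i) ∂(Measure.pi μ) = ∏ i, ∫⁻ t, f i t ∂(μ i) := by
  induction n with
  | zero =>
    intro μ _ f _
    simp
  | succ n ih =>
    intro μ _ f hf
    have he := (measurePreserving_piFinSuccAbove μ 0).symm
    rw [← he.lintegral_comp (by fun_prop), Fin.prod_univ_succ]
    have h1 : ∀ p : ℝ × (Fin n → ℝ), ∏ i, f i ((MeasurableEquiv.piFinSuccAbove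
        (fun _ : Fin (n + 1) => ℝ) 0).symm p i) = f 0 p.1 * ∏ i : Fin n, f i.succ (p.2 i) := by
      intro p
      rw [Fin.prod_univ_succ]
      congr 1
    simp only [h1]
    rw [lintegral_prod_mul (f := f 0) (g := fun y : Fin n → ℝ => ∏ i : Fin n, f i.succ (y i))
      (hf 0).aemeasurable
      (Finset.measurable_prod _ fun i _ => (hf i.succ).comp (measurable_pi_apply i)).aemeasurable, ← ih (fun i => hf i.succ)]
    rfl

theorem pi_withDensity {n : ℕ} {f : Fin n → ℝ → ENNReal} (hf : ∀ i, Measurable (f i))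
    [∀ i, SigmaFinite ((volume : Measure ℝ).withDensity (f i))] :
    Measure.pi (fun i => (volume : Measure ℝ).withDensity (f i)) =
      (volume : Measure (Fin n → ℝ)).withDensity fun x => ∏ i, f i (x i) := by
  refine Measure.pi_eq fun s hs => ?_
  rw [withDensity_apply _ (MeasurableSet.univ_pi hs), volume_pi, Measure.restrict_pi_pi,
    lintegral_pi_prod_eq_prod_lintegral hf]
  exact Finset.prod_congr rfl fun i _ => (withDensity_apply _ (hs i)).symm

theorem lintegral_eq_lintegral_toSphere {n : ℕ} (hn : 0 < n)
    {G : EuclideanSpace ℝ (Fin n) → ENNReal} (hG : Measurable G) :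
    ∫⁻ x, G x = ∫⁻ y : UnitSphere n, (∫⁻ r in Ioi (0:ℝ), ENNReal.ofReal (r ^ (n - 1)) * G (r • y.1))
      ∂(volume : Measure (EuclideanSpace ℝ (Fin n))).toSphere := by
  have : Nonempty (Fin n) := ⟨⟨0, hn⟩⟩
  have hmp := (volume : Measure (EuclideanSpace ℝ (Fin n))).measurePreserving_homeomorphUnitSphereProd
  have h1 : ∫⁻ x, G x = ∫⁻ x : ({(0)}ᶜ : Set (EuclideanSpace ℝ (Fin n))), G x.1
      ∂(volume.comap Subtype.val) := by
    rw [lintegral_subtype_comap (measurableSet_singleton _).compl G, restrict_compl_singleton]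
  have h2 : ∀ x : ({(0)}ᶜ : Set (EuclideanSpace ℝ (Fin n))), G x.1 =
      (fun p : UnitSphere n × Ioi (0:ℝ) => G (p.2.1 • p.1.1)) (homeomorphUnitSphereProd _ x) := by
    intro x
    have hx : ‖x.1‖ ≠ 0 := norm_ne_zero_iff.2 x.2
    simp [homeomorphUnitSphereProd, smul_smul, hx]
  have hm : Measurable (fun p : UnitSphere n × Ioi (0:ℝ) => G (p.2.1 • p.1.1)) := by
    fun_prop
  rw [h1]
  simp only [h2]
  rw [hmp.lintegral_comp hm, lintegral_prod _ hm.aemeasurable]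
  congr 1
  ext y
  simp only [Measure.volumeIoiPow, finrank_euclideanSpace, Fintype.card_fin]
  rw [lintegral_withDensity_eq_lintegral_mul _ (by fun_prop) (by fun_prop)]
  exact lintegral_subtype_comap measurableSet_Ioi
    (fun r : ℝ => ENNReal.ofReal (r ^ (n - 1)) * G (r • y.1))

/-- The product measure on `ℝⁿ` with density proportional to `∏ |xᵢ|^β e^{-|x|²/2}`. -/
noncomputable def gaussMeasPi (n : ℕ) (β : ℝ) : Measure (EuclideanSpace ℝ (Fin n)) :=
  (Measure.pi fun _ : Fin n => gaussMeas β).map (WithLp.toLp 2)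

theorem measurePreserving_toLp_gaussMeasPi (n : ℕ) (β : ℝ) :
    MeasurePreserving (WithLp.toLp 2) (Measure.pi fun _ : Fin n => gaussMeas β)
      (gaussMeasPi n β) :=
  ⟨by fun_prop, rfl⟩

theorem isProbabilityMeasure_gaussMeasPi (n : ℕ) {β : ℝ} (hβ : -1 < β) :
    IsProbabilityMeasure (gaussMeasPi n β) := by
  have := isProbabilityMeasure_gaussMeas hβ
  exact Measure.isProbabilityMeasure_map (by fun_prop)

theorem gaussMeasPi_eq_withDensity (n : ℕ) {β : ℝ} (hβ : -1 < β) :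
    gaussMeasPi n β = (volume : Measure (EuclideanSpace ℝ (Fin n))).withDensity fun x =>
      ∏ i, ENNReal.ofReal (|x i| ^ β * Real.exp (-x i ^ 2 / 2) / (2 * gaussMoment β)) := by
  have := isProbabilityMeasure_gaussMeas hβ
  have (i : Fin n) : SigmaFinite ((volume : Measure ℝ).withDensity fun t =>
      ENNReal.ofReal (|t| ^ β * Real.exp (-t ^ 2 / 2) / (2 * gaussMoment β))) := by
    change SigmaFinite (gaussMeas β)
    infer_instance
  have h := pi_withDensity (n := n) (f := fun _ t =>
    ENNReal.ofReal (|t| ^ β * Real.exp (-t ^ 2 / 2) / (2 * gaussMoment β))) (fun _ => by fun_prop)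
  have hv := PiLp.volume_preserving_toLp (Fin n)
  ext s hs
  rw [gaussMeasPi, Measure.map_apply (by fun_prop) hs]
  change (Measure.pi fun _ : Fin n => (volume : Measure ℝ).withDensity _) _ = _
  rw [h, withDensity_apply _ (by measurability), withDensity_apply _ hs,
    ← hv.setLIntegral_comp_preimage hs (by fun_prop)]

theorem gaussMeasPi_absolutelyContinuous (n : ℕ) {β : ℝ} (hβ : -1 < β) :
    gaussMeasPi n β ≪ volume := by
  rw [gaussMeasPi_eq_withDensity n hβ]
  exact withDensity_absolutelyContinuous _ _

/-- The Gaussian factor depends only on `r` and the weight is homogeneous, so the density splits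
into a radial factor and `|y₁ ⋯ yₙ|^β`. -/
theorem prod_gaussDensity_smul {n : ℕ} {β r : ℝ} (y : UnitSphere n) (hr : 0 < r) :
    ∏ i, (|(r • y.1) i| ^ β * Real.exp (-(r • y.1) i ^ 2 / 2) / (2 * gaussMoment β)) =
      r ^ (n * β) * |∏ i, y.1 i| ^ β * Real.exp (-r ^ 2 / 2) / (2 * gaussMoment β) ^ n := by
  have hy : ∑ i, y.1 i ^ 2 = 1 := by
    have := EuclideanSpace.norm_sq_eq y.1
    rw [norm_eq_of_mem_sphere y] at this
    simpa using this.symm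
  rw [Finset.prod_div_distrib, Finset.prod_mul_distrib, ← Real.exp_sum, Finset.prod_const,
    Finset.card_univ, Fintype.card_fin, Real.finsetProd_rpow _ _ fun _ _ => abs_nonneg _,
    ← Finset.abs_prod]
  simp only [PiLp.smul_apply, smul_eq_mul, Finset.prod_mul_distrib, Finset.prod_const,
    Finset.card_univ, Fintype.card_fin]
  rw [abs_mul, abs_of_pos (pow_pos hr n), Real.mul_rpow (by positivity) (by positivity),
    ← Real.rpow_natCast_mul hr.le]
  congr 3
  rw [← Finset.sum_div]
  congr 1
  simp only [mul_pow, Finset.sum_neg_distrib, ← Finset.mul_sum, hy, mul_one]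

/-- Polar coordinates. The radial exponent `p + n(β+1) - 1` collects `n - 1` from the Jacobian, `nβ`
from the weight and `p` from `G`. -/
theorem lintegral_gaussMeasPi_of_homogeneous {n : ℕ} (hn : 0 < n) {β p : ℝ} (hβ : -1 < β)
    (hp : 0 < p + n * (β + 1)) {G : EuclideanSpace ℝ (Fin n) → ENNReal} (hG : Measurable G)
    {g : UnitSphere n → ENNReal}
    (hGg : ∀ (y : UnitSphere n) (r : ℝ), 0 < r → G (r • y.1) = ENNReal.ofReal (r ^ p) * g y) :
    ∫⁻ x, G x ∂(gaussMeasPi n β) =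
      ENNReal.ofReal (gaussMoment (p + n * (β + 1) - 1) / (2 * gaussMoment β) ^ n) *
        ∫⁻ y : UnitSphere n, g y * ENNReal.ofReal (|∏ i, y.1 i| ^ β)
          ∂(volume : Measure (EuclideanSpace ℝ (Fin n))).toSphere := by
  have hI := gaussMoment_pos hβ
  rw [gaussMeasPi_eq_withDensity n hβ, lintegral_withDensity_eq_lintegral_mul _ (by fun_prop) hG,
    lintegral_eq_lintegral_toSphere hn (by fun_prop), ← lintegral_const_mul' _ _ (by simp)]
  refine lintegral_congr fun y => ?_
  have hpt : ∀ r ∈ Ioi (0:ℝ), ENNReal.ofReal (r ^ (n - 1)) * ((fun x : EuclideanSpace ℝ (Fin n) =>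
      ∏ i, ENNReal.ofReal (|x i| ^ β * Real.exp (-x i ^ 2 / 2) / (2 * gaussMoment β))) * G)
        (r • y.1) = ENNReal.ofReal (r ^ (p + n * (β + 1) - 1) * Real.exp (-r ^ 2 / 2)) *
        (ENNReal.ofReal (1 / (2 * gaussMoment β) ^ n) *
          (g y * ENNReal.ofReal (|∏ i, y.1 i| ^ β))) := by
    intro r hr
    have hr : 0 < r := hr
    simp only [Pi.mul_apply]
    rw [hGg y r hr, ← ENNReal.ofReal_prod_of_nonneg (fun i _ => by positivity),
      prod_gaussDensity_smul y hr]
    have e1 : r ^ (p + n * (β + 1) - 1) = r ^ (n - 1) * r ^ (n * β) * r ^ p := by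
      rw [← Real.rpow_natCast, ← Real.rpow_add hr, ← Real.rpow_add hr, Nat.cast_pred hn]
      ring_nf
    calc ENNReal.ofReal (r ^ (n - 1)) * (ENNReal.ofReal (r ^ (n * β) * |∏ i, y.1 i| ^ β *
          Real.exp (-r ^ 2 / 2) / (2 * gaussMoment β) ^ n) * (ENNReal.ofReal (r ^ p) * g y))
        = (ENNReal.ofReal (r ^ (n - 1)) * ENNReal.ofReal (r ^ (n * β) * |∏ i, y.1 i| ^ β *
          Real.exp (-r ^ 2 / 2) / (2 * gaussMoment β) ^ n) * ENNReal.ofReal (r ^ p)) * g y := by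
          ring
      _ = (ENNReal.ofReal (r ^ (p + n * (β + 1) - 1) * Real.exp (-r ^ 2 / 2)) *
        (ENNReal.ofReal (1 / (2 * gaussMoment β) ^ n) *
          (ENNReal.ofReal (|∏ i, y.1 i| ^ β)))) * g y := by
          congr 1
          rw [← ENNReal.ofReal_mul (by positivity), ← ENNReal.ofReal_mul (by positivity),
            ← ENNReal.ofReal_mul (by positivity), ← ENNReal.ofReal_mul (by positivity), e1]
          congr 1
          ring
      _ = _ := by ring
  rw [setLIntegral_congr_fun measurableSet_Ioi hpt, lintegral_mul_const _ (by fun_prop),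
    lintegral_gaussMoment (by linarith), ← mul_assoc,
    ← ENNReal.ofReal_mul (gaussMoment_pos (by linarith)).le, mul_one_div]

/-- The moment `E |x|^p` for `gaussMeasPi n β`. -/
noncomputable def radialMoment (n : ℕ) (β p : ℝ) : ℝ :=
  gaussMoment (p + n * (β + 1) - 1) / gaussMoment (n * (β + 1) - 1)

theorem natCast_mul_add_one_pos {n : ℕ} (hn : 0 < n) {β : ℝ} (hβ : -1 < β) :
    0 < n * (β + 1) := by
  have : (0:ℝ) < n := by exact_mod_cast hn
  have : 0 < β + 1 := by linarith
  positivity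

theorem radialMoment_pos {n : ℕ} (hn : 0 < n) {β p : ℝ} (hβ : -1 < β)
    (hp : 0 < p + n * (β + 1)) : 0 < radialMoment n β p := by
  have := natCast_mul_add_one_pos hn hβ
  exact div_pos (gaussMoment_pos (by linarith)) (gaussMoment_pos (by linarith))

/-- Compares `∫F²`, of degree `2λ`, with `∫|∇F|²`, of degree `2λ - 2`; the dimension enters the
final constant here. -/
theorem radialMoment_add_two {n : ℕ} {β p : ℝ} (hp : 0 < p + n * (β + 1)) :
    radialMoment n β (p + 2) = (p + n * (β + 1)) * radialMoment n β p := by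
  have h := gaussMoment_add_two (a := p + n * (β + 1) - 1) (by linarith)
  rw [radialMoment, radialMoment, show p + 2 + n * (β + 1) - 1 = p + n * (β + 1) - 1 + 2 by ring, h]
  ring

theorem radialMoment_zero {n : ℕ} (hn : 0 < n) {β : ℝ} (hβ : -1 < β) :
    radialMoment n β 0 = 1 := by
  have := natCast_mul_add_one_pos hn hβ
  rw [radialMoment, zero_add, div_self (gaussMoment_pos (by linarith)).ne']

theorem two_div_sub_one_gt {q : ℝ} (hq : 0 < q) : -1 < 2 / q - 1 := by
  have : 0 < 2 / q := by positivity
  linarith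

theorem measurable_sphereWeight (n : ℕ) (q : ℝ) : Measurable (sphereWeight n q) := by
  unfold sphereWeight
  fun_prop

theorem lintegral_measureM {n : ℕ} (hn : 0 < n) {q : ℝ} (hq : 0 < q) {g : UnitSphere n → ENNReal}
    (hg : Measurable g) :
    ∫⁻ y, g y ∂(measureM n q) =
      ENNReal.ofReal (gaussMoment (n * (2 / q - 1 + 1) - 1) / (2 * gaussMoment (2 / q - 1)) ^ n) *
        ∫⁻ y : UnitSphere n, g y * ENNReal.ofReal (|∏ i, y.1 i| ^ (2 / q - 1))
          ∂(volume : Measure (EuclideanSpace ℝ (Fin n))).toSphere := by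
  have hβ := two_div_sub_one_gt hq
  have hD := natCast_mul_add_one_pos hn hβ
  have := isProbabilityMeasure_gaussMeasPi n hβ
  have hne : Nonempty (Fin n) := ⟨⟨0, hn⟩⟩
  have hw := measurable_sphereWeight n q
  set T := (volume : Measure (EuclideanSpace ℝ (Fin n))).toSphere with hT
  set c := gaussMoment (n * (2 / q - 1 + 1) - 1) / (2 * gaussMoment (2 / q - 1)) ^ n with hc
  have hc0 : 0 < c := div_pos (gaussMoment_pos (by linarith))
    (pow_pos (mul_pos two_pos (gaussMoment_pos hβ)) n)
  -- Total mass 1 identifies the normalizing integral of the sphere weight without computing it.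
  have h1 := lintegral_gaussMeasPi_of_homogeneous hn hβ (p := 0) (by linarith)
    (G := fun _ => 1) measurable_const (g := fun _ => 1) (fun y r hr => by simp)
  simp only [lintegral_one, measure_univ, one_mul, zero_add] at h1
  change 1 = ENNReal.ofReal c * ∫⁻ y, ENNReal.ofReal (sphereWeight n q y) ∂T at h1
  change _ = ENNReal.ofReal c * ∫⁻ y, g y * ENNReal.ofReal (sphereWeight n q y) ∂T
  have hW : ∫⁻ y, ENNReal.ofReal (sphereWeight n q y) ∂T = ENNReal.ofReal (1 / c) := by
    rw [one_div, ENNReal.ofReal_inv_of_pos hc0]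
    exact ENNReal.eq_inv_of_mul_eq_one_left (by rw [mul_comm]; exact h1.symm)
  have hT0 : T univ ≠ 0 := by
    rw [hT, Measure.measure_univ_ne_zero]
    exact Measure.toSphere_ne_zero _
  have hTt : T univ ≠ ⊤ := measure_ne_top _ _
  have hint : ∫ z, sphereWeight n q z ∂(sphereSigma n) = (T univ).toReal⁻¹ * (1 / c) := by
    rw [integral_eq_lintegral_of_nonneg_ae (.of_forall fun y => by
      simp only [sphereWeight, Pi.zero_apply]; positivity) hw.aestronglyMeasurable, sphereSigma,
      lintegral_smul_measure, hW, smul_eq_mul, ENNReal.toReal_mul, ENNReal.toReal_inv,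
      ENNReal.toReal_ofReal (by positivity)]
  have hTp : 0 < (T univ).toReal := ENNReal.toReal_pos hT0 hTt
  rw [measureM, hint, lintegral_withDensity_eq_lintegral_mul _ (by fun_prop) hg, sphereSigma,
    lintegral_smul_measure, smul_eq_mul, ← lintegral_const_mul _ (by fun_prop),
    ← lintegral_const_mul _ (by fun_prop)]
  congr 1
  ext y
  simp only [Pi.mul_apply]
  rw [← mul_assoc, mul_comm (g y), ← mul_assoc]
  congr 1
  rw [← ENNReal.ofReal_mul hc0.le, ← ENNReal.ofReal_toReal (ENNReal.inv_ne_top.2 hT0),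
    ← ENNReal.ofReal_mul (by positivity), ENNReal.toReal_inv]
  congr 1
  field_simp

/-- Independence of radius and direction under the product measure: the direction has law `measureM
n q`, and the radius contributes its `p`-th moment. -/
theorem lintegral_homogeneous_eq {n : ℕ} (hn : 0 < n) {q p : ℝ} (hq : 0 < q)
    (hp : 0 < p + n * (2 / q - 1 + 1)) {G : EuclideanSpace ℝ (Fin n) → ENNReal} (hG : Measurable G)
    {g : UnitSphere n → ENNReal}
    (hGg : ∀ (y : UnitSphere n) (r : ℝ), 0 < r → G (r • y.1) = ENNReal.ofReal (r ^ p) * g y) :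
    ∫⁻ x, G x ∂(gaussMeasPi n (2 / q - 1)) =
      ENNReal.ofReal (radialMoment n (2 / q - 1) p) * ∫⁻ y, g y ∂(measureM n q) := by
  have hβ := two_div_sub_one_gt hq
  have hD := natCast_mul_add_one_pos hn hβ
  have hg : Measurable g := by
    have : g = fun y => G y.1 := by
      ext y
      have := hGg y 1 one_pos
      simpa using this.symm
    rw [this]
    exact hG.comp measurable_subtype_coe
  have h0 := gaussMoment_pos (a := n * (2 / q - 1 + 1) - 1) (by linarith)
  rw [lintegral_gaussMeasPi_of_homogeneous hn hβ hp hG hGg, lintegral_measureM hn hq hg, ← mul_assoc,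
    ← ENNReal.ofReal_mul (radialMoment_pos hn hβ hp).le, radialMoment,
    div_mul_div_cancel₀ h0.ne']

theorem isProbabilityMeasure_measureM {n : ℕ} (hn : 0 < n) {q : ℝ} (hq : 0 < q) :
    IsProbabilityMeasure (measureM n q) := by
  have hβ := two_div_sub_one_gt hq
  have hD := natCast_mul_add_one_pos hn hβ
  have := isProbabilityMeasure_gaussMeasPi n hβ
  have h := lintegral_homogeneous_eq hn hq (p := 0) (by linarith) (G := fun _ => 1)
    measurable_const (g := fun _ => 1) (fun y r hr => by simp)
  rw [radialMoment_zero hn hβ] at h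
  simp only [lintegral_one, measure_univ, ENNReal.ofReal_one, one_mul] at h
  exact ⟨h.symm⟩

theorem integral_homogeneous_eq {n : ℕ} (hn : 0 < n) {q p : ℝ} (hq : 0 < q)
    (hp : 0 < p + n * (2 / q - 1 + 1)) {G : EuclideanSpace ℝ (Fin n) → ℝ} (hG : Measurable G)
    {g : UnitSphere n → ℝ} (hg : Integrable g (measureM n q))
    (hGg : ∀ (y : UnitSphere n) (r : ℝ), 0 < r → G (r • y.1) = r ^ p * g y) :
    Integrable G (gaussMeasPi n (2 / q - 1)) ∧
    ∫ x, G x ∂(gaussMeasPi n (2 / q - 1)) =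
      radialMoment n (2 / q - 1) p * ∫ y, g y ∂(measureM n q) := by
  have hA := radialMoment_pos hn (two_div_sub_one_gt hq) hp
  have hi : Integrable G (gaussMeasPi n (2 / q - 1)) := by
    refine ⟨hG.aestronglyMeasurable, ?_⟩
    rw [hasFiniteIntegral_iff_enorm, lintegral_homogeneous_eq hn hq hp hG.enorm
      (g := fun y => ‖g y‖ₑ) (fun y r hr => ?_)]
    · exact ENNReal.mul_lt_top ENNReal.ofReal_lt_top hg.2
    · rw [hGg y r hr, enorm_mul, Real.enorm_of_nonneg (by positivity)]
  refine ⟨hi, ?_⟩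
  rw [integral_eq_lintegral_pos_part_sub_lintegral_neg_part hi,
    integral_eq_lintegral_pos_part_sub_lintegral_neg_part hg,
    lintegral_homogeneous_eq hn hq hp (G := fun x => ENNReal.ofReal (G x)) (by fun_prop)
      (g := fun y => ENNReal.ofReal (g y)) (fun y r hr => by
        rw [hGg y r hr, ENNReal.ofReal_mul (by positivity)]),
    lintegral_homogeneous_eq hn hq hp (G := fun x => ENNReal.ofReal (-G x)) (by fun_prop)
      (g := fun y => ENNReal.ofReal (-g y)) (fun y r hr => by
        rw [hGg y r hr, ← mul_neg, ENNReal.ofReal_mul (by positivity)]),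
    ENNReal.toReal_mul, ENNReal.toReal_mul, ENNReal.toReal_ofReal hA.le, mul_sub]

/-! ### Regularity and gradient of the 0-homogeneous extension. -/

theorem norm_normalize_sub_le {E : Type*} [NormedAddCommGroup E] [NormedSpace ℝ E] {x y : E}
    (hx : x ≠ 0) (hy : y ≠ 0) : ‖‖x‖⁻¹ • x - ‖y‖⁻¹ • y‖ ≤ 2 / ‖x‖ * ‖x - y‖ := by
  have hx' := norm_pos_iff.2 hx
  have hy' := norm_pos_iff.2 hy
  have e : ‖x‖⁻¹ • x - ‖y‖⁻¹ • y = ‖x‖⁻¹ • (x - y) + (‖x‖⁻¹ - ‖y‖⁻¹) • y := by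
    rw [smul_sub, sub_smul]; abel
  rw [e]
  refine (norm_add_le _ _).trans ?_
  rw [norm_smul, norm_smul, norm_inv, norm_norm, Real.norm_eq_abs]
  have h2 : |‖x‖⁻¹ - ‖y‖⁻¹| * ‖y‖ = ‖x‖⁻¹ * |‖y‖ - ‖x‖| := by
    have : ‖x‖⁻¹ - ‖y‖⁻¹ = (‖y‖ - ‖x‖) * (‖x‖⁻¹ * ‖y‖⁻¹) := by field_simp
    rw [this, abs_mul, abs_of_pos (by positivity : 0 < ‖x‖⁻¹ * ‖y‖⁻¹)]
    field_simp
  rw [h2]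
  have h3 : |‖y‖ - ‖x‖| ≤ ‖x - y‖ := by
    rw [norm_sub_rev]; exact abs_norm_sub_norm_le y x
  calc ‖x‖⁻¹ * ‖x - y‖ + ‖x‖⁻¹ * |‖y‖ - ‖x‖| ≤ ‖x‖⁻¹ * ‖x - y‖ + ‖x‖⁻¹ * ‖x - y‖ := by gcongr
    _ = _ := by ring

section Sphere

variable {n : ℕ}

theorem homogExt_of_ne (f : UnitSphere n → ℝ) {x : EuclideanSpace ℝ (Fin n)} (hx : x ≠ 0) :
    homogExt f x = f ⟨‖x‖⁻¹ • x, norm_inv_smul_mem_sphere hx⟩ := by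
  simp [homogExt, hx]

theorem homogExt_smul (f : UnitSphere n → ℝ) {r : ℝ} (hr : 0 < r) (x : EuclideanSpace ℝ (Fin n)) :
    homogExt f (r • x) = homogExt f x := by
  by_cases hx : x = 0
  · simp [hx]
  · rw [homogExt_of_ne f hx, homogExt_of_ne f (smul_ne_zero hr.ne' hx)]
    congr 2
    rw [norm_smul, Real.norm_of_nonneg hr.le, smul_smul]
    congr 1
    field_simp

theorem homogExt_coe (f : UnitSphere n → ℝ) (y : UnitSphere n) : homogExt f y.1 = f y := by
  have hy : ‖y.1‖ = 1 := norm_eq_of_mem_sphere y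
  have h0 : y.1 ≠ 0 := norm_ne_zero_iff.1 (by rw [hy]; exact one_ne_zero)
  rw [homogExt_of_ne f h0]
  congr 1
  ext1
  simp [hy]

theorem homogExt_smul_coe (f : UnitSphere n → ℝ) {r : ℝ} (hr : 0 < r) (y : UnitSphere n) :
    homogExt f (r • y.1) = f y := by
  rw [homogExt_smul f hr, homogExt_coe]

theorem homogExt_neg (f : UnitSphere n → ℝ) (hf : ∀ y, f (-y) = f y)
    (x : EuclideanSpace ℝ (Fin n)) : homogExt f (-x) = homogExt f x := by
  by_cases hx : x = 0
  · simp [hx]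
  · rw [homogExt_of_ne f hx, homogExt_of_ne f (neg_ne_zero.2 hx), ← hf]
    congr 1
    ext1
    simp

theorem dist_homogExt_le {f : UnitSphere n → ℝ} {K : NNReal} (hf : LipschitzWith K f)
    {x y : EuclideanSpace ℝ (Fin n)} (hx : x ≠ 0) (hy : y ≠ 0) :
    dist (homogExt f x) (homogExt f y) ≤ K * (2 / ‖x‖) * dist x y := by
  rw [homogExt_of_ne f hx, homogExt_of_ne f hy]
  refine (hf.dist_le_mul _ _).trans ?_
  rw [mul_assoc]
  refine mul_le_mul_of_nonneg_left ?_ K.2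
  rw [Subtype.dist_eq, dist_eq_norm, dist_eq_norm]
  exact norm_normalize_sub_le hx hy

theorem lipschitzOnWith_homogExt {f : UnitSphere n → ℝ} {K : NNReal} (hf : LipschitzWith K f)
    {δ : NNReal} (hδ : 0 < δ) :
    LipschitzOnWith (K * (2 / δ)) (homogExt f) {x | δ ≤ ‖x‖} := by
  refine LipschitzOnWith.of_dist_le_mul fun x hx y hy => ?_
  have hδ' : (0:ℝ) < δ := hδ
  have hx' : (δ:ℝ) ≤ ‖x‖ := hx
  have hy' : (δ:ℝ) ≤ ‖y‖ := hy
  refine (dist_homogExt_le hf (norm_pos_iff.1 (hδ'.trans_le hx))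
    (norm_pos_iff.1 (hδ'.trans_le hy))).trans ?_
  push_cast
  gcongr

theorem setOf_lt_norm_mem_nhds {x : EuclideanSpace ℝ (Fin n)} {δ : ℝ} (h : δ < ‖x‖) :
    {x : EuclideanSpace ℝ (Fin n) | δ ≤ ‖x‖} ∈ nhds x :=
  Filter.mem_of_superset ((isOpen_lt continuous_const continuous_norm).mem_nhds h)
    fun y (hy : δ < ‖y‖) => show δ ≤ ‖y‖ from hy.le

theorem continuousAt_homogExt {f : UnitSphere n → ℝ} {K : NNReal} (hf : LipschitzWith K f)
    {x : EuclideanSpace ℝ (Fin n)} (hx : x ≠ 0) : ContinuousAt (homogExt f) x := by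
  have hx' := norm_pos_iff.2 hx
  have h := lipschitzOnWith_homogExt hf (δ := (‖x‖ / 2).toNNReal) (by simpa using hx)
  refine h.continuousOn.continuousAt (setOf_lt_norm_mem_nhds ?_)
  rw [Real.coe_toNNReal _ (by positivity)]
  linarith

/-- Rademacher's theorem on the sets `‖x‖ ≥ 1/(k+1)`, where the extension is Lipschitz; these
exhaust the complement of the origin. -/
theorem ae_differentiableAt_homogExt {f : UnitSphere n → ℝ} {K : NNReal}
    (hf : LipschitzWith K f) :
    ∀ᵐ x : EuclideanSpace ℝ (Fin n), x ≠ 0 → DifferentiableAt ℝ (homogExt f) x := by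
  have h : ∀ k : ℕ, ∀ᵐ x : EuclideanSpace ℝ (Fin n), x ∈ {x | ((1 / (k + 1) : NNReal):ℝ) ≤ ‖x‖} →
      DifferentiableWithinAt ℝ (homogExt f) {x | ((1 / (k + 1) : NNReal):ℝ) ≤ ‖x‖} x := fun k =>
    (lipschitzOnWith_homogExt hf (δ := 1 / (k + 1)) (by positivity)).ae_differentiableWithinAt_of_mem
  filter_upwards [ae_all_iff.2 h] with x hx h0
  obtain ⟨k, hk⟩ := exists_nat_one_div_lt (norm_pos_iff.2 h0)
  have hk' : ((1 / (k + 1) : NNReal):ℝ) < ‖x‖ := by push_cast; exact hk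
  exact (hx k (le_of_lt hk')).differentiableAt (setOf_lt_norm_mem_nhds hk')

theorem norm_sphereGrad_le {f : UnitSphere n → ℝ} {K : NNReal} (hf : LipschitzWith K f)
    (y : UnitSphere n) : ‖sphereGrad f y‖ ≤ K * 4 := by
  have hy : ‖y.1‖ = 1 := norm_eq_of_mem_sphere y
  have h := lipschitzOnWith_homogExt hf (δ := 1 / 2) (by positivity)
  have h2 := norm_fderiv_le_of_lipschitzOn ℝ (x₀ := y.1)
    (setOf_lt_norm_mem_nhds (by rw [hy]; norm_num)) h
  rw [sphereGrad, gradient, LinearIsometryEquiv.norm_map]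
  refine h2.trans (le_of_eq ?_)
  push_cast
  ring

theorem gradient_homogExt_smul (f : UnitSphere n → ℝ) {r : ℝ} (hr : 0 < r)
    (x : EuclideanSpace ℝ (Fin n)) :
    gradient (homogExt f) (r • x) = r⁻¹ • gradient (homogExt f) x := by
  have h : homogExt f = (homogExt f <| r • ·) := by
    ext x; rw [homogExt_smul f hr]
  have h2 : fderiv ℝ (homogExt f) x = r • fderiv ℝ (homogExt f) (r • x) := by
    conv_lhs => rw [h]
    rw [fderiv_comp_smul]
  rw [gradient, gradient, h2, map_smul, smul_smul, inv_mul_cancel₀ hr.ne', one_smul]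

/-- The extension is constant along rays. -/
theorem fderiv_homogExt_self (f : UnitSphere n → ℝ) {x : EuclideanSpace ℝ (Fin n)}
    (hx : DifferentiableAt ℝ (homogExt f) x) : fderiv ℝ (homogExt f) x x = 0 := by
  have h1 : HasDerivAt (fun t : ℝ => homogExt f (t • x)) (fderiv ℝ (homogExt f) x x) 1 := by
    have h2 : HasDerivAt (fun t : ℝ => t • x) x 1 := by
      simpa using (hasDerivAt_id (1:ℝ)).smul_const x
    have h3 : HasFDerivAt (homogExt f) (fderiv ℝ (homogExt f) x) ((1:ℝ) • x) := by
      rw [one_smul]; exact hx.hasFDerivAt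
    exact h3.comp_hasDerivAt (1:ℝ) h2
  have h4 : HasDerivAt (fun t : ℝ => homogExt f (t • x)) 0 1 := by
    refine (hasDerivAt_const (1:ℝ) (homogExt f x)).congr_of_eventuallyEq ?_
    filter_upwards [lt_mem_nhds (zero_lt_one (α := ℝ))] with t ht
    exact homogExt_smul f ht x
  exact h1.unique h4

theorem measurable_gradient (F : EuclideanSpace ℝ (Fin n) → ℝ) : Measurable (gradient F) :=
  (InnerProductSpace.toDual ℝ (EuclideanSpace ℝ (Fin n))).symm.continuous.measurable.comp
    (measurable_fderiv ℝ F)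

theorem measurable_sphereGrad (f : UnitSphere n → ℝ) : Measurable (sphereGrad f) :=
  (measurable_gradient _).comp measurable_subtype_coe

theorem sum_lineDeriv_sq {F : EuclideanSpace ℝ (Fin n) → ℝ} {x : EuclideanSpace ℝ (Fin n)}
    (hF : DifferentiableAt ℝ F x) :
    ∑ i, lineDeriv ℝ F x (EuclideanSpace.single i 1) ^ 2 = ‖gradient F x‖ ^ 2 := by
  rw [EuclideanSpace.norm_sq_eq]
  refine Finset.sum_congr rfl fun i _ => ?_
  rw [hF.lineDeriv_eq_fderiv, Real.norm_eq_abs, sq_abs]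
  congr 1
  have : gradient F x i = inner ℝ (gradient F x) (EuclideanSpace.single i (1:ℝ)) := by
    rw [EuclideanSpace.inner_single_right]; simp
  rw [this, gradient, InnerProductSpace.toDual_symm_apply]

theorem hasFDerivAt_norm_rpow_of_ne_zero {x : EuclideanSpace ℝ (Fin n)} (hx : x ≠ 0) (p : ℝ) :
    HasFDerivAt (fun x : EuclideanSpace ℝ (Fin n) => ‖x‖ ^ p)
      ((p * ‖x‖ ^ (p - 2)) • innerSL ℝ x) x := by
  have h := ((hasStrictFDerivAt_norm_sq x).rpow_const (p := p / 2) (by simp [hx])).hasFDerivAt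
  have hx' := norm_pos_iff.2 hx
  refine (h.congr_of_eventuallyEq (.of_forall fun y => ?_)).congr_fderiv ?_
  · simp only
    rw [← Real.rpow_natCast, ← Real.rpow_mul (norm_nonneg _)]
    congr 1; push_cast; ring
  · rw [← Real.rpow_natCast, ← Real.rpow_mul (norm_nonneg _)]
    ext v
    simp only [smul_apply, nsmul_eq_mul, smul_eq_mul]
    rw [show ((2:ℕ):ℝ) * (p / 2 - 1) = p - 2 by push_cast; ring]
    push_cast
    ring

/-- The gradient of `‖x‖^p` is radial and that of the extension is tangential, so there is no cross
term. -/
theorem norm_gradient_norm_rpow_mul_sq (f : UnitSphere n → ℝ) (M p : ℝ)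
    {x : EuclideanSpace ℝ (Fin n)} (hx : x ≠ 0) (hf : DifferentiableAt ℝ (homogExt f) x) :
    DifferentiableAt ℝ (fun x => ‖x‖ ^ p * (homogExt f x - M)) x ∧
    ‖gradient (fun x => ‖x‖ ^ p * (homogExt f x - M)) x‖ ^ 2 =
      p ^ 2 * (‖x‖ ^ (2 * p - 2) * (homogExt f x - M) ^ 2) +
        ‖x‖ ^ (2 * p) * ‖gradient (homogExt f) x‖ ^ 2 := by
  have hx' := norm_pos_iff.2 hx
  have h1 : HasFDerivAt (fun x => ‖x‖ ^ p * (homogExt f x - M)) _ x :=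
    (hasFDerivAt_norm_rpow_of_ne_zero hx p).mul (hf.hasFDerivAt.sub_const M)
  refine ⟨h1.differentiableAt, ?_⟩
  have hg : gradient (fun x => ‖x‖ ^ p * (homogExt f x - M)) x =
      ‖x‖ ^ p • gradient (homogExt f) x + ((homogExt f x - M) * (p * ‖x‖ ^ (p - 2))) • x := by
    rw [gradient, h1.fderiv, map_add, map_smul, map_smul, map_smul, smul_smul]
    congr 2
    exact (InnerProductSpace.toDual ℝ _).symm_apply_apply x
  have hinn : inner ℝ (gradient (homogExt f) x) x = 0 := by
    rw [gradient, InnerProductSpace.toDual_symm_apply, fderiv_homogExt_self f hf]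
  rw [hg, norm_add_sq_real, inner_smul_left, inner_smul_right, hinn, norm_smul, norm_smul]
  simp only [mul_zero, add_zero, Real.norm_eq_abs, mul_pow, sq_abs]
  have e1 : ‖x‖ ^ (2 * p - 2) = (‖x‖ ^ (p - 2)) ^ 2 * ‖x‖ ^ 2 := by
    rw [← Real.rpow_mul_natCast hx'.le, ← Real.rpow_natCast ‖x‖ 2, ← Real.rpow_add hx']
    congr 1; push_cast; ring
  have e2 : ‖x‖ ^ (2 * p) = (‖x‖ ^ p) ^ 2 := by
    rw [← Real.rpow_mul_natCast hx'.le]; congr 1; push_cast; ring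
  rw [e1, e2]
  ring

end Sphere

/-! ### Restriction of homogeneous functions to lines parallel to the axes. -/

section Sphere

variable {n : ℕ}

theorem toLp_update_eq (x : Fin n → ℝ) (i : Fin n) (s t : ℝ) :
    (WithLp.toLp 2 (Function.update x i t) : EuclideanSpace ℝ (Fin n)) =
      WithLp.toLp 2 (Function.update x i s) + (t - s) • EuclideanSpace.single i (1:ℝ) := by
  ext j
  by_cases h : j = i
  · subst h; simp
  · simp [h]

theorem lipschitzWith_toLp_update (x : Fin n → ℝ) (i : Fin n) :
    LipschitzWith 1 fun t => (WithLp.toLp 2 (Function.update x i t) : EuclideanSpace ℝ (Fin n)) := by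
  refine LipschitzWith.of_dist_le_mul fun t s => ?_
  rw [toLp_update_eq x i s t, dist_eq_norm, add_sub_cancel_left, norm_smul]
  simp [Real.dist_eq]

theorem abs_le_norm_toLp_update (x : Fin n → ℝ) {i j : Fin n} (hij : j ≠ i) (t : ℝ) :
    |x j| ≤ ‖(WithLp.toLp 2 (Function.update x i t) : EuclideanSpace ℝ (Fin n))‖ := by
  have := PiLp.norm_apply_le (WithLp.toLp 2 (Function.update x i t) : EuclideanSpace ℝ (Fin n)) j
  simpa [hij] using this

theorem deriv_comp_toLp_update (F : EuclideanSpace ℝ (Fin n) → ℝ) (x : Fin n → ℝ) (i : Fin n)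
    (s : ℝ) : deriv (fun t => F (WithLp.toLp 2 (Function.update x i t))) s =
      lineDeriv ℝ F (WithLp.toLp 2 (Function.update x i s)) (EuclideanSpace.single i 1) := by
  rw [lineDeriv]
  have h : ∀ t, F (WithLp.toLp 2 (Function.update x i t)) =
      (fun r => F (WithLp.toLp 2 (Function.update x i s) + r • EuclideanSpace.single i (1:ℝ)))
        (t - s) := fun t => by
    rw [toLp_update_eq x i s t]
  rw [funext h]
  have h2 := deriv_comp_sub_const (f := fun r => F (WithLp.toLp 2 (Function.update x i s) +
    r • EuclideanSpace.single i (1:ℝ))) s s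
  rw [sub_self] at h2
  exact h2

/-- A line in direction `i` on which some other coordinate is nonzero stays away from the origin,
the only singularity. -/
theorem absolutelyContinuousOnInterval_slice {f : UnitSphere n → ℝ} {K : NNReal}
    (hf : LipschitzWith K f) (M p : ℝ) (x : Fin n → ℝ) {i j : Fin n} (hij : j ≠ i) (hj : x j ≠ 0)
    (a b : ℝ) : AbsolutelyContinuousOnInterval (fun t =>
      (fun x => ‖x‖ ^ p * (homogExt f x - M)) (WithLp.toLp 2 (Function.update x i t))) a b := by
  have hj' : 0 < |x j| := abs_pos.2 hj
  have hpos : ∀ t, 0 < ‖(WithLp.toLp 2 (Function.update x i t) : EuclideanSpace ℝ (Fin n))‖ :=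
    fun t => hj'.trans_le (abs_le_norm_toLp_update x hij t)
  have h1 : AbsolutelyContinuousOnInterval (fun t =>
      ‖(WithLp.toLp 2 (Function.update x i t) : EuclideanSpace ℝ (Fin n))‖ ^ p) a b := by
    have hc : ContDiff ℝ 1 (fun t =>
        ‖(WithLp.toLp 2 (Function.update x i t) : EuclideanSpace ℝ (Fin n))‖ ^ p) := by
      rw [contDiff_iff_contDiffAt]
      intro t
      refine ContDiffAt.rpow_const_of_ne (ContDiffAt.norm ℝ ?_ (norm_pos_iff.1 (hpos t)))
        (hpos t).ne'
      rw [funext (toLp_update_eq x i 0)]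
      fun_prop
    obtain ⟨L, hL⟩ := (hc.locallyLipschitz.locallyLipschitzOn
      (s := uIcc a b)).exists_lipschitzOnWith_of_compact isCompact_uIcc
    exact hL.absolutelyContinuousOnInterval
  have h2 : AbsolutelyContinuousOnInterval (fun t =>
      homogExt f (WithLp.toLp 2 (Function.update x i t)) - M) a b := by
    have hl := (lipschitzOnWith_homogExt hf (δ := |x j|.toNNReal) (by simpa using hj)).comp
      ((lipschitzWith_toLp_update x i).lipschitzOnWith (s := uIcc a b)) (fun t _ => by
        simpa using abs_le_norm_toLp_update x hij t)
    have hl2 : LipschitzOnWith (K * (2 / |x j|.toNNReal) * 1) (fun t =>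
      homogExt f (WithLp.toLp 2 (Function.update x i t)) - M) (uIcc a b) := by
      intro t ht s hs
      simpa using hl ht hs
    exact hl2.absolutelyContinuousOnInterval
  exact h1.mul h2

/-- Positivity of `p` makes the factor `‖x‖ ^ p` kill the discontinuity at the origin. There
`homogExt` is 0 by convention, hence the extra bound on `|M|`. -/
theorem continuous_norm_rpow_mul_homogExt {f : UnitSphere n → ℝ} {K : NNReal}
    (hf : LipschitzWith K f) (M : ℝ) {p : ℝ} (hp : 0 < p) {B : ℝ} (hB : ∀ y, |f y - M| ≤ B)
    (hB0 : |M| ≤ B) :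
    Continuous (fun x : EuclideanSpace ℝ (Fin n) => ‖x‖ ^ p * (homogExt f x - M)) ∧
    ∀ x : EuclideanSpace ℝ (Fin n), |‖x‖ ^ p * (homogExt f x - M)| ≤ ‖x‖ ^ p * B := by
  have hb : ∀ x : EuclideanSpace ℝ (Fin n), |‖x‖ ^ p * (homogExt f x - M)| ≤ ‖x‖ ^ p * B := by
    intro x
    rw [abs_mul, abs_of_nonneg (by positivity)]
    gcongr
    by_cases hx : x = 0
    · simpa [homogExt, hx] using hB0
    · rw [homogExt_of_ne f hx]; exact hB _
  refine ⟨continuous_iff_continuousAt.2 fun x => ?_, hb⟩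
  by_cases hx : x = 0
  · subst hx
    rw [ContinuousAt, norm_zero, Real.zero_rpow hp.ne', zero_mul]
    refine squeeze_zero_norm hb ?_
    have : Continuous fun x : EuclideanSpace ℝ (Fin n) => ‖x‖ ^ p * B :=
      (continuous_norm.rpow_const fun _ => Or.inr hp.le).mul continuous_const
    simpa [Real.zero_rpow hp.ne'] using this.tendsto 0
  · exact (continuousAt_id.norm.rpow_const (Or.inr hp.le)).mul
      ((continuousAt_homogExt hf hx).sub continuousAt_const)

theorem memLp_sq_gaussMeas {β : ℝ} (hβ : -1 < β) : MemLp (fun t : ℝ => t ^ 2) 2 (gaussMeas β) := by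
  rw [memLp_two_iff_integrable_sq (by fun_prop)]
  refine ⟨by fun_prop, ?_⟩
  rw [hasFiniteIntegral_iff_ofReal (.of_forall fun t => by positivity)]
  have h := lintegral_gaussMeas_abs_rpow hβ (s := 4) (by linarith)
  have e : ∀ t : ℝ, (t ^ 2) ^ 2 = |t| ^ (4:ℝ) := fun t => by
    rw [Real.rpow_ofNat, ← pow_mul]
    exact ((even_two_mul 2).pow_abs t).symm
  simp only [e, h]
  exact ENNReal.ofReal_lt_top

/-- Since `p ≤ 2`, the slice is dominated by a quadratic polynomial, and fourth moments are finite.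
-/
theorem memLp_slice {β : ℝ} (hβ : -1 < β) {F : EuclideanSpace ℝ (Fin n) → ℝ} (hF : Continuous F)
    {p B : ℝ} (hp : 0 ≤ p) (hp2 : p ≤ 2) (hB0 : 0 ≤ B) (hB : ∀ x, |F x| ≤ ‖x‖ ^ p * B)
    (x : Fin n → ℝ) (i : Fin n) :
    MemLp (fun t => F (WithLp.toLp 2 (Function.update x i t))) 2 (gaussMeas β) := by
  have := isProbabilityMeasure_gaussMeas hβ
  set R := ‖(WithLp.toLp 2 (Function.update x i 0) : EuclideanSpace ℝ (Fin n))‖ with hR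
  have hm : MemLp (fun t : ℝ => (1 + (2 * R ^ 2 + 2 * t ^ 2)) * B) 2 (gaussMeas β) := by
    have h1 : MemLp (fun t : ℝ => 2 * t ^ 2) 2 (gaussMeas β) :=
      (memLp_sq_gaussMeas hβ).const_mul 2
    have h2 : MemLp (fun _ : ℝ => 1 + 2 * R ^ 2) 2 (gaussMeas β) := memLp_const _
    have h3 : MemLp (fun t : ℝ => (1 + 2 * R ^ 2) + 2 * t ^ 2) 2 (gaussMeas β) := h2.add h1
    simpa only [add_assoc] using h3.mul_const B
  refine hm.mono ?_ (.of_forall fun t => ?_)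
  · exact (hF.comp (lipschitzWith_toLp_update x i).continuous).aestronglyMeasurable
  · rw [Real.norm_eq_abs, Real.norm_eq_abs]
    refine (hB _).trans (le_trans ?_ (le_abs_self _))
    gcongr
    set y := (WithLp.toLp 2 (Function.update x i t) : EuclideanSpace ℝ (Fin n)) with hy
    have h1 : ‖y‖ ≤ R + |t| := by
      rw [hy, toLp_update_eq x i 0 t]
      refine (norm_add_le _ _).trans ?_
      rw [norm_smul]
      simp [hR]
    have h2 : ‖y‖ ^ 2 ≤ 2 * R ^ 2 + 2 * t ^ 2 := by
      have h3 : ‖y‖ ^ 2 ≤ (R + |t|) ^ 2 := by gcongr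
      nlinarith [sq_nonneg (R - |t|), sq_abs t]
    have h0 := norm_nonneg y
    by_cases h1' : ‖y‖ ≤ 1
    · have := Real.rpow_le_one h0 h1' hp
      nlinarith [sq_nonneg R, sq_nonneg t]
    · have := Real.rpow_le_rpow_of_exponent_le (not_le.1 h1').le hp2
      rw [Real.rpow_two] at this
      linarith

theorem ae_gaussMeas_ne_zero (β : ℝ) : ∀ᵐ t ∂(gaussMeas β), t ≠ 0 := by
  rw [ae_iff]
  simpa using gaussMeas_absolutelyContinuous β (measure_singleton (0:ℝ))

theorem ae_pi_gaussMeas_ne_zero {β : ℝ} (hβ : -1 < β) :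
    ∀ᵐ x ∂(Measure.pi fun _ : Fin n => gaussMeas β), ∀ j, x j ≠ 0 := by
  have := isProbabilityMeasure_gaussMeas hβ
  rw [ae_all_iff]
  intro j
  exact (measurePreserving_eval (fun _ : Fin n => gaussMeas β) j).quasiMeasurePreserving.ae
    (ae_gaussMeas_ne_zero β)

end Sphere

/-! ### The upper bound. -/

/-- The tensorized inequality for the even function `‖x‖^lam (f(x/‖x‖) - M)`, read in polar
coordinates. The radial derivative adds `lam²` times the variance to the energy, and the moment
recursion absorbs it. The hypothesis `hD` makes the moment of order `2 lam - 2` finite. -/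
theorem mul_variance_le_integral_norm_sphereGrad_sq {n : ℕ} (hn : 2 ≤ n) {q : ℝ} (hq : 1 < q)
    {lam : ℝ} (hlam : 0 < lam) (hlam2 : lam ≤ 2) (hlamq : lam ≤ 2 * (2 - 2 / q))
    (hD : 0 < 2 * lam - 2 + n * (2 / q - 1 + 1)) {f : UnitSphere n → ℝ} {K : NNReal}
    (hf : LipschitzWith K f) (hev : ∀ y, f (-y) = f y) :
    lam * (lam + n * (2 / q - 1 + 1) - 2) * variance f (measureM n q) ≤
      ∫ y, ‖sphereGrad f y‖ ^ 2 ∂(measureM n q) := by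
  have hn0 : 0 < n := by omega
  have hq0 : 0 < q := by linarith
  have hq2 : 2 / q < 2 := by rw [div_lt_iff₀ hq0]; linarith
  have hq3 : 0 < 2 / q := by positivity
  set β := 2 / q - 1 with hβdef
  have hβ : -1 < β := two_div_sub_one_gt hq0
  have hP1 := isProbabilityMeasure_gaussMeas hβ
  have hPn := isProbabilityMeasure_gaussMeasPi n hβ
  have hPm := isProbabilityMeasure_measureM hn0 hq0
  set m := measureM n q with hm
  set M := ∫ y, f y ∂m with hM
  obtain ⟨B, hB⟩ : ∃ B, ∀ y, ‖f y - M‖ ≤ B := by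
    have hc : Continuous fun y => ‖f y - M‖ := (hf.continuous.sub continuous_const).norm
    obtain ⟨B, hB⟩ := (isCompact_range hc).bddAbove
    exact ⟨B, fun y => hB ⟨y, rfl⟩⟩
  set B' := max B |M| with hB'
  have hB1 : ∀ y, |f y - M| ≤ B' := fun y => (hB y).trans (le_max_left _ _)
  have hB0 : 0 ≤ B' := (abs_nonneg M).trans (le_max_right _ _)
  set F : EuclideanSpace ℝ (Fin n) → ℝ := fun x => ‖x‖ ^ lam * (homogExt f x - M) with hF
  obtain ⟨hFc, hFb⟩ := continuous_norm_rpow_mul_homogExt hf M hlam hB1 (le_max_right _ _)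
  have hfi : Integrable f m := by
    refine Integrable.of_bound hf.continuous.aestronglyMeasurable (B' + |M|) (.of_forall fun y => ?_)
    have := abs_add_le (f y - M) M
    rw [sub_add_cancel] at this
    exact this.trans (by gcongr; exact hB1 y)
  have hfL : MemLp f 2 m := by
    refine MemLp.of_bound hf.continuous.aestronglyMeasurable (B' + |M|) (.of_forall fun y => ?_)
    have := abs_add_le (f y - M) M
    rw [sub_add_cancel] at this
    exact this.trans (by gcongr; exact hB1 y)
  have hvar : variance f m = ∫ y, (f y - M) ^ 2 ∂m :=
    variance_eq_integral hf.continuous.aemeasurable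
  have hi2 : Integrable (fun y => (f y - M) ^ 2) m := (hfL.sub (memLp_const M)).integrable_sq
  -- transfer to `ℝⁿ`
  have hFhom : ∀ (y : UnitSphere n) (r : ℝ), 0 < r → F (r • y.1) = r ^ lam * (f y - M) := by
    intro y r hr
    simp only [hF]
    rw [homogExt_smul_coe f hr, norm_smul, norm_eq_of_mem_sphere y, mul_one,
      Real.norm_of_nonneg hr.le]
  have hnD : 0 < n * (β + 1) := natCast_mul_add_one_pos hn0 hβ
  have tF := integral_homogeneous_eq hn0 hq0 (p := lam) (by linarith) hFc.measurable
    (hfi.sub (integrable_const M)) hFhom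
  have tF2 := integral_homogeneous_eq hn0 hq0 (p := 2 * lam) (by linarith)
    (G := fun x => F x ^ 2) (hFc.measurable.pow_const 2) hi2 (fun y r hr => by
      rw [hFhom y r hr, mul_pow, ← Real.rpow_mul_natCast hr.le]
      congr 2; push_cast; ring)
  -- Centring `f` makes `F` centred, so the variance of `F` is just its second moment.
  have hmean : ∫ x, F x ∂(gaussMeasPi n β) = 0 := by
    rw [tF.2]
    simp only [Pi.sub_apply]
    rw [integral_sub hfi (integrable_const M)]
    simp [hM]
  have hmp := measurePreserving_toLp_gaussMeasPi n β
  have hemb : MeasurableEmbedding (WithLp.toLp 2 : (Fin n → ℝ) → EuclideanSpace ℝ (Fin n)) :=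
    (MeasurableEquiv.toLp 2 (Fin n → ℝ)).measurableEmbedding
  have hFL : MemLp F 2 (gaussMeasPi n β) :=
    (memLp_two_iff_integrable_sq hFc.aestronglyMeasurable).2 tF2.1
  have hFLp : MemLp (fun x : Fin n → ℝ => F (WithLp.toLp 2 x)) 2
      (Measure.pi fun _ => gaussMeas β) := hFL.comp_measurePreserving hmp
  have hFneg : ∀ x, F (-x) = F x := fun x => by
    simp only [hF, norm_neg, homogExt_neg f hev]
  -- Evenness of `f` is used here: the odd part of `F` vanishes and the parity form is the whole
  -- variance.
  have hform : parityForm (Measure.pi fun _ : Fin n => gaussMeas β) (fun x => -x)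
      (fun x => F (WithLp.toLp 2 x)) = radialMoment n β (2 * lam) * variance f m := by
    have e1 : ∀ x : Fin n → ℝ, F (WithLp.toLp 2 (-x)) = F (WithLp.toLp 2 x) := fun x => by
      rw [WithLp.toLp_neg, hFneg]
    simp only [parityForm, e1, ← sq]
    rw [hmp.integral_comp hemb (fun x => F x), hmp.integral_comp hemb (fun x => F x ^ 2), hmean,
      tF2.2, hvar]
    ring
  -- the tensorized inequality
  set g : Fin n → (Fin n → ℝ) → ENNReal := fun i x =>
    ENNReal.ofReal (lineDeriv ℝ F (WithLp.toLp 2 x) (EuclideanSpace.single i 1) ^ 2) with hg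
  have hgE : ∀ i, Measurable fun x : EuclideanSpace ℝ (Fin n) =>
      ENNReal.ofReal (lineDeriv ℝ F x (EuclideanSpace.single i 1) ^ 2) := fun i =>
    ((measurable_lineDeriv hFc).pow_const 2).ennreal_ofReal
  have hgm : ∀ i, Measurable (g i) := fun i => (hgE i).comp hmp.measurable
  have htens := parityForm_pi_le (measurePreserving_neg_gaussMeas β) hlam.le hgm hFLp (fun i => by
    filter_upwards [ae_pi_gaussMeas_ne_zero hβ] with x hx
    -- In dimension at least 2 a second coordinate exists, and it is almost surely nonzero, so the
    -- line avoids the origin.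
    obtain ⟨j, hj⟩ : ∃ j : Fin n, j ≠ i := by
      have : Nontrivial (Fin n) := Fin.nontrivial_iff_two_le.2 hn
      exact exists_ne i
    have h1 := parityForm_gaussMeas_le (α := 2 - 2 / q) (lam := lam)
      (u := fun t => F (WithLp.toLp 2 (Function.update x i t))) (by linarith) (by linarith) hlam.le
      hlam2 hlamq (by
        rw [show 1 - (2 - 2 / q) = β by rw [hβdef]; ring]
        exact memLp_slice hβ hFc hlam.le hlam2 hB0 hFb x i)
      (fun a b => absolutelyContinuousOnInterval_slice hf M lam x hj (hx j) a b)
    rw [show 1 - (2 - 2 / q) = β by rw [hβdef]; ring] at h1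
    simpa only [deriv_comp_toLp_update, hg] using h1)
  rw [hform] at htens
  have hsum : ∑ i, ∫⁻ x, g i x ∂(Measure.pi fun _ => gaussMeas β) =
      ∫⁻ x, ∑ i, ENNReal.ofReal (lineDeriv ℝ F x (EuclideanSpace.single i 1) ^ 2)
        ∂(gaussMeasPi n β) := by
    rw [lintegral_finsetSum _ fun i _ => hgE i]
    exact Finset.sum_congr rfl fun i _ => hmp.lintegral_comp (hgE i)
  -- the gradient in polar coordinates
  set G₁ : EuclideanSpace ℝ (Fin n) → ENNReal := fun x =>
    ENNReal.ofReal (lam ^ 2 * (‖x‖ ^ (2 * lam - 2) * (homogExt f x - M) ^ 2) +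
      ‖x‖ ^ (2 * lam) * ‖gradient (homogExt f) x‖ ^ 2) with hG₁
  -- The extension is recovered from the continuous function `F` by dividing by `‖x‖ ^ lam` off the
  -- origin.
  have hhm : Measurable (homogExt f) := by
    have : homogExt f = fun x => if x = 0 then 0 else F x / ‖x‖ ^ lam + M := by
      ext x
      split_ifs with hx
      · simp [homogExt, hx]
      · have : ‖x‖ ^ lam ≠ 0 := (Real.rpow_pos_of_pos (norm_pos_iff.2 hx) _).ne'
        simp only [hF]
        field_simp
        ring
    rw [this]
    exact Measurable.ite (measurableSet_singleton 0) measurable_const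
      ((hFc.measurable.div (by fun_prop)).add_const M)
  have hgrad : ∀ᵐ x ∂(gaussMeasPi n β),
      ∑ i, ENNReal.ofReal (lineDeriv ℝ F x (EuclideanSpace.single i 1) ^ 2) = G₁ x := by
    have hac := gaussMeasPi_absolutelyContinuous n hβ
    have h0 : ∀ᵐ x : EuclideanSpace ℝ (Fin n), x ≠ 0 := by
      have : Nonempty (Fin n) := ⟨⟨0, hn0⟩⟩
      rw [ae_iff]; simp
    filter_upwards [hac.ae_le (ae_differentiableAt_homogExt hf), hac.ae_le h0] with x hx hx0
    obtain ⟨hd, hnorm⟩ := norm_gradient_norm_rpow_mul_sq f M lam hx0 (hx hx0)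
    rw [← ENNReal.ofReal_sum_of_nonneg fun i _ => sq_nonneg _, sum_lineDeriv_sq hd, hnorm]
  have hG₁hom := lintegral_homogeneous_eq hn0 hq0 (p := 2 * lam - 2) hD (G := G₁) (by
      have := measurable_gradient (homogExt f)
      fun_prop) (g := fun y => ENNReal.ofReal (lam ^ 2 * (f y - M) ^ 2 + ‖sphereGrad f y‖ ^ 2))
    (fun y r hr => by
      simp only [hG₁]
      rw [homogExt_smul_coe f hr, gradient_homogExt_smul f hr, norm_smul, norm_smul,
        norm_eq_of_mem_sphere y, mul_one, Real.norm_of_nonneg hr.le, norm_inv,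
        Real.norm_of_nonneg hr.le, ← ENNReal.ofReal_mul (by positivity), sphereGrad]
      congr 1
      have : r ^ (2 * lam) = r ^ (2 * lam - 2) * r ^ 2 := by
        rw [← Real.rpow_natCast, ← Real.rpow_add hr]; congr 1; push_cast; ring
      rw [this]
      field_simp)
  have hig : Integrable (fun y => ‖sphereGrad f y‖ ^ 2) m := by
    refine Integrable.of_bound ((measurable_sphereGrad f).norm.pow_const 2).aestronglyMeasurable
      ((K * 4) ^ 2) (.of_forall fun y => ?_)
    rw [Real.norm_of_nonneg (by positivity)]
    gcongr
    exact norm_sphereGrad_le hf y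
  rw [hsum, lintegral_congr_ae hgrad, hG₁hom, ← ofReal_integral_eq_lintegral_ofReal
    (by fun_prop) (.of_forall fun y => by simp only [Pi.zero_apply]; positivity),
    integral_add (by fun_prop) hig, integral_const_mul, ← hvar,
    ← ENNReal.ofReal_mul (radialMoment_pos hn0 hβ hD).le,
    ENNReal.ofReal_le_ofReal_iff] at htens
  · have hA := radialMoment_pos hn0 hβ hD
    -- Both sides become multiples of the moment of order `2 lam - 2`; subtracting `lam² Var f` from
    -- `lam (2 lam - 2 + n(β+1)) Var f` leaves the stated coefficient.
    have hrec := radialMoment_add_two hD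
    rw [sub_add_cancel] at hrec
    rw [hrec] at htens
    have : radialMoment n β (2 * lam - 2) * (lam * (lam + n * (β + 1) - 2) * variance f m) ≤
        radialMoment n β (2 * lam - 2) * ∫ y, ‖sphereGrad f y‖ ^ 2 ∂m := by
      linarith
    exact le_of_mul_le_mul_left this hA
  · have := variance_nonneg f m
    have h2 : 0 ≤ ∫ y, ‖sphereGrad f y‖ ^ 2 ∂m := integral_nonneg fun y => by positivity
    have := radialMoment_pos hn0 hβ hD
    positivity

theorem evenPoincare_locallyLipschitz {n : ℕ} (hn : 2 ≤ n) {q : ℝ} (hq : 1 < q) :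
    EvenPoincare (measureM n q) LocallyLipschitz
      (max (q / (4 * n)) (q ^ 2 / (8 * (q - 1) * (n + q - 2)))) := by
  intro f hf hev
  obtain ⟨K, hK⟩ := (hf.locallyLipschitzOn (s := univ)).exists_lipschitzOnWith_of_compact
    isCompact_univ
  rw [lipschitzOnWith_univ] at hK
  have hE : 0 ≤ ∫ y, ‖sphereGrad f y‖ ^ 2 ∂(measureM n q) := integral_nonneg fun y => by positivity
  have hn' : (2:ℝ) ≤ n := by exact_mod_cast hn
  have hq0 : 0 < q := by linarith
  have hDn : n * (2 / q - 1 + 1) = 2 * n / q := by ring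
  have hvar := variance_nonneg f (measureM n q)
  have hle : ∀ {c C : ℝ}, 0 < c → c * C = 1 →
      c * variance f (measureM n q) ≤ ∫ y, ‖sphereGrad f y‖ ^ 2 ∂(measureM n q) →
      variance f (measureM n q) ≤ C * ∫ y, ‖sphereGrad f y‖ ^ 2 ∂(measureM n q) := by
    intro c C hc hcC h
    have hC : 0 ≤ C := by
      by_contra hneg
      have := mul_neg_of_pos_of_neg hc (not_le.1 hneg)
      linarith
    calc variance f (measureM n q) = C * (c * variance f (measureM n q)) := by
          rw [← mul_assoc, mul_comm C, hcC, one_mul]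
      _ ≤ _ := mul_le_mul_of_nonneg_left h hC
  -- The exponent is `min(2, 2α)` with `2α = 2(2 - 2/q)`, and `2α ≥ 2` exactly when `q ≥ 2`.
  rcases le_total 2 q with hq2 | hq2
  · have h1 : 2 / q ≤ 1 := by rw [div_le_one hq0]; exact hq2
    have h2 := mul_variance_le_integral_norm_sphereGrad_sq hn hq (lam := 2) two_pos le_rfl
      (by linarith) (by rw [hDn]; positivity) hK hev
    rw [hDn] at h2
    refine (hle (C := q / (4 * n)) (by ring_nf; positivity) ?_ h2).trans ?_
    · field_simp; ring
    · gcongr; exact le_max_left _ _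
  · have h1 : 1 ≤ 2 / q := by rw [one_le_div hq0]; exact hq2
    have h3 : 2 / q < 2 := by rw [div_lt_iff₀ hq0]; linarith
    have h4 : 2 * (2 / q) ≤ n * (2 / q) := by gcongr
    have h5 : 0 < (q - 1) * (n + q - 2) := mul_pos (by linarith) (by linarith)
    have h5' : n + q - 2 ≠ 0 := by linarith
    have h5'' : q - 1 ≠ 0 := by linarith
    have e : 2 * (2 - 2 / q) * (2 * (2 - 2 / q) + 2 * n / q - 2) =
        8 * (q - 1) * (n + q - 2) / q ^ 2 := by
      field_simp; ring
    have h2 := mul_variance_le_integral_norm_sphereGrad_sq hn hq (lam := 2 * (2 - 2 / q))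
      (by linarith) (by linarith) le_rfl (by linarith) hK hev
    rw [hDn, e] at h2
    refine (hle (C := q ^ 2 / (8 * (q - 1) * (n + q - 2))) ?_ ?_ h2).trans ?_
    · have : 0 < 8 * (q - 1) * (n + q - 2) := by linarith
      positivity
    · field_simp
    · gcongr; exact le_max_right _ _

/-! ### Smooth test functions, moments on the sphere and the lower bounds. -/

section Sphere

variable {n : ℕ}

theorem SphereSmooth.locallyLipschitz {f : UnitSphere n → ℝ} (hf : SphereSmooth f) :
    LocallyLipschitz f := by
  intro y
  have h0 : y.1 ∈ ({0}ᶜ : Set (EuclideanSpace ℝ (Fin n))) :=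
    norm_ne_zero_iff.1 (by rw [norm_eq_of_mem_sphere y]; exact one_ne_zero)
  have h1 : ContDiffAt ℝ 1 (homogExt f) y.1 :=
    (hf.contDiffAt (isOpen_compl_singleton.mem_nhds h0)).of_le (by simp)
  obtain ⟨K, t, ht, hK⟩ := h1.exists_lipschitzOnWith
  refine ⟨K, Subtype.val ⁻¹' t, continuous_subtype_val.continuousAt.preimage_mem_nhds ht, ?_⟩
  intro x hx z hz
  have := hK hx hz
  rwa [homogExt_coe, homogExt_coe] at this

theorem sphereSmooth_restrict {H : EuclideanSpace ℝ (Fin n) → ℝ} (hH : ContDiff ℝ ∞ H) :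
    SphereSmooth fun y : UnitSphere n => H y.1 := by
  have h : ContDiffOn ℝ ∞ (fun x : EuclideanSpace ℝ (Fin n) => H (‖x‖⁻¹ • x)) {0}ᶜ := by
    have h1 : ContDiffOn ℝ ∞ (fun x : EuclideanSpace ℝ (Fin n) => ‖x‖⁻¹) {0}ᶜ :=
      ContDiffOn.inv (fun x hx => (contDiffAt_norm ℝ hx).contDiffWithinAt)
        fun x hx => norm_ne_zero_iff.2 hx
    exact hH.comp_contDiffOn (h1.smul contDiffOn_id)
  exact h.congr fun x hx => homogExt_of_ne _ hx

/-- The spherical gradient is the tangential projection `H' - ⟨H', y⟩ y`. -/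
theorem norm_sphereGrad_restrict_sq {H : EuclideanSpace ℝ (Fin n) → ℝ}
    {H' : EuclideanSpace ℝ (Fin n)} {y : UnitSphere n} (hH : HasGradientAt H H' y.1) :
    ‖sphereGrad (fun y : UnitSphere n => H y.1) y‖ ^ 2 = ‖H'‖ ^ 2 - (inner ℝ H' y.1) ^ 2 := by
  have hy : ‖y.1‖ = 1 := norm_eq_of_mem_sphere y
  have h0 : y.1 ≠ 0 := norm_ne_zero_iff.1 (by rw [hy]; exact one_ne_zero)
  have hN : HasFDerivAt (fun x : EuclideanSpace ℝ (Fin n) => ‖x‖ ^ (-1:ℝ) • x) _ y.1 :=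
    (hasFDerivAt_norm_rpow_of_ne_zero h0 (-1)).smul (hasFDerivAt_id y.1)
  have e1 : ‖y.1‖ ^ (-1:ℝ) • y.1 = y.1 := by rw [hy]; simp
  have hc := HasFDerivAt.comp (g := H) y.1 (by rw [e1]; exact hH.hasFDerivAt) hN
  have hc2 : HasGradientAt (homogExt fun y : UnitSphere n => H y.1)
      (H' - (inner ℝ H' y.1) • y.1) y.1 := by
    rw [hasGradientAt_iff_hasFDerivAt]
    refine (hc.congr_of_eventuallyEq ?_).congr_fderiv ?_
    · filter_upwards [isOpen_compl_singleton.mem_nhds h0] with x hx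
      rw [homogExt_of_ne _ hx, Function.comp_apply, Real.rpow_neg_one]
    · ext v
      simp only [hy, Real.one_rpow, mul_one, ContinuousLinearMap.comp_apply, map_add, map_smul,
        add_apply, smul_apply,
        ContinuousLinearMap.smulRight_apply, InnerProductSpace.toDual_apply_apply, map_sub,
        sub_apply, innerSL_apply_apply, smul_eq_mul]
      simp
      ring
  rw [sphereGrad, hc2.gradient, norm_sub_sq_real, inner_smul_right, norm_smul, hy, Real.norm_eq_abs,
    mul_one, sq_abs]
  ring

theorem hasGradientAt_mul_coord {i j : Fin n} {a b : ℝ → ℝ} {a' b' : ℝ}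
    {x : EuclideanSpace ℝ (Fin n)} (ha : HasDerivAt a a' (x i)) (hb : HasDerivAt b b' (x j)) :
    HasGradientAt (fun x : EuclideanSpace ℝ (Fin n) => a (x i) * b (x j))
      (EuclideanSpace.single i (a' * b (x j)) + EuclideanSpace.single j (a (x i) * b')) x := by
  rw [hasGradientAt_iff_hasFDerivAt]
  have hi : ∀ i, HasFDerivAt (fun x : EuclideanSpace ℝ (Fin n) => x i)
    (EuclideanSpace.proj i : EuclideanSpace ℝ (Fin n) →L[ℝ] ℝ) x := fun i =>
    (EuclideanSpace.proj i : EuclideanSpace ℝ (Fin n) →L[ℝ] ℝ).hasFDerivAt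
  refine ((ha.comp_hasFDerivAt x (hi i)).mul (hb.comp_hasFDerivAt x (hi j))).congr_fderiv ?_
  ext v
  simp [EuclideanSpace.inner_single_left]
  ring

theorem norm_sphereGrad_mul_coord_sq {i j : Fin n} (hij : i ≠ j) {a b : ℝ → ℝ} {a' b' : ℝ}
    {y : UnitSphere n} (ha : HasDerivAt a a' (y.1 i)) (hb : HasDerivAt b b' (y.1 j)) :
    ‖sphereGrad (fun y : UnitSphere n => a (y.1 i) * b (y.1 j)) y‖ ^ 2 =
      (a' * b (y.1 j)) ^ 2 + (a (y.1 i) * b') ^ 2 -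
        (a' * b (y.1 j) * y.1 i + a (y.1 i) * b' * y.1 j) ^ 2 := by
  rw [norm_sphereGrad_restrict_sq (H := fun x => a (x i) * b (x j))
    (hasGradientAt_mul_coord ha hb), norm_add_sq_real, inner_add_left]
  simp [EuclideanSpace.inner_single_left, hij, mul_pow]

/-- The integrand is homogeneous of degree `s + t`. On `ℝⁿ` its integral factors over independent
coordinates; dividing by the radial moment gives the integral on the sphere. -/
theorem lintegral_measureM_abs_rpow_mul {q : ℝ} (hq : 0 < q) {i j : Fin n} (hij : i ≠ j) {s t : ℝ}
    (hs : -1 < 2 / q - 1 + s) (ht : -1 < 2 / q - 1 + t)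
    (hst : 0 < s + t + n * (2 / q - 1 + 1)) :
    ∫⁻ y, ENNReal.ofReal (|y.1 i| ^ s * |y.1 j| ^ t) ∂(measureM n q) =
      ENNReal.ofReal (gaussMoment (2 / q - 1 + s) / gaussMoment (2 / q - 1) *
        (gaussMoment (2 / q - 1 + t) / gaussMoment (2 / q - 1)) /
        radialMoment n (2 / q - 1) (s + t)) := by
  have hn : 0 < n := i.pos
  have hβ := two_div_sub_one_gt hq
  have := isProbabilityMeasure_gaussMeas hβ
  have h0 := gaussMoment_pos hβ
  have h1 := gaussMoment_pos hs
  have h2 := gaussMoment_pos ht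
  have hA := radialMoment_pos hn hβ hst
  have key := lintegral_homogeneous_eq hn hq hst
    (G := fun x => ENNReal.ofReal (|x i| ^ s * |x j| ^ t)) (by fun_prop)
    (g := fun y => ENNReal.ofReal (|y.1 i| ^ s * |y.1 j| ^ t)) (fun y r hr => by
      rw [← ENNReal.ofReal_mul (by positivity)]
      simp only [PiLp.smul_apply, smul_eq_mul, abs_mul, abs_of_pos hr]
      rw [Real.mul_rpow hr.le (abs_nonneg _), Real.mul_rpow hr.le (abs_nonneg _),
        Real.rpow_add hr]
      congr 1; ring)
  rw [← (measurePreserving_toLp_gaussMeasPi n _).lintegral_comp (by fun_prop)] at key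
  have hprod : ∀ x : Fin n → ℝ, ENNReal.ofReal (|x i| ^ s * |x j| ^ t) =
      ∏ k, ((if k = i then ENNReal.ofReal (|x k| ^ s) else 1) *
        (if k = j then ENNReal.ofReal (|x k| ^ t) else 1)) := fun x => by
    rw [Finset.prod_mul_distrib, Finset.prod_ite_eq' Finset.univ i,
      Finset.prod_ite_eq' Finset.univ j, ENNReal.ofReal_mul (by positivity)]
    simp
  simp only [hprod] at key
  rw [lintegral_pi_prod_eq_prod_lintegral (f := fun k x =>
    (if k = i then ENNReal.ofReal (|x| ^ s) else 1) *
        (if k = j then ENNReal.ofReal (|x| ^ t) else 1)) (fun k => by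
      split_ifs <;> fun_prop)] at key
  have hk : ∀ k : Fin n, ∫⁻ x, (if k = i then ENNReal.ofReal (|x| ^ s) else 1) *
        (if k = j then ENNReal.ofReal (|x| ^ t) else 1) ∂(gaussMeas (2 / q - 1)) =
      (if k = i then ENNReal.ofReal (gaussMoment (2 / q - 1 + s) / gaussMoment (2 / q - 1)) else 1)
      * (if k = j then ENNReal.ofReal (gaussMoment (2 / q - 1 + t) / gaussMoment (2 / q - 1))
        else 1) := fun k => by
    by_cases hki : k = i
    · have hkj : k ≠ j := hki ▸ hij
      simp only [hki, hij, if_true, if_false, mul_one]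
      exact lintegral_gaussMeas_abs_rpow hβ hs
    · by_cases hkj : k = j
      · simp only [hkj, hij.symm, if_true, if_false, one_mul]
        exact lintegral_gaussMeas_abs_rpow hβ ht
      · simp [hki, hkj]
  rw [Finset.prod_congr rfl fun k _ => hk k, Finset.prod_mul_distrib,
    Finset.prod_ite_eq' Finset.univ i, Finset.prod_ite_eq' Finset.univ j] at key
  simp only [Finset.mem_univ, if_true, ← hprod] at key
  rw [← ENNReal.ofReal_mul (by positivity)] at key
  rw [ENNReal.ofReal_div_of_pos hA, key, mul_comm, ENNReal.mul_div_cancel_right]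
  · simpa using hA
  · simp

end Sphere

section Sphere

variable {n : ℕ}

/-- The moment `∫ |yᵢ|^s |yⱼ|^t dm` for `i ≠ j`. -/
noncomputable def sphereMoment (n : ℕ) (q s t : ℝ) : ℝ :=
  gaussMoment (2 / q - 1 + s) / gaussMoment (2 / q - 1) *
    (gaussMoment (2 / q - 1 + t) / gaussMoment (2 / q - 1)) / radialMoment n (2 / q - 1) (s + t)

theorem sphereMoment_pos (hn : 0 < n) {q s t : ℝ} (hq : 0 < q)
    (hs : -1 < 2 / q - 1 + s) (ht : -1 < 2 / q - 1 + t)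
    (hst : 0 < s + t + n * (2 / q - 1 + 1)) : 0 < sphereMoment n q s t := by
  have hβ := two_div_sub_one_gt hq
  have h0 := gaussMoment_pos hβ
  have h1 := gaussMoment_pos hs
  have h2 := gaussMoment_pos ht
  have hA := radialMoment_pos hn hβ hst
  unfold sphereMoment
  positivity

theorem integral_measureM_abs_rpow_mul {q : ℝ} (hq : 0 < q) {i j : Fin n} (hij : i ≠ j) {s t : ℝ}
    (hs : -1 < 2 / q - 1 + s) (ht : -1 < 2 / q - 1 + t)
    (hst : 0 < s + t + n * (2 / q - 1 + 1)) :
    Integrable (fun y => |y.1 i| ^ s * |y.1 j| ^ t) (measureM n q) ∧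
    ∫ y, |y.1 i| ^ s * |y.1 j| ^ t ∂(measureM n q) = sphereMoment n q s t := by
  have h := lintegral_measureM_abs_rpow_mul hq hij hs ht hst
  have hm : Measurable (fun y : UnitSphere n => |y.1 i| ^ s * |y.1 j| ^ t) := by fun_prop
  have h0 : ∀ y : UnitSphere n, 0 ≤ |y.1 i| ^ s * |y.1 j| ^ t := fun y => by positivity
  have hp := sphereMoment_pos i.pos hq hs ht hst
  refine ⟨⟨hm.aestronglyMeasurable, ?_⟩, ?_⟩
  · rw [hasFiniteIntegral_iff_ofReal (.of_forall h0), h]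
    exact ENNReal.ofReal_lt_top
  · rw [integral_eq_lintegral_of_nonneg_ae (.of_forall h0) hm.aestronglyMeasurable, h]
    exact ENNReal.toReal_ofReal hp.le

theorem sphereMoment_add_two (hn : 0 < n) {q s t : ℝ} (hq : 0 < q)
    (hs : -1 < 2 / q - 1 + s) (hst : 0 < s + t + n * (2 / q - 1 + 1)) :
    (s + t + n * (2 / q - 1 + 1)) * sphereMoment n q (s + 2) t =
      (2 / q - 1 + s + 1) * sphereMoment n q s t := by
  have hA := radialMoment_pos hn (two_div_sub_one_gt hq) hst
  rw [sphereMoment, sphereMoment, ← add_assoc, gaussMoment_add_two hs,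
    show s + 2 + t = s + t + 2 by ring, radialMoment_add_two hst]
  generalize radialMoment n (2 / q - 1) (s + t) = A at *
  generalize gaussMoment (2 / q - 1 + s) = A1 at *
  generalize gaussMoment (2 / q - 1 + t) = A2 at *
  generalize gaussMoment (2 / q - 1) = A3 at *
  generalize s + t + n * (2 / q - 1 + 1) = P at *
  generalize 2 / q - 1 + s + 1 = Q at *
  field_simp

theorem sphereMoment_zero_zero (hn : 0 < n) {q : ℝ} (hq : 0 < q) : sphereMoment n q 0 0 = 1 := by
  have hβ := two_div_sub_one_gt hq
  have h0 := gaussMoment_pos hβ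
  rw [sphereMoment, add_zero, add_zero, radialMoment_zero hn hβ, div_self h0.ne']
  norm_num

theorem abs_coord_le_one (y : UnitSphere n) (i : Fin n) : |y.1 i| ≤ 1 := by
  have := PiLp.norm_apply_le y.1 i
  rwa [norm_eq_of_mem_sphere y] at this

/-- Tested on `y_i²`, for which energy over variance is exactly `4n/q`. -/
theorem le_of_evenPoincare_smooth_sq (hn : 2 ≤ n) {q C : ℝ} (hq : 1 < q)
    (hC : EvenPoincare (measureM n q) SphereSmooth C) : q / (4 * n) ≤ C := by
  have hn0 : 0 < n := by omega
  have hq0 : 0 < q := by linarith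
  have hn' : (2:ℝ) ≤ n := by exact_mod_cast hn
  have hd : 0 < 2 / q := by positivity
  have := isProbabilityMeasure_measureM hn0 hq0
  have : Nontrivial (Fin n) := Fin.nontrivial_iff_two_le.2 hn
  obtain ⟨i, j, hij⟩ := exists_pair_ne (Fin n)
  have hD : n * (2 / q - 1 + 1) = n * (2 / q) := by ring
  have hD0 : 0 < n * (2 / q) := by positivity
  have m2 := integral_measureM_abs_rpow_mul hq0 hij (s := 2) (t := 0) (by linarith) (by linarith)
    (by rw [hD]; linarith)
  have m4 := integral_measureM_abs_rpow_mul hq0 hij (s := 4) (t := 0) (by linarith) (by linarith)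
    (by rw [hD]; linarith)
  have r1 := sphereMoment_add_two hn0 (q := q) (s := 0) (t := 0) hq0 (by linarith)
    (by rw [hD]; linarith)
  have r2 := sphereMoment_add_two hn0 (q := q) (s := 2) (t := 0) hq0 (by linarith)
    (by rw [hD]; linarith)
  rw [sphereMoment_zero_zero hn0 hq0, hD] at r1
  rw [hD] at r2
  norm_num at r1 r2
  have e2 : ∀ x z : ℝ, |x| ^ (2:ℝ) * |z| ^ (0:ℝ) = x ^ 2 := fun x z => by simp
  have e4 : ∀ x z : ℝ, |x| ^ (4:ℝ) * |z| ^ (0:ℝ) = (x ^ 2) ^ 2 := fun x z => by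
    rw [Real.rpow_zero, mul_one, Real.rpow_ofNat, ← sq_abs x, ← pow_mul]
  simp only [e2] at m2
  simp only [e4] at m4
  -- The constant second factor puts `y_i²` in the two-coordinate form for which the gradient is
  -- known.
  have h := hC (fun y => (fun t => t ^ 2) (y.1 i) * (fun _ => 1) (y.1 j))
    (sphereSmooth_restrict (H := fun x => (fun t => t ^ 2) (x i) * (fun _ => 1) (x j))
      (by fun_prop)) (fun y => by simp)
  have hgr : ∀ y : UnitSphere n, ‖sphereGrad (fun y : UnitSphere n =>
      (fun t => t ^ 2) (y.1 i) * (fun _ => (1:ℝ)) (y.1 j)) y‖ ^ 2 =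
      4 * y.1 i ^ 2 - 4 * (y.1 i ^ 2) ^ 2 := fun y => by
    rw [norm_sphereGrad_mul_coord_sq hij (hasDerivAt_pow 2 _) (hasDerivAt_const _ _)]
    push_cast
    ring
  simp only [hgr] at h
  simp only [mul_one] at h
  have hL : MemLp (fun y : UnitSphere n => y.1 i ^ 2) 2 (measureM n q) :=
    (memLp_two_iff_integrable_sq (by fun_prop)).2 m4.1
  rw [variance_eq_sub hL, integral_sub (m2.1.const_mul 4) (m4.1.const_mul 4), integral_const_mul,
    integral_const_mul, m2.2] at h
  simp only [Pi.pow_apply] at h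
  rw [m4.2] at h
  have s2 : sphereMoment n q 2 0 = 1 / n := by
    field_simp at r1 ⊢; linarith
  rw [s2] at h r2
  have hne : 2 + n * (2 / q) ≠ 0 := by positivity
  have s4 : sphereMoment n q 4 0 = (2 / q + 2) / n / (2 + n * (2 / q)) := by
    rw [eq_div_iff hne, mul_comm, r2]
    ring
  rw [s4] at h
  have hk : (0:ℝ) < n - 1 := by linarith
  have eV : (2 / q + 2) / n / (2 + n * (2 / q)) - (1 / (n:ℝ)) ^ 2 =
      2 * (n - 1) / (n ^ 2 * (2 + n * (2 / q))) := by
    field_simp; ring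
  have eE : 4 * (1 / (n:ℝ)) - 4 * ((2 / q + 2) / n / (2 + n * (2 / q))) =
      2 * (n - 1) / (n ^ 2 * (2 + n * (2 / q))) * (4 * n / q) := by
    field_simp; ring
  rw [eV, eE] at h
  have hpos : 0 < 2 * ((n:ℝ) - 1) / (n ^ 2 * (2 + n * (2 / q))) := by positivity
  have h2 : 1 ≤ C * (4 * n / q) := by
    have : 2 * ((n:ℝ) - 1) / (n ^ 2 * (2 + n * (2 / q))) * 1 ≤
        2 * ((n:ℝ) - 1) / (n ^ 2 * (2 + n * (2 / q))) * (C * (4 * n / q)) := by linarith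
    exact le_of_mul_le_mul_left this hpos
  rw [div_le_iff₀ (by positivity)]
  rw [mul_div_assoc', one_le_div hq0] at h2
  exact h2

end Sphere

/-! ### Regularized powers and the second extremal function. -/

/-- A smooth odd regularization of `t |t|^(α-1)`. -/
noncomputable def regPow (α ε t : ℝ) : ℝ := t * (t ^ 2 + ε) ^ ((α - 1) / 2)

/-- The derivative of `regPow α ε`. -/
noncomputable def regPowDeriv (α ε t : ℝ) : ℝ :=
  (t ^ 2 + ε) ^ ((α - 1) / 2) * ((ε + α * t ^ 2) / (t ^ 2 + ε))

section RegPow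

variable {α ε t : ℝ}

theorem contDiff_regPow (hε : 0 < ε) : ContDiff ℝ ∞ (regPow α ε) := by
  refine contDiff_id.mul (ContDiff.rpow_const_of_ne (by fun_prop) fun t => ?_)
  positivity

theorem hasDerivAt_regPow (hε : 0 < ε) (t : ℝ) :
    HasDerivAt (regPow α ε) (regPowDeriv α ε t) t := by
  have hs : 0 < t ^ 2 + ε := by positivity
  have h1 : HasDerivAt (fun t : ℝ => t ^ 2 + ε) (2 * t) t := by
    simpa using (hasDerivAt_pow 2 t).add_const ε
  have h2 := (hasDerivAt_id t).mul (h1.rpow_const (p := (α - 1) / 2) (Or.inl hs.ne'))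
  refine h2.congr_deriv ?_
  rw [regPowDeriv, Real.rpow_sub_one hs.ne']
  simp only [id]
  field_simp
  ring

theorem regPow_neg (α ε t : ℝ) : regPow α ε (-t) = -regPow α ε t := by
  simp [regPow]

theorem sq_rpow_half (α t : ℝ) : (t ^ 2) ^ ((α - 1) / 2) = |t| ^ (α - 1) := by
  rw [← sq_abs, ← Real.rpow_natCast_mul (abs_nonneg t)]
  congr 1; push_cast; ring

/-- A bound uniform in `ε`: for `α ≤ 1` the exponent is nonpositive and dropping `ε` only increases
the power; for `α ≥ 1` the base is at most 2. -/
theorem rpow_sq_add_le (hα2 : α < 2) (hε : 0 < ε) (hε1 : ε ≤ 1) (ht : t ≠ 0)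
    (ht1 : |t| ≤ 1) : (t ^ 2 + ε) ^ ((α - 1) / 2) ≤ 2 + |t| ^ (α - 1) := by
  have hs : 0 < t ^ 2 + ε := by positivity
  have ht2 : t ^ 2 ≤ 1 := (sq_le_one_iff_abs_le_one t).2 ht1
  have hp : 0 ≤ |t| ^ (α - 1) := by positivity
  rcases le_total α 1 with h | h
  · have h1 : (t ^ 2 + ε) ^ ((α - 1) / 2) ≤ (t ^ 2) ^ ((α - 1) / 2) :=
      Real.rpow_le_rpow_of_nonpos (by positivity) (by linarith) (by linarith)
    rw [sq_rpow_half] at h1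
    linarith
  · have h1 : (t ^ 2 + ε) ^ ((α - 1) / 2) ≤ 2 ^ ((α - 1) / 2) :=
      Real.rpow_le_rpow hs.le (by linarith) (by linarith)
    have h2 : (2:ℝ) ^ ((α - 1) / 2) ≤ 2 ^ (1:ℝ) :=
      Real.rpow_le_rpow_of_exponent_le (by norm_num) (by linarith)
    rw [Real.rpow_one] at h2
    linarith

theorem abs_mul_abs_rpow_sub_one (α : ℝ) (ht : t ≠ 0) : |t| * |t| ^ (α - 1) = |t| ^ α := by
  rw [mul_comm, ← Real.rpow_add_one (abs_ne_zero.2 ht), sub_add_cancel]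

theorem abs_regPow_le (hα : 0 < α) (hα2 : α < 2) (hε : 0 < ε) (hε1 : ε ≤ 1) (ht1 : |t| ≤ 1) :
    |regPow α ε t| ≤ 3 := by
  by_cases ht : t = 0
  · simp [regPow, ht]
  · have h := rpow_sq_add_le hα2 hε hε1 ht ht1
    rw [regPow, abs_mul, abs_of_nonneg (a := (t ^ 2 + ε) ^ ((α - 1) / 2)) (by positivity)]
    have h2 := mul_le_mul_of_nonneg_left h (abs_nonneg t)
    rw [mul_add, abs_mul_abs_rpow_sub_one α ht] at h2
    have h3 : |t| ^ α ≤ 1 := Real.rpow_le_one (abs_nonneg t) ht1 hα.le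
    linarith

/-- Uniform domination for the energy. The majorant is integrable against `|t|^(1-α)` near 0 because
`2α - 2 + 1 - α = α - 1 > -1`. -/
theorem regPowDeriv_sq_le (hα : 0 < α) (hα2 : α < 2) (hε : 0 < ε) (hε1 : ε ≤ 1) (ht : t ≠ 0)
    (ht1 : |t| ≤ 1) : regPowDeriv α ε t ^ 2 ≤ 32 + 8 * |t| ^ (2 * α - 2) := by
  have h := rpow_sq_add_le hα2 hε hε1 ht ht1
  have hs : 0 < t ^ 2 + ε := by positivity
  have h1 : (ε + α * t ^ 2) / (t ^ 2 + ε) ≤ 2 := by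
    rw [div_le_iff₀ hs]; nlinarith [sq_nonneg t]
  have h2 : regPowDeriv α ε t ≤ (2 + |t| ^ (α - 1)) * 2 := by
    unfold regPowDeriv
    gcongr
  have h0 : 0 ≤ regPowDeriv α ε t := by unfold regPowDeriv; positivity
  have e : |t| ^ (2 * α - 2) = (|t| ^ (α - 1)) ^ 2 := by
    rw [← Real.rpow_mul_natCast (abs_nonneg t)]
    congr 1; push_cast; ring
  rw [e]
  calc regPowDeriv α ε t ^ 2 ≤ ((2 + |t| ^ (α - 1)) * 2) ^ 2 := by gcongr
    _ ≤ _ := by nlinarith [sq_nonneg (2 - |t| ^ (α - 1))]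

theorem tendsto_rpow_sq_add (α : ℝ) (ht : t ≠ 0) {e : ℕ → ℝ}
    (he : Filter.Tendsto e Filter.atTop (nhds 0)) :
    Filter.Tendsto (fun k => (t ^ 2 + e k) ^ ((α - 1) / 2)) Filter.atTop
      (nhds (|t| ^ (α - 1))) := by
  have h : Filter.Tendsto (fun k => t ^ 2 + e k) Filter.atTop (nhds (t ^ 2 + 0)) := he.const_add _
  rw [add_zero] at h
  have := h.rpow_const (p := (α - 1) / 2) (Or.inl (by positivity))
  rwa [sq_rpow_half] at this

theorem tendsto_regPow (α : ℝ) (ht : t ≠ 0) {e : ℕ → ℝ}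
    (he : Filter.Tendsto e Filter.atTop (nhds 0)) :
    Filter.Tendsto (fun k => regPow α (e k) t) Filter.atTop (nhds (t * |t| ^ (α - 1))) :=
  (tendsto_rpow_sq_add α ht he).const_mul t

theorem tendsto_regPowDeriv (α : ℝ) (ht : t ≠ 0) {e : ℕ → ℝ}
    (he : Filter.Tendsto e Filter.atTop (nhds 0)) :
    Filter.Tendsto (fun k => regPowDeriv α (e k) t) Filter.atTop (nhds (|t| ^ (α - 1) * α)) := by
  refine (tendsto_rpow_sq_add α ht he).mul ?_
  have h : Filter.Tendsto (fun k => (e k + α * t ^ 2) / (t ^ 2 + e k)) Filter.atTop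
      (nhds ((0 + α * t ^ 2) / (t ^ 2 + 0))) :=
    (he.add_const (α * t ^ 2)).div (he.const_add (t ^ 2)) (by simpa using ht)
  rwa [zero_add, add_zero, mul_div_cancel_right₀ _ (pow_ne_zero 2 ht)] at h

end RegPow

section Sphere

variable {n : ℕ}

/-- The indicator of a coordinate hyperplane is homogeneous of degree 0, so nullity transfers from
the product measure. -/
theorem ae_measureM_coord_ne_zero (hn : 0 < n) {q : ℝ} (hq : 0 < q) :
    ∀ᵐ y ∂(measureM n q), ∀ i, y.1 i ≠ 0 := by
  have hβ := two_div_sub_one_gt hq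
  have hD := natCast_mul_add_one_pos hn hβ
  rw [ae_all_iff]
  intro i
  have hs : MeasurableSet {x : EuclideanSpace ℝ (Fin n) | x i = 0} :=
    measurableSet_eq_fun (by fun_prop) measurable_const
  have h := lintegral_homogeneous_eq hn hq (p := 0) (by linarith)
    (G := {x : EuclideanSpace ℝ (Fin n) | x i = 0}.indicator 1) (measurable_one.indicator hs)
    (g := {y : UnitSphere n | y.1 i = 0}.indicator 1) (fun y r hr => by
      by_cases hy : y.1 i = 0 <;> simp [indicator, hy, hr.ne'])
  have hs' : MeasurableSet {y : UnitSphere n | y.1 i = 0} := measurable_subtype_coe hs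
  rw [lintegral_indicator_one hs, lintegral_indicator_one hs', radialMoment_zero hn hβ,
    ENNReal.ofReal_one, one_mul] at h
  rw [ae_iff]
  simp only [ne_eq, not_not]
  rw [← h, gaussMeasPi, Measure.map_apply (by fun_prop) hs]
  refine measure_mono_null ?_ (ae_iff.1 (ae_pi_gaussMeas_ne_zero (n := n) hβ))
  intro x hx
  simp only [mem_preimage, mem_ofPred_eq] at hx ⊢
  exact fun h' => h' i hx

theorem integral_gaussMeas_odd (β : ℝ) {h : ℝ → ℝ} (hodd : ∀ t, h (-t) = -h t)
    (hm : Measurable h) : ∫ t, h t ∂(gaussMeas β) = 0 := by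
  have := (measurePreserving_neg_gaussMeas β).integral_comp_eq hm.aestronglyMeasurable
  simp only [hodd, integral_neg] at this
  linarith

/-- The integrand is homogeneous, and on the product space it contains the factor of coordinate `i`,
which is odd. -/
theorem integral_measureM_signed_rpow {q α : ℝ} (hq : 0 < q) (hα : 0 < α) {i j : Fin n}
    (hij : i ≠ j) :
    ∫ y, y.1 i * |y.1 i| ^ (α - 1) * (y.1 j * |y.1 j| ^ (α - 1)) ∂(measureM n q) = 0 := by
  have hn := i.pos
  have hβ := two_div_sub_one_gt hq
  have hD := natCast_mul_add_one_pos hn hβ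
  have hP := isProbabilityMeasure_measureM hn hq
  have hP1 := isProbabilityMeasure_gaussMeas hβ
  set h : ℝ → ℝ := fun t => t * |t| ^ (α - 1) with hh
  have hm : Measurable h := by fun_prop
  have hb : ∀ t, |t| ≤ 1 → |h t| ≤ 1 := fun t ht => by
    by_cases h0 : t = 0
    · simp [hh, h0]
    · rw [hh]
      simp only
      rw [abs_mul, abs_of_nonneg (a := |t| ^ (α - 1)) (by positivity),
        abs_mul_abs_rpow_sub_one α h0]
      exact Real.rpow_le_one (abs_nonneg t) ht hα.le
  have hi : Integrable (fun y : UnitSphere n => h (y.1 i) * h (y.1 j)) (measureM n q) := by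
    refine Integrable.of_bound (by fun_prop) 1 (.of_forall fun y => ?_)
    rw [Real.norm_eq_abs, abs_mul]
    exact mul_le_one₀ (hb _ (abs_coord_le_one y i)) (abs_nonneg _) (hb _ (abs_coord_le_one y j))
  have hhom : ∀ r t : ℝ, 0 < r → h (r * t) = r ^ α * h t := fun r t hr => by
    simp only [hh]
    rw [abs_mul, abs_of_pos hr, Real.mul_rpow hr.le (abs_nonneg t)]
    have : r ^ α = r * r ^ (α - 1) := by
      rw [mul_comm, ← Real.rpow_add_one hr.ne', sub_add_cancel]
    rw [this]; ring
  have key := integral_homogeneous_eq hn hq (p := α + α) (by linarith)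
    (G := fun x : EuclideanSpace ℝ (Fin n) => h (x i) * h (x j)) (by fun_prop) hi
    (fun y r hr => by
      simp only [PiLp.smul_apply, smul_eq_mul]
      rw [hhom _ _ hr, hhom _ _ hr, Real.rpow_add hr]; ring)
  have hzero : ∫ x : EuclideanSpace ℝ (Fin n), h (x i) * h (x j) ∂(gaussMeasPi n (2 / q - 1)) = 0 := by
    have hemb : MeasurableEmbedding (WithLp.toLp 2 : (Fin n → ℝ) → EuclideanSpace ℝ (Fin n)) :=
      (MeasurableEquiv.toLp 2 (Fin n → ℝ)).measurableEmbedding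
    rw [← (measurePreserving_toLp_gaussMeasPi n (2 / q - 1)).integral_comp hemb]
    have hprod : ∀ x : Fin n → ℝ, h (x i) * h (x j) =
        ∏ k, ((if k = i then h (x k) else 1) * (if k = j then h (x k) else 1)) := fun x => by
      rw [Finset.prod_mul_distrib, Finset.prod_ite_eq' Finset.univ i,
        Finset.prod_ite_eq' Finset.univ j]
      simp
    simp only [hprod]
    rw [integral_fintype_prod_eq_prod (fun k x => (if k = i then h x else 1) *
      (if k = j then h x else 1))]
    refine Finset.prod_eq_zero (Finset.mem_univ i) ?_
    simp only [if_true, hij, if_false, mul_one]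
    exact integral_gaussMeas_odd _ (fun t => by simp [hh]) hm
  rw [hzero] at key
  have hA := radialMoment_pos hn hβ (p := α + α) (by linarith)
  exact (mul_eq_zero.1 key.2.symm).resolve_left hA.ne'

end Sphere

/-- The product of two regularized odd powers in distinct coordinates is smooth and even. As the
regularization tends to 0, mean, second moment and energy converge by dominated convergence to those
of the singular extremal function. -/
theorem le_of_evenPoincare_smooth_regPow {n : ℕ} (hn : 2 ≤ n) {q C : ℝ} (hq : 1 < q)
    (hC : EvenPoincare (measureM n q) SphereSmooth C) :
    q ^ 2 / (8 * (q - 1) * (n + q - 2)) ≤ C := by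
  have hn0 : 0 < n := by omega
  have hq0 : 0 < q := by linarith
  have hn' : (2:ℝ) ≤ n := by exact_mod_cast hn
  have hd : 0 < 2 / q := by positivity
  have hd2 : 2 / q < 2 := by rw [div_lt_iff₀ hq0]; linarith
  have := isProbabilityMeasure_measureM hn0 hq0
  have : Nontrivial (Fin n) := Fin.nontrivial_iff_two_le.2 hn
  obtain ⟨i, j, hij⟩ := exists_pair_ne (Fin n)
  have hD : n * (2 / q - 1 + 1) = n * (2 / q) := by ring
  have hD2 : 2 * (2 / q) ≤ n * (2 / q) := by gcongr
  obtain ⟨α, hαq⟩ : ∃ α, α = 2 - 2 / q := ⟨_, rfl⟩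
  have hα : 0 < α := by linarith
  have hα2 : α < 2 := by linarith
  obtain ⟨e, he0, he1, he⟩ : ∃ e : ℕ → ℝ, (∀ k, 0 < e k) ∧ (∀ k, e k ≤ 1) ∧
      Filter.Tendsto e Filter.atTop (nhds 0) :=
    ⟨fun k => 1 / ((k:ℝ) + 1), fun k => by positivity, fun k => by
      rw [div_le_one (by positivity)]; linarith [k.cast_nonneg (α := ℝ)],
      tendsto_one_div_add_atTop_nhds_zero_nat⟩
  have m0 := integral_measureM_abs_rpow_mul hq0 hij (s := 2 * α) (t := 2 * α) (by linarith)
    (by linarith) (by rw [hD]; linarith)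
  have m1 := integral_measureM_abs_rpow_mul hq0 hij (s := 2 * α - 2) (t := 2 * α) (by linarith)
    (by linarith) (by rw [hD]; linarith)
  have m2 := integral_measureM_abs_rpow_mul hq0 hij.symm (s := 2 * α - 2) (t := 2 * α)
    (by linarith) (by linarith) (by rw [hD]; linarith)
  have d1 := (integral_measureM_abs_rpow_mul hq0 hij (s := 2 * α - 2) (t := 0) (by linarith)
    (by linarith) (by rw [hD]; linarith)).1
  have d2 := (integral_measureM_abs_rpow_mul hq0 hij.symm (s := 2 * α - 2) (t := 0) (by linarith)
    (by linarith) (by rw [hD]; linarith)).1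
  simp only [Real.rpow_zero, mul_one] at d1 d2
  have hrec := sphereMoment_add_two hn0 (q := q) (s := 2 * α - 2) (t := 2 * α) hq0 (by linarith)
    (by rw [hD]; linarith)
  have hpos := sphereMoment_pos hn0 (q := q) (s := 2 * α) (t := 2 * α) hq0 (by linarith)
    (by linarith) (by rw [hD]; linarith)
  have hne := ae_measureM_coord_ne_zero hn0 hq0
  set f : ℕ → UnitSphere n → ℝ :=
    fun k y => regPow α (e k) (y.1 i) * regPow α (e k) (y.1 j) with hf
  have hfs : ∀ k, SphereSmooth (f k) := fun k =>
    sphereSmooth_restrict (H := fun x => regPow α (e k) (x i) * regPow α (e k) (x j))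
      (((contDiff_regPow (he0 k)).comp (by fun_prop)).mul
        ((contDiff_regPow (he0 k)).comp (by fun_prop)))
  have hfm : ∀ k, AEStronglyMeasurable (f k) (measureM n q) := fun k =>
    (hfs k).locallyLipschitz.continuous.aestronglyMeasurable
  have hreg : ∀ k (y : UnitSphere n) l, |regPow α (e k) (y.1 l)| ≤ 3 := fun k y l =>
    abs_regPow_le hα hα2 (he0 k) (he1 k) (abs_coord_le_one y l)
  have hfb : ∀ k y, |f k y| ≤ 9 := fun k y => by
    rw [hf, abs_mul]
    calc _ ≤ (3:ℝ) * 3 := mul_le_mul (hreg k y i) (hreg k y j) (abs_nonneg _) (by norm_num)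
      _ = 9 := by norm_num
  have hlim : ∀ᵐ y ∂(measureM n q), Filter.Tendsto (fun k => f k y) Filter.atTop
      (nhds (y.1 i * |y.1 i| ^ (α - 1) * (y.1 j * |y.1 j| ^ (α - 1)))) := by
    filter_upwards [hne] with y hy
    exact (tendsto_regPow α (hy i) he).mul (tendsto_regPow α (hy j) he)
  have habs : ∀ x : ℝ, x ≠ 0 → |x| ^ (2 * α) = (x * |x| ^ (α - 1)) ^ 2 := fun x hx => by
    rw [← sq_abs (x * _), abs_mul, abs_of_nonneg (a := |x| ^ (α - 1)) (by positivity),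
      abs_mul_abs_rpow_sub_one α hx, ← Real.rpow_mul_natCast (abs_nonneg x)]
    congr 1; push_cast; ring
  have habs' : ∀ x : ℝ, |x| ^ (2 * α - 2) = (|x| ^ (α - 1)) ^ 2 := fun x => by
    rw [← Real.rpow_mul_natCast (abs_nonneg x)]
    congr 1; push_cast; ring
  have t1 : Filter.Tendsto (fun k => ∫ y, f k y ∂(measureM n q)) Filter.atTop (nhds 0) := by
    rw [← integral_measureM_signed_rpow hq0 hα hij]
    exact tendsto_integral_of_dominated_convergence (fun _ => 9) hfm (integrable_const _)
      (fun k => .of_forall (hfb k)) hlim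
  have t2 : Filter.Tendsto (fun k => ∫ y, f k y ^ 2 ∂(measureM n q)) Filter.atTop
      (nhds (sphereMoment n q (2 * α) (2 * α))) := by
    rw [← m0.2]
    refine tendsto_integral_of_dominated_convergence (fun _ => 9 ^ 2) (fun k => (hfm k).pow 2)
      (integrable_const _) (fun k => .of_forall fun y => ?_) ?_
    · rw [norm_pow, Real.norm_eq_abs]
      exact pow_le_pow_left₀ (abs_nonneg _) (hfb k y) 2
    · filter_upwards [hne, hlim] with y hy h
      rw [habs _ (hy i), habs _ (hy j), ← mul_pow]
      exact h.pow 2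
  have hgr : ∀ k y, ‖sphereGrad (f k) y‖ ^ 2 = _ := fun k y =>
    norm_sphereGrad_mul_coord_sq hij (hasDerivAt_regPow (α := α) (he0 k) _)
      (hasDerivAt_regPow (α := α) (he0 k) _)
  have hint : ∫ y, (α ^ 2 * (|y.1 i| ^ (2 * α - 2) * |y.1 j| ^ (2 * α) +
      |y.1 j| ^ (2 * α - 2) * |y.1 i| ^ (2 * α)) -
      4 * α ^ 2 * (|y.1 i| ^ (2 * α) * |y.1 j| ^ (2 * α))) ∂(measureM n q) =
      α ^ 2 * (2 * sphereMoment n q (2 * α - 2) (2 * α)) -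
        4 * α ^ 2 * sphereMoment n q (2 * α) (2 * α) := by
    rw [integral_sub ((m1.1.fun_add m2.1).const_mul _) (m0.1.const_mul _), integral_const_mul,
      integral_const_mul, integral_add m1.1 m2.1, m0.2, m1.2, m2.2, two_mul (sphereMoment n q _ _)]
  have hdom : Integrable (fun y : UnitSphere n => (32 + 8 * |y.1 i| ^ (2 * α - 2)) * 3 ^ 2 +
      3 ^ 2 * (32 + 8 * |y.1 j| ^ (2 * α - 2))) (measureM n q) := by fun_prop
  -- In the limit the radial component of the gradient is `2α` times the function, by homogeneity of
  -- degree `2α`; this is the subtracted term with factor `4α²`.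
  have t3 : Filter.Tendsto (fun k => ∫ y, ‖sphereGrad (f k) y‖ ^ 2 ∂(measureM n q)) Filter.atTop
      (nhds (α ^ 2 * (2 * sphereMoment n q (2 * α - 2) (2 * α)) -
        4 * α ^ 2 * sphereMoment n q (2 * α) (2 * α))) := by
    rw [← hint]
    refine tendsto_integral_of_dominated_convergence _
      (fun k => ((measurable_sphereGrad (f k)).norm.pow_const 2).aestronglyMeasurable)
      hdom (fun k => ?_) ?_
    · filter_upwards [hne] with y hy
      rw [Real.norm_of_nonneg (by positivity), hgr, mul_pow, mul_pow]
      have hr : ∀ l, regPow α (e k) (y.1 l) ^ 2 ≤ 3 ^ 2 := fun l => by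
        rw [← sq_abs]; exact pow_le_pow_left₀ (abs_nonneg _) (hreg k y l) 2
      have hr' : ∀ l, regPowDeriv α (e k) (y.1 l) ^ 2 ≤ 32 + 8 * |y.1 l| ^ (2 * α - 2) := fun l =>
        regPowDeriv_sq_le hα hα2 (he0 k) (he1 k) (hy l) (abs_coord_le_one y l)
      refine (sub_le_self _ (sq_nonneg _)).trans (add_le_add ?_ ?_)
      · exact mul_le_mul (hr' i) (hr j) (sq_nonneg _) (by positivity)
      · exact mul_le_mul (hr i) (hr' j) (sq_nonneg _) (by positivity)
    · filter_upwards [hne] with y hy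
      simp only [hgr]
      have a := fun l => tendsto_regPow α (hy l) he
      have b := fun l => tendsto_regPowDeriv α (hy l) he
      have h := (((b i).mul (a j)).pow 2).add (((a i).mul (b j)).pow 2) |>.sub
        (((((b i).mul (a j)).mul_const (y.1 i)).add (((a i).mul (b j)).mul_const (y.1 j))).pow 2)
      refine h.trans_eq ?_
      rw [habs _ (hy i), habs _ (hy j), habs', habs']
      congr 1
      ring
  have key : ∀ k, ∫ y, f k y ^ 2 ∂(measureM n q) - (∫ y, f k y ∂(measureM n q)) ^ 2 ≤
      C * ∫ y, ‖sphereGrad (f k) y‖ ^ 2 ∂(measureM n q) := fun k => by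
    have h := hC (f k) (hfs k) (fun y => by simp [hf, regPow_neg])
    rwa [variance_eq_sub (MemLp.of_bound (hfm k) 9 (.of_forall (hfb k)))] at h
  have h := le_of_tendsto_of_tendsto' (t2.sub (t1.pow 2)) (t3.const_mul C) key
  rw [hD, sub_add_cancel] at hrec
  -- The recursion coefficient `2/q + 2α - 2` equals `α`, because `2/q = 2 - α`.
  have hrec' : (2 * α - 2 + 2 * α + n * (2 / q)) * sphereMoment n q (2 * α) (2 * α) =
      α * sphereMoment n q (2 * α - 2) (2 * α) := by
    rw [hrec]; congr 1; linarith
  have h1 : sphereMoment n q (2 * α) (2 * α) * 1 ≤ sphereMoment n q (2 * α) (2 * α) *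
      (C * (2 * α * (n * (2 / q) + 2 * α - 2))) := by
    calc _ ≤ _ := by simpa using h
      _ = C * (2 * α * (α * sphereMoment n q (2 * α - 2) (2 * α)) -
          4 * α ^ 2 * sphereMoment n q (2 * α) (2 * α)) := by ring
      _ = _ := by rw [← hrec']; ring
  have h2 := le_of_mul_le_mul_left h1 hpos
  -- The limiting ratio of energy to variance is `λ(λ + 2n/q - 2)` at `λ = 2α`, matching the upper
  -- bound.
  have e3 : 2 * α * (n * (2 / q) + 2 * α - 2) = 8 * (q - 1) * (n + q - 2) / q ^ 2 := by
    rw [hαq]; field_simp; ring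
  have hq1 : 0 < q - 1 := by linarith
  have hnq : 0 < n + q - 2 := by linarith
  rw [e3, mul_div_assoc', one_le_div (by positivity)] at h2
  rwa [div_le_iff₀ (by positivity)]

theorem mainTheorem5 (n : ℕ) (hn : 2 ≤ n) (q : ℝ) (hq : 1 < q) :
    IsProbabilityMeasure (measureM n q) ∧
    IsLeast {C : ℝ | EvenPoincare (measureM n q) LocallyLipschitz C}
      (max (q / (4 * n)) (q ^ 2 / (8 * (q - 1) * (n + q - 2)))) ∧
    IsLeast {C : ℝ | EvenPoincare (measureM n q) SphereSmooth C}
      (max (q / (4 * n)) (q ^ 2 / (8 * (q - 1) * (n + q - 2)))) := by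
  -- Smooth functions are locally Lipschitz, so the upper bound for the larger class and the lower
  -- bound for the smaller one settle both.
  have smooth : ∀ {C}, EvenPoincare (measureM n q) LocallyLipschitz C →
      EvenPoincare (measureM n q) SphereSmooth C := fun h f hf => h f hf.locallyLipschitz
  have lower : ∀ {C}, EvenPoincare (measureM n q) SphereSmooth C →
      max (q / (4 * n)) (q ^ 2 / (8 * (q - 1) * (n + q - 2))) ≤ C := fun h =>
    max_le (le_of_evenPoincare_smooth_sq hn hq h) (le_of_evenPoincare_smooth_regPow hn hq h)
  have upper := evenPoincare_locallyLipschitz hn hq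
  exact ⟨isProbabilityMeasure_measureM (by omega) (by linarith),
    ⟨upper, fun _ h => lower (smooth h)⟩, smooth upper, fun _ h => lower h⟩
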